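/- Let $X=(X_t)_{t\ge 0}$ be an upwards skip-free Lévy chain on a probability space $(\Omega,\mathcal F,\mathsf P)$ with a filtration $\mathbb F$. That is, every path of $X$ is càdlàg, $X_0=0$ a.s., $X$ is $\mathbb F$-adapted with stationary increments that are independent relative to $\mathbb F$, and $X$ is a compound Poisson process, with $\mathsf E[e^{ipX_t}]=\exp\{t\int(e^{ipx}-1)\lambda(dx)\}$ for a finite nonzero Lévy measure $\lambda$ with $\lambda(\{0\})=0$. Moreover, for some $h>0$, $\mathrm{supp}(\lambda)\subset\mathbb Z_h:=\{hk:k\in\mathbb Z\}$ and $\mathrm{supp}(\lambda|_{(0,\infty)})=\{h\}$. For $x\in\mathbb R$ put $T_x:=\inf\{t\ge 0:X_t\ge x\}$ and for $x\ge 0$ put $T_x^-:=\inf\{t\ge0:X_t<-x\}$ ($\inf\emptyset=\infty$). Let $\psi(\beta):=\int(e^{\beta x}-1)\lambda(dx)$ ($\beta\ge0$), let $\Phi(0)$ be the largest root of $\psi$ on $[0,\infty)$, and let $\Phi:[0,\infty)\to[\Phi(0),\infty)$ be the inverse of the bijection $\psi|_{[\Phi(0),\infty)}$. The scale functions are defined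 as follows. (a) For $c\ge 0$ let $\mathsf P_c$ be the unique measure on the canonical space of càdlàg paths $[0,\infty)\to\mathbb Z_h$ (with the $\sigma$-algebra of the evaluation maps) such that $\mathsf P_c(\Lambda)=\mathsf E[e^{cX_t-\psi(c)t}\mathbf 1_{\{X\in\Lambda\}}]$ for all $t\ge0$ and all events $\Lambda$ in the $\sigma$-algebra of the evaluation maps up to time $t$. Under $\mathsf P_c$ the coordinate process is an upwards skip-free Lévy chain with Lévy measure $\lambda_c(dx)=e^{cx}\lambda(dx)$; let $\psi_c$ and $\Phi_c(0)$ denote its $\psi$ and $\Phi(0)$. (b) Let $D_1:=\sup\{-X_t: 0\le t<T_h\}\in[0,\infty]$ be the depth that the chain reaches before it attains the new maximum $h$. For $x\ge0$ set $W_c(x):=C_c\big/\prod_{r=1}^{\lfloor x/h\rfloor}\mathsf P_c(D_1\le (r-1)h)$, where the constant $C_c>0$ is such that $\int_0^\infty e^{-\beta x}W_c(x)\,dx=\dfrac{e^{\beta h}-1}{\beta h\,\psi_c(\beta)}$ for all $\beta>\Phi_c(0)$. (c) For $q\ge0$ and $x\ge 0$ let $W^{(q)}(x):=e^{\Phi(q)\lfloor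 1+x/h\rfloor h}\,W_{\Phi(q)}(x)$ and $Z^{(q)}(x):=1+q\int_0^{\lfloor x/h\rfloor h}W^{(q)}(z)\,dz$. **Proposition.** For all $q\ge 0$, $x\ge 0$ and $y\in\mathbb Z_h$ with $y\ge 0$, the random variable $e^{-qT_x^-}\mathbf 1_{\{T_x^-<T_y\}}$ is integrable and $$\mathsf E\big[e^{-qT_x^-}\mathbf 1_{\{T_x^-<T_y\}}\big]=Z^{(q)}(x)-Z^{(q)}(x+y)\,\frac{W^{(q)}(x)}{W^{(q)}(x+y)}.$$ -/

import Mathlib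

open MeasureTheory ProbabilityTheory Filter Topology
open scoped NNReal ENNReal

namespace LevyChain

/-- The lattice `ℤ_h = {h k : k ∈ ℤ}`. -/
def lattice (h : ℝ) : Set ℝ := {x | ∃ k : ℤ, x = h * k}

/-- Càdlàg functions on `[0, ∞)`: right-continuous with (finite) left limits.  (At `t = 0` the
left-hand condition is void, since `𝓝[<] 0 = ⊥` in `ℝ≥0`.) -/
def IsCadlag (f : ℝ≥0 → ℝ) : Prop :=
  ∀ t, ContinuousWithinAt f (Set.Ici t) t ∧ ∃ l, Tendsto f (𝓝[<] t) (𝓝 l)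

/-- `X` is a Lévy process relative to the filtration `ℱ`, with all paths càdlàg. -/
structure IsLevyProcess {Ω : Type*} [mΩ : MeasurableSpace Ω] (P : Measure Ω)
    (ℱ : Filtration ℝ≥0 mΩ) (X : ℝ≥0 → Ω → ℝ) : Prop where
  adapted : ∀ t, Measurable[ℱ t] (X t)
  cadlag : ∀ ω, IsCadlag (fun t => X t ω)
  start : ∀ᵐ ω ∂P, X 0 ω = 0
  stationary : ∀ s t, s ≤ t → IdentDistrib (fun ω => X t ω - X s ω) (X (t - s)) P P
  indep : ∀ s t, s ≤ t →
    Indep (MeasurableSpace.comap (fun ω => X t ω - X s ω) inferInstance) (ℱ s) P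

/-- `X` is a compound Poisson process with Lévy measure `lam`: a Lévy process whose
characteristic exponent is `∫ (exp (i p x) - 1) lam(dx)`, with `lam` finite, nonzero and not
charging `0`. -/
structure IsCompoundPoisson {Ω : Type*} [mΩ : MeasurableSpace Ω] (P : Measure Ω)
    (ℱ : Filtration ℝ≥0 mΩ) (X : ℝ≥0 → Ω → ℝ) (lam : Measure ℝ) : Prop
    extends IsLevyProcess P ℱ X where
  finite : IsFiniteMeasure lam
  nonzero : lam ≠ 0
  no_atom : lam {0} = 0
  charExponent : ∀ (t : ℝ≥0) (p : ℝ),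
    ∫ ω, Complex.exp (Complex.I * p * X t ω) ∂P
      = Complex.exp (t * ∫ x : ℝ, (Complex.exp (Complex.I * p * x) - 1) ∂lam)

/-- `X` is an upwards skip-free Lévy chain with Lévy measure `lam` and step `h > 0`: a compound
Poisson process with `supp lam ⊆ ℤ_h` and `supp (lam restricted to (0, ∞)) = {h}`. -/
structure IsUpwardsSkipFreeLevyChain {Ω : Type*} [mΩ : MeasurableSpace Ω] (P : Measure Ω)
    (ℱ : Filtration ℝ≥0 mΩ) (X : ℝ≥0 → Ω → ℝ) (lam : Measure ℝ) (h : ℝ) : Prop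
    extends IsCompoundPoisson P ℱ X lam where
  step_pos : 0 < h
  support_subset : lam.support ⊆ lattice h
  support_pos : (lam.restrict (Set.Ioi 0)).support = {h}

/-- `T_x = inf {t ≥ 0 : f t ≥ x}` for a path `f`, with `inf ∅ = ∞`. -/
noncomputable def entranceAbove (x : ℝ) (f : ℝ≥0 → ℝ) : ℝ≥0∞ :=
  ⨅ (t : ℝ≥0) (_ : x ≤ f t), (t : ℝ≥0∞)

/-- `T_x^- = inf {t ≥ 0 : f t < -x}` for a path `f`, with `inf ∅ = ∞`. -/
noncomputable def entranceBelow (x : ℝ) (f : ℝ≥0 → ℝ) : ℝ≥0∞ :=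
  ⨅ (t : ℝ≥0) (_ : f t < -x), (t : ℝ≥0∞)

/-- The Laplace exponent `ψ(β) = ∫ (exp (β x) - 1) lam(dx)`. -/
noncomputable def psi (lam : Measure ℝ) (β : ℝ) : ℝ := ∫ x, (Real.exp (β * x) - 1) ∂lam

/-- `Φ(0)`: the largest root of `ψ` on `[0, ∞)`. -/
noncomputable def PhiZero (lam : Measure ℝ) : ℝ := sSup {β | 0 ≤ β ∧ psi lam β = 0}

/-- `Φ : [0, ∞) → [Φ(0), ∞)`: the inverse of the bijection `ψ : [Φ(0), ∞) → [0, ∞)`. -/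
noncomputable def Phi (lam : Measure ℝ) (q : ℝ) : ℝ :=
  Function.invFunOn (psi lam) (Set.Ici (PhiZero lam)) q

/-- The canonical space `𝔻_h` of càdlàg paths `[0, ∞) → ℤ_h`, with the `σ`-algebra generated by the
evaluation maps (the instance that Lean finds for a subtype of a product). -/
abbrev PathSpace (h : ℝ) : Type := {f : ℝ≥0 → ℝ // IsCadlag f ∧ ∀ t, f t ∈ lattice h}

/-- The defining property of the exponential change of measure `P_c` on the canonical space:
`P_c(Λ) = E[exp (c X_t - ψ(c) t) 1_Λ]` for `t ≥ 0` and `Λ ∈ σ(X_s : s ≤ t)`.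
The events `Λ` are written as `{(X_s)_{s ≤ t} ∈ B}` with `B` in the product `σ`-algebra. -/
def IsExpTilt {Ω : Type*} [MeasurableSpace Ω] (P : Measure Ω) (X : ℝ≥0 → Ω → ℝ)
    (lam : Measure ℝ) (h c : ℝ) (Q : Measure (PathSpace h)) : Prop :=
  ∀ (t : ℝ≥0) (B : Set (Set.Iic t → ℝ)), MeasurableSet B →
    Q {f | (fun s : Set.Iic t => f.1 s) ∈ B}
      = ∫⁻ ω in {ω | (fun s : Set.Iic t => X s ω) ∈ B},
          ENNReal.ofReal (Real.exp (c * X t ω - psi lam c * t)) ∂P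

/-- The measure `P_c` on the canonical space: the unique measure with `IsExpTilt`. -/
noncomputable def expTilt {Ω : Type*} [MeasurableSpace Ω] (P : Measure Ω) (X : ℝ≥0 → Ω → ℝ)
    (lam : Measure ℝ) (h c : ℝ) : Measure (PathSpace h) :=
  Classical.epsilon (IsExpTilt P X lam h c)

/-- The Lévy measure `exp (c x) lam(dx)` of the chain under `P_c`. -/
noncomputable def levyTilt (lam : Measure ℝ) (c : ℝ) : Measure ℝ :=
  lam.withDensity (fun x => ENNReal.ofReal (Real.exp (c * x)))

/-- `D_1`: the depth (possibly `0` or `+∞`) below the maximum `0` that a path starting at `0` goes to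
before it reaches the new maximum `h`. -/
noncomputable def depth (h : ℝ) (f : ℝ≥0 → ℝ) : EReal :=
  ⨆ (t : ℝ≥0) (_ : (t : ℝ≥0∞) < entranceAbove h f), ((-(f t) : ℝ) : EReal)

/-- The scale function before normalization:
`1 / ∏_{r = 1}^{⌊x / h⌋} Q(D_1 ≤ (r - 1) h)` for `x ≥ 0`. -/
noncomputable def scaleRaw (h : ℝ) (Q : Measure (PathSpace h)) (x : ℝ) : ℝ :=
  1 / ∏ r ∈ Finset.Icc 1 ⌊x / h⌋₊,
    (Q {f | depth h f.1 ≤ ((((r : ℝ) - 1) * h : ℝ) : EReal)}).toReal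

/-- The multiplicative constant `C` for which `C * scaleRaw` has Laplace transform
`(exp (β h) - 1) / (β h ψ(β))` for `β > Φ(0)`; here `nu` is the Lévy measure of the chain with
law `Q`, and `ψ`, `Φ` are those of `nu`. -/
noncomputable def scaleConst (h : ℝ) (nu : Measure ℝ) (Q : Measure (PathSpace h)) : ℝ :=
  Classical.epsilon fun C : ℝ => 0 < C ∧ ∀ β, PhiZero nu < β →
    ∫ x in Set.Ioi (0 : ℝ), Real.exp (-(β * x)) * (C * scaleRaw h Q x)
      = (Real.exp (β * h) - 1) / (β * h * psi nu β)

/-- The scale function `W` of the chain with law `Q` and Lévy measure `nu`, extended by `0` to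
`(-∞, 0)`. -/
noncomputable def scaleW (h : ℝ) (nu : Measure ℝ) (Q : Measure (PathSpace h)) (x : ℝ) : ℝ :=
  if 0 ≤ x then scaleConst h nu Q * scaleRaw h Q x else 0

/-- `W^{(q)}(x) = exp (Φ(q) ⌊1 + x / h⌋ h) W_{Φ(q)}(x)`, where `W_c` is the scale function of the
chain under `P_c`. -/
noncomputable def scaleWq {Ω : Type*} [MeasurableSpace Ω] (P : Measure Ω) (X : ℝ≥0 → Ω → ℝ)
    (lam : Measure ℝ) (h q x : ℝ) : ℝ :=
  Real.exp (Phi lam q * ⌊1 + x / h⌋ * h) *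
    scaleW h (levyTilt lam (Phi lam q)) (expTilt P X lam h (Phi lam q)) x

/-- `Z^{(q)}(x) = 1 + q ∫_0^{⌊x / h⌋ h} W^{(q)}(z) dz` for `x ≥ 0`, extended by `1` to `(-∞, 0)`. -/
noncomputable def scaleZq {Ω : Type*} [MeasurableSpace Ω] (P : Measure Ω) (X : ℝ≥0 → Ω → ℝ)
    (lam : Measure ℝ) (h q x : ℝ) : ℝ :=
  if 0 ≤ x then 1 + q * ∫ z in (0 : ℝ)..(⌊x / h⌋ * h), scaleWq P X lam h q z else 1

end LevyChain

namespace LevyChain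

/-! ### Left-continuous walks on the integers: generator and scale function -/

/-! In units of `h` the chain is a walk on ℤ with jumps `1 - i` at rates `p i`. Let `w` have
generating function `p 0 / (P(z) - s z)`, where `P` is the power series of `p` and `s = q + ∑ p i`,
and extend `w` by zero to the negatives. Reading off coefficients, the generator applied to `w` on ℕ
gives `q w`. The function `Z k = 1 + (q / p 0) ∑_{j < k} w j` has the same property and equals 1 on
the nonpositive integers. Put `n = ⌊x/h⌋` and `y = h m`. Then `F = Z - (Z (n+m) / w (n+m)) w` is
`q`-harmonic on ℕ, equals 1 below 0 and vanishes at `n + m`. Since upward jumps have size one, the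
walk started at `n` leaves `[0, n+m)` either strictly below 0 or at `n + m`. Optional stopping of
`exp (-q t) F` at the exit identifies the required expectation with `F n`, which is the asserted
formula (`IsWalkProcess.integral_exit`, `walkGen_walkScaleSum_sub`).

It remains to match `w` and `Z` with `W^{(q)}` and `Z^{(q)}`, which are defined from the depth `D_1`
under the tilted measure. Under `P_c` with `c = Φ(q)` the rates are `p i * u^(1-i)`, `u = exp (c
h)`, with total mass `q + ∑ p i`; so the undiscounted `w` of the tilted walk is harmonic for it.
Optional stopping on `[-r, 1)` gives `P_c(D_1 ≤ r h) = w r / w (r+1)` (`walkScale_mul_depth`), and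
the product defining `W_c` telescopes to `w`. The Laplace transform fixes the constant as `1 / (h p
0)` with the tilted `p 0` (`scaleConst_eq`), and rescaling the generating function undoes the tilt
(`walkScale_zpow_mul`, `scaleWq_eq`).

Two analytic points carry the rest. Optional stopping is proved by discretizing time: a single step
of length δ has error `O(δ²)` by the compound Poisson expansion, uniformly over past events. And
since `P_c` is obtained by a choice operator, its existence on the path space must be proved; it is
built by concatenating independent unit-time blocks (`exists_isExpTilt`). -/

/-- The generator `∑ i, p i * (g (k + 1 - i) - g k)` of the skip-free walk on `ℤ` that jumps by
`1 - i` at rate `p i`. -/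
noncomputable def walkGen (p : ℕ → ℝ) (g : ℤ → ℝ) (k : ℤ) : ℝ :=
  ∑' i : ℕ, p i * (g (k + 1 - i) - g k)

/-- The coefficients of `p 0 / (∑ i, p i X ^ i - s X)`. -/
noncomputable def walkScale (p : ℕ → ℝ) (s : ℝ) (n : ℕ) : ℝ :=
  PowerSeries.coeff n (PowerSeries.C (p 0) *
    (PowerSeries.mk p - PowerSeries.C s * PowerSeries.X)⁻¹)

/-- The extension of `walkScale` by `0` to the negative integers. -/
noncomputable def walkScaleInt (p : ℕ → ℝ) (s : ℝ) (k : ℤ) : ℝ :=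
  if 0 ≤ k then walkScale p s k.toNat else 0

lemma walkScaleInt_natCast (p : ℕ → ℝ) (s : ℝ) (n : ℕ) :
    walkScaleInt p s n = walkScale p s n := by
  simp [walkScaleInt]

lemma walkScaleInt_of_neg (p : ℕ → ℝ) (s : ℝ) {k : ℤ} (hk : k < 0) :
    walkScaleInt p s k = 0 := by
  simp [walkScaleInt, hk]

lemma mk_mul_walkScale {p : ℕ → ℝ} (h0 : p 0 ≠ 0) (s : ℝ) :
    PowerSeries.mk p * PowerSeries.mk (walkScale p s) =
      PowerSeries.C (p 0) + PowerSeries.X * (PowerSeries.C s * PowerSeries.mk (walkScale p s)) := by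
  set A : PowerSeries ℝ := PowerSeries.mk p - PowerSeries.C s * PowerSeries.X with hA
  have hW : PowerSeries.mk (walkScale p s) = PowerSeries.C (p 0) * A⁻¹ := by
    ext n; simp [walkScale, hA]
  have hc : PowerSeries.constantCoeff A ≠ 0 := by
    simp [hA, h0]
  have hmul := PowerSeries.mul_inv_cancel A hc
  have hp : PowerSeries.mk p = A + PowerSeries.C s * PowerSeries.X := by simp [hA]
  rw [hW, hp]
  linear_combination (PowerSeries.C (p 0)) * hmul

lemma walkScale_zero {p : ℕ → ℝ} (h0 : p 0 ≠ 0) (s : ℝ) : walkScale p s 0 = 1 := by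
  have h := congrArg (PowerSeries.coeff 0) (mk_mul_walkScale h0 s)
  rw [PowerSeries.coeff_mul] at h
  simp at h
  exact mul_left_cancel₀ h0 (by rw [h, mul_one])

lemma sum_antidiagonal_walkScale {p : ℕ → ℝ} (h0 : p 0 ≠ 0) (s : ℝ) (n : ℕ) :
    ∑ ij ∈ Finset.HasAntidiagonal.antidiagonal (n + 1), p ij.1 * walkScale p s ij.2 = s * walkScale p s n := by
  have h := congrArg (PowerSeries.coeff (n + 1)) (mk_mul_walkScale h0 s)
  rw [PowerSeries.coeff_mul, map_add, PowerSeries.coeff_succ_X_mul, PowerSeries.coeff_C_mul] at h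
  simpa [PowerSeries.coeff_C] using h

lemma hasSum_mul_walkScaleInt {p : ℕ → ℝ} (h0 : p 0 ≠ 0) (s : ℝ) (n : ℕ) :
    HasSum (fun i : ℕ => p i * walkScaleInt p s ((n : ℤ) + 1 - i)) (s * walkScale p s n) := by
  rw [← sum_antidiagonal_walkScale h0, Finset.Nat.sum_antidiagonal_eq_sum_range_succ
    (fun i j => p i * walkScale p s j)]
  have key : ∑ i ∈ Finset.range (n + 1 + 1), p i * walkScale p s (n + 1 - i)
      = ∑ i ∈ Finset.range (n + 1 + 1), p i * walkScaleInt p s ((n : ℤ) + 1 - i) := by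
    refine Finset.sum_congr rfl fun i hi => ?_
    have hi' : i ≤ n + 1 := by simpa [Nat.lt_succ_iff] using hi
    rw [show ((n : ℤ) + 1 - i) = ((n + 1 - i : ℕ) : ℤ) by omega, walkScaleInt_natCast]
  rw [key]
  refine hasSum_sum_of_ne_finset_zero fun i hi => ?_
  rw [walkScaleInt_of_neg, mul_zero]
  simp at hi
  omega

/-- Coefficient `n + 1` of the defining power series identity is the recursion `∑ p i w(n+1-i) = s
w(n)`; the zero extension absorbs the indices `i > n + 1`. Hence `w` is an eigenfunction of the
generator on ℕ, harmonic exactly when `s = ∑ p i`. -/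
lemma hasSum_walkGen_walkScaleInt {p : ℕ → ℝ} (h0 : p 0 ≠ 0) (hs : Summable p) (s : ℝ) (n : ℕ) :
    HasSum (fun i : ℕ => p i * (walkScaleInt p s ((n : ℤ) + 1 - i) - walkScaleInt p s n))
      ((s - ∑' i, p i) * walkScale p s n) := by
  have h := (hasSum_mul_walkScaleInt h0 s n).sub (hs.hasSum.mul_right (walkScale p s n))
  rw [sub_mul]
  refine h.congr_fun ?_ |> fun h => h
  intro i
  rw [walkScaleInt_natCast, mul_sub]

/-- A function with nonnegative generator on `ℕ` that is monotone on the negative half-line is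
monotone. -/
lemma monotone_of_walkGen_nonneg {p : ℕ → ℝ} (hp : ∀ i, 0 ≤ p i) (h0 : 0 < p 0) {g : ℤ → ℝ}
    (hneg : MonotoneOn g (Set.Iic 0))
    (hsum : ∀ n : ℕ, Summable fun i : ℕ => p i * (g ((n : ℤ) + 1 - i) - g n))
    (hgen : ∀ n : ℕ, 0 ≤ walkGen p g n) : Monotone g := by
  have key : ∀ n : ℕ, MonotoneOn g (Set.Iic (n : ℤ)) := by
    intro n
    induction n with
    | zero => simpa using hneg
    | succ n ih =>
      have h1 := hgen n
      rw [walkGen, (hsum n).tsum_eq_zero_add] at h1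
      -- Every jump except the upward one lands at or below `n`, where the induction hypothesis
      -- applies; nonnegativity of the generator thus rests on `g (n + 1) - g n`.
      have h2 : ∑' i : ℕ, p (i + 1) * (g ((n : ℤ) + 1 - (i + 1 : ℕ)) - g n) ≤ 0 := by
        refine tsum_nonpos fun i => mul_nonpos_of_nonneg_of_nonpos (hp _) (sub_nonpos.2 (ih ?_ ?_ ?_))
        · simp
        · simp
        · push_cast; omega
      have h3 : g n ≤ g (n + 1) := by
        simp only [Nat.cast_zero, sub_zero] at h1
        by_contra hlt
        push Not at hlt
        nlinarith
      intro a ha b hb hab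
      simp only [Set.mem_Iic] at ha hb
      push_cast at ha hb
      rcases hb.lt_or_eq with hb' | rfl
      · exact ih (by simp; omega) (by simp; omega) hab
      · rcases ha.lt_or_eq with ha' | rfl
        · exact (ih (by simp; omega) (by simp) (by omega)).trans h3
        · exact le_rfl
  intro a b hab
  exact key b.toNat (by simp; omega) (by simp) hab

lemma monotone_walkScaleInt {p : ℕ → ℝ} (hp : ∀ i, 0 ≤ p i) (h0 : 0 < p 0) (hs : Summable p) :
    Monotone (walkScaleInt p (∑' i, p i)) := by
  refine monotone_of_walkGen_nonneg hp h0 ?_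
    (fun n => (hasSum_walkGen_walkScaleInt h0.ne' hs _ n).summable) fun n => ?_
  · intro a ha b hb hab
    simp only [Set.mem_Iic] at ha hb
    rcases hab.lt_or_eq with h | rfl
    · rw [walkScaleInt_of_neg _ _ (h.trans_le hb)]
      rcases hb.lt_or_eq with hb | rfl
      · rw [walkScaleInt_of_neg _ _ hb]
      · have := walkScaleInt_natCast p (∑' i, p i) 0
        rw [walkScale_zero h0.ne', Nat.cast_zero] at this
        rw [this]; exact zero_le_one
    · exact le_rfl
  · rw [walkGen, (hasSum_walkGen_walkScaleInt h0.ne' hs _ n).tsum_eq]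
    simp

lemma one_le_walkScale {p : ℕ → ℝ} (hp : ∀ i, 0 ≤ p i) (h0 : 0 < p 0) (hs : Summable p) (n : ℕ) :
    1 ≤ walkScale p (∑' i, p i) n := by
  rw [← walkScale_zero h0.ne' (∑' i, p i), ← walkScaleInt_natCast, ← walkScaleInt_natCast]
  exact monotone_walkScaleInt hp h0 hs (by simp)

/-- Comparison principle: the exponential `u ^ (k + 1) / (u - 1)` has nonnegative generator, so its
difference with `w` is monotone. The factor `1 / (u - 1)` makes the increment of the exponential
from -1 to 0 equal to 1, the jump of `w` there. The bound gives the abscissa of convergence of the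
generating function of `w`. -/
lemma walkScale_le {p : ℕ → ℝ} (hp : ∀ i, 0 ≤ p i) (h0 : 0 < p 0) (hs : Summable p) {u : ℝ}
    (hu : 1 < u) {a : ℝ} (ha : 0 ≤ a)
    (hpu : HasSum (fun i : ℕ => p i * (u ^ (1 - i : ℤ) - 1)) a) (n : ℕ) :
    walkScale p (∑' i, p i) n ≤ u ^ (n + 1) / (u - 1) := by
  have hu0 : u ≠ 0 := by positivity
  set g : ℤ → ℝ := fun k => u ^ (k + 1) / (u - 1) - walkScaleInt p (∑' i, p i) k with hg
  have hsum : ∀ n : ℕ, HasSum (fun i : ℕ => p i * (g ((n : ℤ) + 1 - i) - g n))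
      (u ^ ((n : ℤ) + 1) / (u - 1) * a) := by
    intro n
    have h := (hpu.mul_left (u ^ ((n : ℤ) + 1) / (u - 1))).sub
      (hasSum_walkGen_walkScaleInt h0.ne' hs (∑' i, p i) n)
    rw [sub_self, zero_mul, sub_zero] at h
    refine h.congr_fun ?_ |> fun h => h
    intro i
    have : u ^ ((n : ℤ) + 1 - i + 1) = u ^ ((n : ℤ) + 1) * u ^ (1 - i : ℤ) := by
      rw [← zpow_add₀ hu0]; congr 1; ring
    simp only [hg, this]
    ring
  have hmono : Monotone g := by
    refine monotone_of_walkGen_nonneg hp h0 ?_ (fun n => (hsum n).summable) fun n => ?_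
    · intro x hx y hy hxy
      simp only [Set.mem_Iic] at hx hy
      have h1 : u ^ (x + 1) / (u - 1) ≤ u ^ (y + 1) / (u - 1) := by
        have : 0 < u - 1 := by linarith
        gcongr
        exact hu.le
      rcases hxy.lt_or_eq with h | rfl
      · simp only [hg]
        rw [walkScaleInt_of_neg _ _ (h.trans_le hy)]
        rcases hy.lt_or_eq with hy | rfl
        · rw [walkScaleInt_of_neg _ _ hy]; linarith
        · have := walkScaleInt_natCast p (∑' i, p i) 0
          rw [walkScale_zero h0.ne', Nat.cast_zero] at this
          rw [this]
          have hu1 : 0 < u - 1 := by linarith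
          have h2 : u ^ (x + 1) ≤ u ^ (0 : ℤ) := zpow_le_zpow_right₀ hu.le (by omega)
          have h3 : u ^ (x + 1) / (u - 1) ≤ 1 / (u - 1) := by
            gcongr; simpa using h2
          have h4 : u ^ ((0 : ℤ) + 1) / (u - 1) - 1 = 1 / (u - 1) := by
            field_simp; simp
          rw [h4]; linarith
      · exact le_rfl
    · rw [walkGen, (hsum n).tsum_eq]
      have h1 : 0 < u - 1 := by linarith
      have h2 : 0 < u ^ ((n : ℤ) + 1) := zpow_pos (by linarith) _
      exact mul_nonneg (div_nonneg h2.le h1.le) ha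
  have h1 := hmono (show (-1 : ℤ) ≤ n by omega)
  simp only [hg, walkScaleInt_natCast] at h1
  rw [walkScaleInt_of_neg _ _ (by norm_num : (-1 : ℤ) < 0)] at h1
  have h2 : 0 ≤ u ^ ((-1 : ℤ) + 1) / (u - 1) - 0 := by
    have : 0 < u - 1 := sub_pos.2 hu
    simpa using (inv_pos.2 this).le
  have h3 : u ^ ((n : ℤ) + 1) = u ^ (n + 1) := by
    rw [← zpow_natCast]; norm_cast
  rw [h3] at h1
  linarith

lemma tsum_walkScale_mul {p : ℕ → ℝ} (hp : ∀ i, 0 ≤ p i) (h0 : p 0 ≠ 0) (hs : Summable p) (s : ℝ)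
    {z : ℝ} (hz : 0 ≤ z) (hz1 : z ≤ 1)
    (hw : Summable fun n => ‖walkScale p s n * z ^ n‖) :
    (∑' n, walkScale p s n * z ^ n) * (∑' i, p i * z ^ i - s * z) = p 0 := by
  have hpz : Summable fun i => ‖p i * z ^ i‖ := by
    refine Summable.of_nonneg_of_le (fun _ => norm_nonneg _) (fun i => ?_) hs
    rw [Real.norm_of_nonneg (mul_nonneg (hp i) (pow_nonneg hz i))]
    exact mul_le_of_le_one_right (hp i) (pow_le_one₀ hz hz1)
  have h := tsum_mul_tsum_eq_tsum_sum_antidiagonal_of_summable_norm hpz hw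
  have hterm : ∀ n, ∑ kl ∈ Finset.HasAntidiagonal.antidiagonal n,
      p kl.1 * z ^ kl.1 * (walkScale p s kl.2 * z ^ kl.2)
      = z ^ n * ∑ kl ∈ Finset.HasAntidiagonal.antidiagonal n, p kl.1 * walkScale p s kl.2 := by
    intro n
    rw [Finset.mul_sum]
    refine Finset.sum_congr rfl fun kl hkl => ?_
    rw [← Finset.HasAntidiagonal.mem_antidiagonal.1 hkl, pow_add]
    ring
  have hsum := (summable_norm_sum_mul_antidiagonal_of_summable_norm hpz hw).of_norm
  rw [hsum.tsum_eq_zero_add] at h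
  have h2 : ∀ n, ∑ kl ∈ Finset.HasAntidiagonal.antidiagonal (n + 1),
      p kl.1 * z ^ kl.1 * (walkScale p s kl.2 * z ^ kl.2)
      = s * z * (walkScale p s n * z ^ n) := by
    intro n
    rw [hterm, sum_antidiagonal_walkScale h0, pow_succ]
    ring
  simp only [h2] at h
  rw [tsum_mul_left] at h
  simp [walkScale_zero h0] at h
  linear_combination h

end LevyChain
namespace LevyChain

/-! ### Skip-free measures, the Laplace exponent and the normalization of the scale function -/

/-- A nonzero finite measure carried by `{h, 0, -h, -2h, …}` that charges `h`. -/
structure IsSkipFreeMeasure (ν : Measure ℝ) (h : ℝ) : Prop where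
  finite : IsFiniteMeasure ν
  step_pos : 0 < h
  ae_mem : ∀ᵐ x ∂ν, ∃ i : ℕ, x = h * (1 - i)
  apply_step_ne_zero : ν {h} ≠ 0

/-- The mass of the jump `h * (1 - i)`. -/
noncomputable def jumpRate (ν : Measure ℝ) (h : ℝ) (i : ℕ) : ℝ := ν.real {h * (1 - i)}

lemma exp_zpow_one_sub (a : ℝ) (i : ℕ) :
    Real.exp a ^ (1 - i : ℤ) = Real.exp (a * (1 - i)) := by
  rw [← Real.rpow_intCast, ← Real.exp_mul]
  push_cast
  rfl

lemma jumpRate_nonneg (ν : Measure ℝ) (h : ℝ) (i : ℕ) : 0 ≤ jumpRate ν h i := measureReal_nonneg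

lemma IsUpwardsSkipFreeLevyChain.isSkipFreeMeasure {Ω : Type*} [mΩ : MeasurableSpace Ω]
    {P : Measure Ω} {ℱ : Filtration ℝ≥0 mΩ} {X : ℝ≥0 → Ω → ℝ} {lam : Measure ℝ} {h : ℝ}
    (hX : IsUpwardsSkipFreeLevyChain P ℱ X lam h) : IsSkipFreeMeasure lam h := by
  have hfin := hX.finite
  have h1 : ∀ᵐ x ∂lam, x ∈ lam.support := Measure.support_mem_ae
  have h2 : ∀ᵐ x ∂(lam.restrict (Set.Ioi 0)), x = h := by
    have : ∀ᵐ x ∂(lam.restrict (Set.Ioi 0)), x ∈ (lam.restrict (Set.Ioi 0)).support :=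
      Measure.support_mem_ae
    rwa [hX.support_pos] at this
  rw [ae_restrict_iff' measurableSet_Ioi] at h2
  refine ⟨hfin, hX.step_pos, ?_, fun h0 => ?_⟩
  · filter_upwards [h1, h2] with x hx1 hx2
    obtain ⟨k, hk⟩ := hX.support_subset hx1
    rcases le_or_gt k 0 with hk0 | hk0
    · refine ⟨(1 - k).toNat, ?_⟩
      have : (((1 - k).toNat : ℤ) : ℝ) = ((1 - k : ℤ) : ℝ) := by
        rw [Int.toNat_of_nonneg (by omega)]
      push_cast at this
      rw [this, hk]; ring
    · refine ⟨0, ?_⟩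
      rw [hx2 (by rw [hk]; exact mul_pos hX.step_pos (by exact_mod_cast hk0))]; simp
  · have h3 : lam (Set.Ioi 0) = 0 := by
      have : ∀ᵐ x ∂lam, x ∉ Set.Ioi (0 : ℝ) := by
        have h4 : ∀ᵐ x ∂lam, x ∉ ({h} : Set ℝ) := measure_eq_zero_iff_ae_notMem.1 h0
        filter_upwards [h2, h4] with x hx hx' hpos
        exact hx' (hx hpos)
      exact measure_eq_zero_iff_ae_notMem.2 this
    have h5 := hX.support_pos
    rw [Measure.restrict_eq_zero.2 h3, Measure.support_zero] at h5
    exact (Set.singleton_ne_empty h) h5.symm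

namespace IsSkipFreeMeasure

variable {ν : Measure ℝ} {h : ℝ} (hν : IsSkipFreeMeasure ν h)
include hν

lemma jumpRate_zero_pos : 0 < jumpRate ν h 0 := by
  have := hν.finite
  have h0 := hν.apply_step_ne_zero
  simp only [jumpRate, Nat.cast_zero, sub_zero, mul_one]
  exact ENNReal.toReal_pos h0 (measure_ne_top _ _)

lemma hasSum_integral {f : ℝ → ℝ} (hf : Integrable f ν) :
    HasSum (fun i : ℕ => jumpRate ν h i * f (h * (1 - i))) (∫ x, f x ∂ν) := by
  have hd : Pairwise (Function.onFun Disjoint fun i : ℕ => ({h * (1 - i)} : Set ℝ)) := by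
    intro i j hij
    simp only [Function.onFun, Set.disjoint_singleton, ne_eq]
    intro he
    have := mul_left_cancel₀ hν.step_pos.ne' he
    exact hij (by exact_mod_cast (sub_right_injective this))
  have hS := hasSum_integral_iUnion (μ := ν) (f := f) (fun i => measurableSet_singleton _) hd
    hf.integrableOn
  have hU : (⋃ i : ℕ, ({h * (1 - i)} : Set ℝ)) =ᵐ[ν] Set.univ := by
    filter_upwards [hν.ae_mem] with x hx
    obtain ⟨i, hi⟩ := hx
    apply propext
    change x ∈ (⋃ i : ℕ, ({h * (1 - i)} : Set ℝ)) ↔ x ∈ Set.univ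
    simp only [Set.mem_iUnion, Set.mem_singleton_iff, Set.mem_univ, iff_true]
    exact ⟨i, hi⟩
  rw [setIntegral_congr_set hU, setIntegral_univ] at hS
  simp only [integral_singleton, smul_eq_mul] at hS
  exact hS

lemma summable_jumpRate : Summable (jumpRate ν h) := by
  have := hν.finite
  simpa using (hν.hasSum_integral (integrable_const (1 : ℝ))).summable

lemma ae_le : ∀ᵐ x ∂ν, x ≤ h := by
  filter_upwards [hν.ae_mem] with x hx
  obtain ⟨i, rfl⟩ := hx
  have := hν.step_pos
  have : 0 ≤ h * (i : ℝ) := by positivity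
  linarith

lemma ae_norm_exp_le {β : ℝ} (hβ : 0 ≤ β) :
    ∀ᵐ x ∂ν, ‖Real.exp (β * x)‖ ≤ Real.exp (β * h) := by
  filter_upwards [hν.ae_le] with x hx
  rw [Real.norm_of_nonneg (Real.exp_pos _).le]
  exact Real.exp_le_exp.2 (mul_le_mul_of_nonneg_left hx hβ)

lemma integrable_exp {β : ℝ} (hβ : 0 ≤ β) : Integrable (fun x => Real.exp (β * x)) ν := by
  have := hν.finite
  exact Integrable.of_bound (by fun_prop) _ (hν.ae_norm_exp_le hβ)

lemma hasSum_psi {β : ℝ} (hβ : 0 ≤ β) :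
    HasSum (fun i : ℕ => jumpRate ν h i * (Real.exp (β * h) ^ (1 - i : ℤ) - 1)) (psi ν β) := by
  have := hν.finite
  refine (hν.hasSum_integral ((hν.integrable_exp hβ).sub (integrable_const 1))).congr_fun ?_
    |> fun h => h
  intro i
  rw [exp_zpow_one_sub]
  simp only [Pi.sub_apply]
  congr 3
  ring

/-- Keeping only the upward jump in the series for `ψ` plus the total mass. This forces `ψ → ∞`,
which bounds the roots and supplies the upper endpoint for the intermediate value theorem. -/
lemma le_psi {β : ℝ} (hβ : 0 ≤ β) :
    jumpRate ν h 0 * Real.exp (β * h) - ∑' i, jumpRate ν h i ≤ psi ν β := by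
  have h1 := hν.hasSum_psi hβ
  have h2 := h1.add hν.summable_jumpRate.hasSum
  have h3 := h2.summable.le_tsum 0 (fun i _ => by
    have : 0 < Real.exp (β * h) ^ (1 - i : ℤ) := zpow_pos (Real.exp_pos _) _
    have := mul_nonneg (jumpRate_nonneg ν h i) this.le
    linarith)
  rw [h2.tsum_eq] at h3
  simp at h3
  linarith

lemma continuousOn_psi : ContinuousOn (psi ν) (Set.Ici 0) := by
  have := hν.finite
  intro b hb
  have hb0 : (0 : ℝ) ≤ b := hb
  refine continuousWithinAt_of_dominated
    (bound := fun _ => Real.exp ((b + 1) * h) + 1) ?_ ?_ (integrable_const _) ?_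
  · exact Eventually.of_forall fun β => by fun_prop
  · have h1 : ∀ᶠ β in 𝓝[Set.Ici 0] b, β < b + 1 :=
      nhdsWithin_le_nhds (Iio_mem_nhds (by linarith))
    filter_upwards [h1, self_mem_nhdsWithin] with β hβ hβ0
    filter_upwards [hν.ae_norm_exp_le (β := β) hβ0] with x hx
    refine (norm_sub_le _ _).trans ?_
    rw [norm_one]
    gcongr
    refine hx.trans (Real.exp_le_exp.2 ?_)
    exact mul_le_mul_of_nonneg_right hβ.le hν.step_pos.le
  · exact Eventually.of_forall fun x => by fun_prop

lemma exists_psi_gt (a q : ℝ) : ∃ b, a ≤ b ∧ 0 ≤ b ∧ q < psi ν b := by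
  have h0 := hν.jumpRate_zero_pos
  have ht : Tendsto (fun β : ℝ => jumpRate ν h 0 * Real.exp (β * h) - ∑' i, jumpRate ν h i)
      atTop atTop :=
    tendsto_atTop_add_const_right _ _ ((Real.tendsto_exp_atTop.comp
      (tendsto_id.atTop_mul_const hν.step_pos)).const_mul_atTop h0)
  obtain ⟨b, hb1, hb2, hb3⟩ :=
    ((ht.eventually_gt_atTop q).and ((eventually_ge_atTop a).and (eventually_ge_atTop 0))).exists
  exact ⟨b, hb2, hb3, hb1.trans_le (hν.le_psi hb3)⟩

lemma bddAbove_roots : BddAbove {β | 0 ≤ β ∧ psi ν β = 0} := by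
  have h0 := hν.jumpRate_zero_pos
  refine ⟨(∑' i, jumpRate ν h i) / (jumpRate ν h 0 * h), fun β hβ => ?_⟩
  have h1 := hν.le_psi hβ.1
  rw [hβ.2] at h1
  have h2 := Real.add_one_le_exp (β * h)
  have h3 := hν.step_pos
  rw [le_div_iff₀ (by positivity)]
  nlinarith

lemma PhiZero_mem : PhiZero ν ∈ {β | 0 ≤ β ∧ psi ν β = 0} := by
  refine IsClosed.csSup_mem ?_ ⟨0, le_rfl, by simp [psi]⟩ hν.bddAbove_roots
  exact hν.continuousOn_psi.preimage_isClosed_of_isClosed isClosed_Ici isClosed_singleton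

lemma psi_pos {β : ℝ} (hβ : PhiZero ν < β) : 0 < psi ν β := by
  have hβ0 : 0 ≤ β := hν.PhiZero_mem.1.trans hβ.le
  by_contra hle
  push Not at hle
  obtain ⟨b, hab, hb0, hb⟩ := hν.exists_psi_gt β 0
  have hc : ContinuousOn (psi ν) (Set.Icc β b) :=
    hν.continuousOn_psi.mono fun x hx => hβ0.trans hx.1
  obtain ⟨x, hx, hx0⟩ := intermediate_value_Icc hab hc ⟨hle, hb.le⟩
  have : x ≤ PhiZero ν := le_csSup hν.bddAbove_roots ⟨hβ0.trans hx.1, hx0⟩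
  exact absurd (hx.1.trans this) (not_le.2 hβ)

lemma exists_psi_eq {q : ℝ} (hq : 0 ≤ q) : ∃ c ∈ Set.Ici (PhiZero ν), psi ν c = q := by
  obtain ⟨b, hab, hb0, hb⟩ := hν.exists_psi_gt (PhiZero ν) q
  have hc : ContinuousOn (psi ν) (Set.Icc (PhiZero ν) b) :=
    hν.continuousOn_psi.mono fun x hx => hν.PhiZero_mem.1.trans hx.1
  obtain ⟨x, hx, hx0⟩ := intermediate_value_Icc hab hc ⟨by rwa [hν.PhiZero_mem.2], hb.le⟩
  exact ⟨x, hx.1, hx0⟩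

/-- Surjectivity of `ψ` onto `[0, ∞)` is enough here: what follows depends on `Φ(q)` only through
`ψ(Φ(q)) = q` and `Φ(q) ≥ 0`. -/
lemma psi_Phi {q : ℝ} (hq : 0 ≤ q) : psi ν (Phi ν q) = q :=
  Function.invFunOn_eq (hν.exists_psi_eq hq)

lemma Phi_nonneg {q : ℝ} (hq : 0 ≤ q) : 0 ≤ Phi ν q :=
  hν.PhiZero_mem.1.trans (Function.invFunOn_mem (hν.exists_psi_eq hq))

lemma jumpRate_levyTilt (c : ℝ) (i : ℕ) :
    jumpRate (levyTilt ν c) h i = jumpRate ν h i * Real.exp (c * (h * (1 - i))) := by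
  have := hν.finite
  rw [jumpRate, levyTilt, measureReal_def, withDensity_apply _ (measurableSet_singleton _),
    lintegral_singleton, ENNReal.toReal_mul, ENNReal.toReal_ofReal (Real.exp_pos _).le, mul_comm]
  rfl

lemma levyTilt {c : ℝ} (hc : 0 ≤ c) : IsSkipFreeMeasure (levyTilt ν c) h := by
  have := hν.finite
  refine ⟨?_, hν.step_pos, (withDensity_absolutelyContinuous _ _).ae_le hν.ae_mem, fun h0 => ?_⟩
  · exact isFiniteMeasure_withDensity_ofReal (hν.integrable_exp hc).2
  · have h1 := hν.jumpRate_levyTilt c 0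
    have h2 := hν.jumpRate_zero_pos
    simp only [jumpRate, Nat.cast_zero, sub_zero, mul_one, measureReal_def, h0] at h1 h2
    have h3 := Real.exp_pos (c * h)
    simp only [ENNReal.toReal_zero] at h1
    exact (mul_pos h2 h3).ne h1

/-- For `c = Φ(q)` the total tilted rate is `q + ∑ p i`: killing at rate `q` is absorbed into the
tilt. -/
lemma tsum_jumpRate_levyTilt {c : ℝ} (hc : 0 ≤ c) :
    ∑' i, jumpRate (LevyChain.levyTilt ν c) h i = psi ν c + ∑' i, jumpRate ν h i := by
  have h1 := (hν.hasSum_psi hc).add hν.summable_jumpRate.hasSum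
  rw [← h1.tsum_eq]
  refine tsum_congr fun i => ?_
  rw [hν.jumpRate_levyTilt, exp_zpow_one_sub]
  rw [show c * (h * (1 - (i : ℝ))) = c * h * (1 - (i : ℝ)) by ring]
  ring

end IsSkipFreeMeasure

/-! ### Laplace transform of the scale function and the normalizing constant -/

lemma setIntegral_exp_Ico {β h : ℝ} (hβ : 0 < β) (hh : 0 < h) (n : ℕ) :
    ∫ x in Set.Ico (n * h : ℝ) ((n + 1 : ℕ) * h), Real.exp (-(β * x))
      = (1 - Real.exp (-(β * h))) / β * Real.exp (-(β * h)) ^ n := by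
  have hle : (n * h : ℝ) ≤ ((n + 1 : ℕ) * h) := by
    push_cast; nlinarith
  rw [setIntegral_congr_set Ico_ae_eq_Ioc, ← intervalIntegral.integral_of_le hle]
  have h1 : ∀ x : ℝ, Real.exp (-(β * x)) = Real.exp ((-β) * x) := fun x => by ring_nf
  simp_rw [h1]
  rw [intervalIntegral.integral_comp_mul_left _ (neg_ne_zero.2 hβ.ne'), integral_exp,
    ← Real.exp_nat_mul]
  have h2 : Real.exp (-β * ((n + 1 : ℕ) * h)) = Real.exp (-β * h) * Real.exp (n * (-β * h)) := by
    rw [← Real.exp_add]; congr 1; push_cast; ring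
  have h3 : Real.exp (-β * (n * h)) = Real.exp (n * (-β * h)) := by congr 1; ring
  rw [h2, h3, smul_eq_mul]
  field_simp
  ring

/-- The Laplace transform of a step function. -/
lemma setIntegral_exp_mul_step {β h : ℝ} (hβ : 0 < β) (hh : 0 < h) {a : ℕ → ℝ}
    (ha : ∀ n, 0 ≤ a n) (hs : Summable fun n => a n * Real.exp (-(β * h)) ^ n) :
    ∫ x in Set.Ioi (0 : ℝ), Real.exp (-(β * x)) * a ⌊x / h⌋₊
      = (1 - Real.exp (-(β * h))) / β * ∑' n, a n * Real.exp (-(β * h)) ^ n := by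
  set s : ℕ → Set ℝ := fun n => Set.Ico (n * h : ℝ) ((n + 1 : ℕ) * h) with hsdef
  have hU : (⋃ n, s n) = Set.Ici (0 : ℝ) := by
    ext x
    simp only [hsdef, Set.mem_iUnion, Set.mem_Ico, Set.mem_Ici]
    constructor
    · rintro ⟨n, hn, -⟩; exact le_trans (by positivity) hn
    · intro hx
      refine ⟨⌊x / h⌋₊, ?_, ?_⟩
      · rw [← le_div_iff₀ hh]; exact Nat.floor_le (by positivity)
      · rw [← div_lt_iff₀ hh]; push_cast; exact Nat.lt_floor_add_one _
  have hfl : ∀ n, ∀ x ∈ s n, ⌊x / h⌋₊ = n := by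
    intro n x hx
    have hx0 : 0 ≤ x := le_trans (by positivity) hx.1
    rw [Nat.floor_eq_iff (by positivity), le_div_iff₀ hh, div_lt_iff₀ hh]
    exact ⟨hx.1, by simpa using hx.2⟩
  have hm : ∀ n, MeasurableSet (s n) := fun n => measurableSet_Ico
  have hd : Pairwise (Function.onFun Disjoint s) := by
    intro i j hij
    refine Set.disjoint_left.2 fun x hi hj => hij ?_
    rw [← hfl i x hi, hfl j x hj]
  have hint : ∀ n, ∫ x in s n, Real.exp (-(β * x)) * a ⌊x / h⌋₊
      = (1 - Real.exp (-(β * h))) / β * (a n * Real.exp (-(β * h)) ^ n) := by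
    intro n
    rw [setIntegral_congr_fun (g := fun x => Real.exp (-(β * x)) * a n) (hm n)
      (fun x hx => by simp only [hfl n x hx]), integral_mul_const, setIntegral_exp_Ico hβ hh]
    ring
  have hon : ∀ n, IntegrableOn (fun x => Real.exp (-(β * x)) * a ⌊x / h⌋₊) (s n) := by
    intro n
    have : IntegrableOn (fun x => Real.exp (-(β * x)) * a n) (s n) :=
      (Continuous.integrableOn_Icc (by fun_prop)).mono_set Set.Ico_subset_Icc_self
    exact this.congr_fun (fun x hx => by simp only [hfl n x hx]) (hm n)
  have hI : IntegrableOn (fun x => Real.exp (-(β * x)) * a ⌊x / h⌋₊) (⋃ n, s n) := by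
    refine integrableOn_iUnion_of_summable_integral_norm hon ?_
    have : ∀ n, ∫ x in s n, ‖Real.exp (-(β * x)) * a ⌊x / h⌋₊‖
        = (1 - Real.exp (-(β * h))) / β * (a n * Real.exp (-(β * h)) ^ n) := by
      intro n
      rw [← hint]
      refine integral_congr_ae (Eventually.of_forall fun x => ?_)
      exact Real.norm_of_nonneg (mul_nonneg (Real.exp_pos _).le (ha _))
    simp_rw [this]
    exact hs.mul_left _
  have hS := hasSum_integral_iUnion hm hd hI
  simp_rw [hint] at hS
  rw [hU, integral_Ici_eq_integral_Ioi] at hS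
  rw [← hS.tsum_eq, tsum_mul_left]

namespace IsSkipFreeMeasure

variable {ν : Measure ℝ} {h : ℝ} (hν : IsSkipFreeMeasure ν h)
include hν

lemma setIntegral_exp_mul_walkScale {β : ℝ} (hβ : PhiZero ν < β) :
    ∫ x in Set.Ioi (0 : ℝ), Real.exp (-(β * x)) *
        walkScale (jumpRate ν h) (∑' i, jumpRate ν h i) ⌊x / h⌋₊
      = jumpRate ν h 0 * (Real.exp (β * h) - 1) / (β * psi ν β) := by
  set p := jumpRate ν h
  have h0 : 0 < p 0 := hν.jumpRate_zero_pos
  have hp : ∀ i, 0 ≤ p i := jumpRate_nonneg ν h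
  have hs : Summable p := hν.summable_jumpRate
  have hh := hν.step_pos
  -- The growth bound at an intermediate `b` makes the terms at `z = exp (-β h)` decay geometrically
  -- with ratio `exp ((b - β) h) < 1`.
  obtain ⟨b, hb1, hb2⟩ := exists_between hβ
  have hb0 : 0 < b := hν.PhiZero_mem.1.trans_lt hb1
  have hβ0 : 0 < β := hb0.trans hb2
  have hψ := hν.psi_pos hβ
  have hz : Real.exp (-(β * h)) = (Real.exp (β * h))⁻¹ := Real.exp_neg _
  have hu : 1 < Real.exp (b * h) := Real.one_lt_exp_iff.2 (by positivity)
  have hw1 : ∀ n, 0 ≤ walkScale p (∑' i, p i) n := fun n =>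
    zero_le_one.trans (one_le_walkScale hp h0 hs n)
  have hsum : Summable fun n => walkScale p (∑' i, p i) n * Real.exp (-(β * h)) ^ n := by
    have hgeo : Summable fun n : ℕ => Real.exp (b * h) / (Real.exp (b * h) - 1) *
        Real.exp (b * h - β * h) ^ n := by
      refine (summable_geometric_of_lt_one (Real.exp_pos _).le ?_).mul_left _
      rw [Real.exp_lt_one_iff]
      nlinarith
    refine Summable.of_nonneg_of_le (fun n => mul_nonneg (hw1 n) (by positivity)) (fun n => ?_) hgeo
    have h1 := walkScale_le hp h0 hs hu (hν.psi_pos hb1).le (hν.hasSum_psi hb0.le) n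
    calc _ ≤ Real.exp (b * h) ^ (n + 1) / (Real.exp (b * h) - 1) * Real.exp (-(β * h)) ^ n := by
          gcongr
      _ = _ := by
          rw [sub_eq_add_neg (b * h), Real.exp_add, mul_pow, pow_succ]; ring
  rw [setIntegral_exp_mul_step hβ0 hh hw1 hsum]
  have hz1 : Real.exp (-(β * h)) ≤ 1 := Real.exp_le_one_iff.2 (by
    have : 0 ≤ β * h := by positivity
    linarith)
  have hG := tsum_walkScale_mul hp h0.ne' hs (∑' i, p i) (Real.exp_pos _).le hz1
    (by simpa only [Real.norm_of_nonneg (mul_nonneg (hw1 _) (pow_nonneg (Real.exp_pos _).le _))]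
      using hsum)
  have hφ : ∑' i, p i * Real.exp (-(β * h)) ^ i - (∑' i, p i) * Real.exp (-(β * h))
      = Real.exp (-(β * h)) * psi ν β := by
    have h1 := ((hν.hasSum_psi hβ0.le).add hs.hasSum).mul_left (Real.exp (-(β * h)))
    rw [mul_add] at h1
    have h2 : ∑' i, p i * Real.exp (-(β * h)) ^ i
        = Real.exp (-(β * h)) * psi ν β + Real.exp (-(β * h)) * ∑' i, p i := by
      rw [← h1.tsum_eq]
      refine tsum_congr fun i => ?_
      rw [hz, zpow_sub₀ (Real.exp_pos _).ne', zpow_one, zpow_natCast, inv_pow]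
      field_simp
      ring
    rw [h2]; ring
  rw [hφ] at hG
  have hu0 := Real.exp_pos (β * h)
  set G := ∑' n, walkScale p (∑' i, p i) n * Real.exp (-(β * h)) ^ n
  rw [hz] at hG ⊢
  rw [eq_div_iff (by positivity)]
  rw [← hG]
  field_simp

/-- The normalizing constant of the scale function. -/
lemma scaleConst_eq {Q : Measure (PathSpace h)}
    (hQ : ∀ x, 0 ≤ x →
      scaleRaw h Q x = walkScale (jumpRate ν h) (∑' i, jumpRate ν h i) ⌊x / h⌋₊) :
    scaleConst h ν Q = 1 / (h * jumpRate ν h 0) := by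
  have h0 : 0 < jumpRate ν h 0 := hν.jumpRate_zero_pos
  have hh := hν.step_pos
  have hint : ∀ C β, PhiZero ν < β →
      ∫ x in Set.Ioi (0 : ℝ), Real.exp (-(β * x)) * (C * scaleRaw h Q x)
        = C * (jumpRate ν h 0 * (Real.exp (β * h) - 1) / (β * psi ν β)) := by
    intro C β hβ
    rw [← hν.setIntegral_exp_mul_walkScale hβ, ← integral_const_mul]
    refine setIntegral_congr_fun measurableSet_Ioi fun x hx => ?_
    simp only [hQ x (le_of_lt hx)]
    ring
  have hex : ∃ C : ℝ, 0 < C ∧ ∀ β, PhiZero ν < β →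
      ∫ x in Set.Ioi (0 : ℝ), Real.exp (-(β * x)) * (C * scaleRaw h Q x)
        = (Real.exp (β * h) - 1) / (β * h * psi ν β) := by
    refine ⟨1 / (h * jumpRate ν h 0), by positivity, fun β hβ => ?_⟩
    rw [hint _ β hβ]
    have h1 := hν.psi_pos hβ
    have h2 : 0 < β := hν.PhiZero_mem.1.trans_lt hβ
    field_simp
  -- The chosen constant satisfies the transform identity because `1 / (h p 0)` does; evaluating at
  -- one point, `Φ(0) + 1`, already determines it, since the transform there is nonzero.
  have hspec := (Classical.epsilon_spec hex).2 (PhiZero ν + 1) (by linarith)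
  change _ = _ at hspec
  rw [hint _ _ (by linarith)] at hspec
  have hψ := hν.psi_pos (β := PhiZero ν + 1) (by linarith)
  have hβ0 : 0 < PhiZero ν + 1 := by linarith [hν.PhiZero_mem.1]
  have he : 0 < Real.exp ((PhiZero ν + 1) * h) - 1 := by
    rw [sub_pos]; exact Real.one_lt_exp_iff.2 (by positivity)
  change scaleConst h ν Q * _ = _ at hspec
  generalize scaleConst h ν Q = C at hspec ⊢
  generalize Real.exp ((PhiZero ν + 1) * h) - 1 = E at he hspec
  field_simp at hspec ⊢
  linarith

end IsSkipFreeMeasure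

end LevyChain
namespace LevyChain

/-! ### Exit of a right-continuous lattice-valued Markov process from a bounded set -/

/-- A right-continuous process on `h ℤ` started at `0` whose one-step conditional expectations are,
to first order in the step, governed by the generator `walkGen p`. -/
structure IsWalkProcess {Ω : Type*} [MeasurableSpace Ω] (Q : Measure Ω) (Y : ℝ≥0 → Ω → ℝ)
    (h : ℝ) (p : ℕ → ℝ) : Prop where
  prob : IsProbabilityMeasure Q
  pos : 0 < h
  measurable : ∀ t, Measurable (Y t)
  right_cont : ∀ ω t, ContinuousWithinAt (fun s => Y s ω) (Set.Ici t) t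
  ae_lattice : ∀ᵐ ω ∂Q, ∀ t, Y t ω ∈ lattice h
  start : ∀ᵐ ω ∂Q, Y 0 ω = 0
  step : ∃ K : ℝ, 0 ≤ K ∧ ∀ (g : ℤ → ℝ) (M : ℝ), (∀ k, |g k| ≤ M) → ∀ t δ : ℝ≥0, δ ≤ 1 →
    ∀ E : Set Ω, MeasurableSet[MeasurableSpace.comap (fun ω (s : Set.Iic t) => Y s ω)
      MeasurableSpace.pi] E →
    |∫ ω in E, (g ⌊Y (t + δ) ω / h⌋ - g ⌊Y t ω / h⌋ - δ * walkGen p g ⌊Y t ω / h⌋) ∂Q|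
      ≤ K * M * (δ : ℝ) ^ 2

section Skeleton

variable {Ω : Type*} (Y : ℝ≥0 → Ω → ℝ) (h : ℝ) (A : Set ℤ) (δ : ℝ≥0) (q : ℝ) (g : ℤ → ℝ)

/-- The event that the skeleton with mesh `δ` stays in `A` at the times before `N`. -/
def skeletonStay (N : ℕ) : Set Ω := {ω | ∀ j < N, ⌊Y (j * δ) ω / h⌋ ∈ A}

/-- The discounted value of `g` at the `N`-th time of the skeleton. -/
noncomputable def skeletonVal (N : ℕ) (ω : Ω) : ℝ :=
  Real.exp (-(q * (N * δ))) * g ⌊Y (N * δ) ω / h⌋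

/-- `skeletonVal` stopped when the skeleton leaves `A`. -/
noncomputable def skeletonStop (N : ℕ) (ω : Ω) : ℝ :=
  skeletonVal Y h δ q g 0 ω + ∑ j ∈ Finset.range N, (skeletonStay Y h A δ (j + 1)).indicator
    (fun ω => skeletonVal Y h δ q g (j + 1) ω - skeletonVal Y h δ q g j ω) ω

variable {Y h A δ q g}

lemma skeletonStay_anti {m n : ℕ} (hmn : m ≤ n) :
    skeletonStay Y h A δ n ⊆ skeletonStay Y h A δ m :=
  fun _ hω j hj => hω j (hj.trans_le hmn)

lemma skeletonStop_of_mem {N : ℕ} {ω : Ω} (hω : ω ∈ skeletonStay Y h A δ N) :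
    skeletonStop Y h A δ q g N ω = skeletonVal Y h δ q g N ω := by
  induction N with
  | zero => simp [skeletonStop]
  | succ N ih =>
    have h1 := ih (skeletonStay_anti (Nat.le_succ N) hω)
    rw [skeletonStop, Finset.sum_range_succ, ← add_assoc, ← skeletonStop, h1,
      Set.indicator_of_mem hω]
    ring

lemma skeletonStop_of_exit {m N : ℕ} (hmN : m ≤ N) {ω : Ω} (hω : ω ∈ skeletonStay Y h A δ m)
    (hm : ⌊Y (m * δ) ω / h⌋ ∉ A) :
    skeletonStop Y h A δ q g N ω = skeletonVal Y h δ q g m ω := by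
  induction N, hmN using Nat.le_induction with
  | base => exact skeletonStop_of_mem hω
  | succ N hmN ih =>
    rw [skeletonStop, Finset.sum_range_succ, ← add_assoc, ← skeletonStop, ih,
      Set.indicator_of_notMem, add_zero]
    exact fun hN => hm (hN m (by omega))

lemma abs_skeletonVal_le (hq : 0 ≤ q) {M : ℝ} (hg : ∀ k, |g k| ≤ M) (N : ℕ) (ω : Ω) :
    |skeletonVal Y h δ q g N ω| ≤ M := by
  rw [skeletonVal, abs_mul, abs_of_pos (Real.exp_pos _)]
  refine (mul_le_of_le_one_left (abs_nonneg _) ?_).trans (hg _)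
  rw [Real.exp_le_one_iff, neg_nonpos]
  positivity

/-- The partial sums telescope, so the stopped value is `skeletonVal` at some index; the bound
therefore does not grow with the number of steps. -/
lemma abs_skeletonStop_le (hq : 0 ≤ q) {M : ℝ} (hg : ∀ k, |g k| ≤ M) (N : ℕ) (ω : Ω) :
    |skeletonStop Y h A δ q g N ω| ≤ M := by
  by_cases hω : ω ∈ skeletonStay Y h A δ N
  · rw [skeletonStop_of_mem hω]; exact abs_skeletonVal_le hq hg _ _
  · have hex : ∃ m, m < N ∧ ⌊Y (m * δ) ω / h⌋ ∉ A := by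
      simpa [skeletonStay] using hω
    classical
    have h1 := Nat.find_spec hex
    rw [skeletonStop_of_exit h1.1.le (fun j hj => ?_) h1.2]
    · exact abs_skeletonVal_le hq hg _ _
    · have := Nat.find_min hex hj
      simp only [not_and, not_not] at this
      exact this (hj.trans h1.1)

/-- Staying in `A` before step `N + 1` involves the times `0, …, N δ` only. So the increment from `N
δ` to `(N + 1) δ` is integrated over an event of the past of `N δ`, as the one-step estimate
demands. -/
lemma measurableSet_skeletonStay_comap (N : ℕ) :
    MeasurableSet[MeasurableSpace.comap (fun ω (s : Set.Iic ((N : ℝ≥0) * δ)) => Y s ω)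
      MeasurableSpace.pi] (skeletonStay Y h A δ (N + 1)) := by
  have hle : ∀ j : Fin (N + 1), ((j : ℕ) : ℝ≥0) * δ ≤ (N : ℝ≥0) * δ := fun j => by
    have : (j : ℕ) ≤ N := by omega
    gcongr
  refine ⟨⋂ j : Fin (N + 1), {y | ⌊y ⟨(j : ℕ) * δ, hle j⟩ / h⌋ ∈ A},
    MeasurableSet.iInter fun j => ?_, ?_⟩
  · have hm : Measurable fun y : (Set.Iic ((N : ℝ≥0) * δ)) → ℝ => y ⟨(j : ℕ) * δ, hle j⟩ :=
      measurable_pi_apply _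
    exact (Int.measurable_floor.comp (hm.div_const h)) (MeasurableSet.of_discrete (s := A))
  · ext ω
    simp only [Set.mem_preimage, Set.mem_iInter, skeletonStay]
    exact ⟨fun H j hj => H ⟨j, hj⟩, fun H j => H j j.2⟩

end Skeleton

/-- A right-continuous lattice-valued path is locally constant to the right. -/
lemma exists_eq_of_right_cont {f : ℝ≥0 → ℝ} {h : ℝ} (hh : 0 < h) {t : ℝ≥0}
    (hc : ContinuousWithinAt f (Set.Ici t) t) (hl : ∀ s, f s ∈ lattice h) :
    ∃ ε > 0, ∀ s, t ≤ s → s < t + ε → f s = f t := by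
  have h1 := (Metric.continuousWithinAt_iff.1 hc) h hh
  obtain ⟨ε, hε, H⟩ := h1
  refine ⟨⟨ε, hε.le⟩, hε, fun s hs hst => ?_⟩
  have h2 : dist (f s) (f t) < h := by
    refine H hs ?_
    have h3 : (s : ℝ) < t + ε := by exact_mod_cast hst
    have h4 : (t : ℝ) ≤ s := by exact_mod_cast hs
    rw [NNReal.dist_eq, abs_of_nonneg (by linarith)]
    linarith
  obtain ⟨a, ha⟩ := hl s
  obtain ⟨b, hb⟩ := hl t
  rw [Real.dist_eq, ha, hb, ← mul_sub, abs_mul, abs_of_pos hh] at h2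
  have h3 : |((a - b : ℤ) : ℝ)| < 1 := by
    push_cast
    nlinarith
  rw [← Int.cast_abs] at h3
  have h4 : |a - b| < 1 := by exact_mod_cast h3
  have h5 : a = b := by
    have := Int.abs_lt_one_iff.1 h4
    omega
  rw [ha, hb, h5]

/-- The first exit time of a right-continuous lattice-valued path is attained. -/
lemma exists_first_exit {f : ℝ≥0 → ℝ} {h : ℝ} (hh : 0 < h)
    (hc : ∀ t, ContinuousWithinAt f (Set.Ici t) t) (hl : ∀ s, f s ∈ lattice h) {B : Set ℝ}
    (hex : ∃ t, f t ∈ B) : ∃ t, f t ∈ B ∧ ∀ s < t, f s ∉ B := by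
  set S : Set ℝ≥0 := {t | f t ∈ B} with hS
  have hne : S.Nonempty := hex
  have hbdd : BddBelow S := OrderBot.bddBelow S
  obtain ⟨ε, hε, hconst⟩ := exists_eq_of_right_cont hh (hc (sInf S)) hl
  obtain ⟨s, hsS, hs⟩ := exists_lt_of_csInf_lt hne (lt_add_of_pos_right (sInf S) hε)
  refine ⟨sInf S, ?_, fun r hr hrB => absurd (csInf_le hbdd hrB) (not_le.2 hr)⟩
  rw [← hconst s (csInf_le hbdd hsS) hs]
  exact hsS

namespace IsWalkProcess

variable {Ω : Type*} [MeasurableSpace Ω] {Q : Measure Ω} {Y : ℝ≥0 → Ω → ℝ} {h : ℝ} {p : ℕ → ℝ}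
  {A : Set ℤ} {δ : ℝ≥0} {q : ℝ} {g : ℤ → ℝ} (hY : IsWalkProcess Q Y h p)
include hY

lemma measurable_index (t : ℝ≥0) : Measurable fun ω => ⌊Y t ω / h⌋ :=
  Int.measurable_floor.comp ((hY.measurable t).div_const h)

lemma measurable_comp (g : ℤ → ℝ) (t : ℝ≥0) : Measurable fun ω => g ⌊Y t ω / h⌋ :=
  (measurable_of_countable g).comp (hY.measurable_index t)

lemma measurableSet_skeletonStay (N : ℕ) : MeasurableSet (skeletonStay Y h A δ (N + 1)) := by
  have h1 := measurableSet_skeletonStay_comap (Y := Y) (h := h) (A := A) (δ := δ) N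
  have h2 : Measurable fun ω (s : Set.Iic ((N : ℝ≥0) * δ)) => Y s ω :=
    measurable_pi_lambda _ fun s => hY.measurable s
  exact h2.comap_le _ h1

lemma measurable_skeletonVal (N : ℕ) : Measurable (skeletonVal Y h δ q g N) :=
  (hY.measurable_comp g _).const_mul _

lemma integrable_skeletonVal (hq : 0 ≤ q) {M : ℝ} (hg : ∀ k, |g k| ≤ M) (N : ℕ) :
    Integrable (skeletonVal Y h δ q g N) Q := by
  have := hY.prob
  exact Integrable.of_bound (hY.measurable_skeletonVal N).aestronglyMeasurable M
    (Eventually.of_forall fun ω => abs_skeletonVal_le hq hg N ω)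

lemma measurable_skeletonStop (N : ℕ) : Measurable (skeletonStop Y h A δ q g N) := by
  refine (hY.measurable_skeletonVal 0).add (Finset.measurable_fun_sum _ fun j _ => ?_)
  exact ((hY.measurable_skeletonVal _).sub (hY.measurable_skeletonVal _)).indicator
    (hY.measurableSet_skeletonStay _)

lemma integral_skeletonStop (hq : 0 ≤ q) {M : ℝ} (hg : ∀ k, |g k| ≤ M) (N : ℕ) :
    ∫ ω, skeletonStop Y h A δ q g N ω ∂Q = g 0 + ∑ j ∈ Finset.range N,
      ∫ ω in skeletonStay Y h A δ (j + 1),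
        (skeletonVal Y h δ q g (j + 1) ω - skeletonVal Y h δ q g j ω) ∂Q := by
  have := hY.prob
  have hi : ∀ j, Integrable ((skeletonStay Y h A δ (j + 1)).indicator
      (fun ω => skeletonVal Y h δ q g (j + 1) ω - skeletonVal Y h δ q g j ω)) Q := fun j =>
    ((hY.integrable_skeletonVal hq hg _).sub (hY.integrable_skeletonVal hq hg _)).indicator
      (hY.measurableSet_skeletonStay j)
  simp only [skeletonStop]
  rw [integral_add (hY.integrable_skeletonVal hq hg 0) (integrable_finsetSum _ fun j _ => hi j),
    integral_finsetSum _ fun j _ => hi j]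
  congr 1
  · have h1 : skeletonVal Y h δ q g 0 =ᵐ[Q] fun _ => g 0 := by
      filter_upwards [hY.start] with ω hω
      simp [skeletonVal, hω]
    rw [integral_congr_ae h1]
    simp
  · exact Finset.sum_congr rfl fun j _ => integral_indicator (hY.measurableSet_skeletonStay j)

/-- The mesh `1 / (j + 1) ^ 2`, which together with `(j + 1) ^ 3` steps covers `[0, j + 1]`. -/
lemma tendsto_skeletonStop {ω : Ω} (hl : ∀ s, Y s ω ∈ lattice h) {t : ℝ≥0}
    (ht : ⌊Y t ω / h⌋ ∉ A) (hlt : ∀ s < t, ⌊Y s ω / h⌋ ∈ A) :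
    Tendsto (fun j : ℕ => skeletonStop Y h A (1 / ((j : ℝ≥0) + 1) ^ 2) q g ((j + 1) ^ 3) ω) atTop
      (𝓝 (Real.exp (-(q * t)) * g ⌊Y t ω / h⌋)) := by
  obtain ⟨ε, hε, hconst⟩ := exists_eq_of_right_cont hY.pos (hY.right_cont ω t) hl
  set d : ℕ → ℝ≥0 := fun j => 1 / ((j : ℝ≥0) + 1) ^ 2 with hd
  have hdpos : ∀ j, 0 < d j := fun j => by simp only [hd]; positivity
  have hd0 : Tendsto d atTop (𝓝 0) := by
    have h1 : Tendsto (fun j : ℕ => (1 / ((j : ℝ≥0) + 1)) ^ 2) atTop (𝓝 (0 ^ 2)) :=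
      (tendsto_one_div_add_atTop_nhds_zero_nat (𝕜 := ℝ≥0)).pow 2
    simpa [hd, one_div, inv_pow] using h1
  -- `m j * d j` is the first skeleton time at or after the exit time `t`. For a fine mesh it lies
  -- in the interval to the right of `t` on which the path is constant, so the skeleton leaves `A`
  -- there, in the same state.
  set m : ℕ → ℕ := fun j => ⌈t / d j⌉₊ with hm
  have hm1 : ∀ j, t ≤ m j * d j := fun j => by
    rw [← div_le_iff₀ (hdpos j)]; exact Nat.le_ceil _
  have hm2 : ∀ j, (m j : ℝ≥0) * d j < t + d j := fun j => by
    have h1 : (m j : ℝ≥0) < t / d j + 1 := Nat.ceil_lt_add_one (by positivity)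
    calc (m j : ℝ≥0) * d j < (t / d j + 1) * d j := mul_lt_mul_of_pos_right h1 (hdpos j)
      _ = t + d j := by rw [add_mul, div_mul_cancel₀ _ (hdpos j).ne', one_mul]
  have hlim : Tendsto (fun j => ((m j : ℝ≥0) * d j : ℝ≥0)) atTop (𝓝 t) := by
    refine tendsto_of_tendsto_of_tendsto_of_le_of_le tendsto_const_nhds
      (by simpa using (tendsto_const_nhds (x := t)).add hd0) hm1 fun j => (hm2 j).le
  have hlim' : Tendsto (fun j => Real.exp (-(q * ((m j : ℝ≥0) * d j : ℝ≥0))) * g ⌊Y t ω / h⌋) atTop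
      (𝓝 (Real.exp (-(q * t)) * g ⌊Y t ω / h⌋)) := by
    have h1 : Tendsto (fun j => (((m j : ℝ≥0) * d j : ℝ≥0) : ℝ)) atTop (𝓝 (t : ℝ)) :=
      NNReal.tendsto_coe.2 hlim
    exact ((Real.continuous_exp.tendsto _).comp ((h1.const_mul q).neg)).mul_const _
  refine hlim'.congr' ?_
  have he1 : ∀ᶠ j in atTop, d j < ε := hd0.eventually_lt_const hε
  obtain ⟨n0, hn0⟩ := exists_nat_ge (t + 1)
  filter_upwards [he1, eventually_ge_atTop n0] with j hj hjn
  have hYm : Y (m j * d j) ω = Y t ω := hconst _ (hm1 j) ((hm2 j).trans (by gcongr))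
  rw [skeletonStop_of_exit (m := m j)]
  · change _ = skeletonVal Y h (d j) q g (m j) ω
    simp only [skeletonVal, hYm]
    push_cast
    rfl
  · have h2 : t / d j = t * ((j : ℝ≥0) + 1) ^ 2 := by simp [hd]
    have h3 : (m j : ℝ≥0) ≤ (((j + 1) ^ 3 : ℕ) : ℝ≥0) := by
      have h1 : (m j : ℝ≥0) < t / d j + 1 := Nat.ceil_lt_add_one (by positivity)
      have h4 : t + 1 ≤ (j : ℝ≥0) + 1 :=
        hn0.trans ((Nat.cast_le.2 hjn).trans (le_add_of_nonneg_right zero_le_one))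
      calc (m j : ℝ≥0) ≤ t * ((j : ℝ≥0) + 1) ^ 2 + 1 := by rw [← h2]; exact h1.le
        _ ≤ t * ((j : ℝ≥0) + 1) ^ 2 + 1 * ((j : ℝ≥0) + 1) ^ 2 := by
            gcongr
            rw [one_mul]
            exact one_le_pow₀ (by simp)
        _ = (t + 1) * ((j : ℝ≥0) + 1) ^ 2 := by ring
        _ ≤ ((j : ℝ≥0) + 1) * ((j : ℝ≥0) + 1) ^ 2 := by gcongr
        _ = (((j + 1) ^ 3 : ℕ) : ℝ≥0) := by push_cast; ring
    exact_mod_cast h3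
  · intro k hk
    refine hlt _ ?_
    rw [← lt_div_iff₀ (hdpos j)]
    exact Nat.lt_ceil.1 hk
  · rwa [hYm]

/-- A process whose generator admits a bounded function with generator bounded below by a positive
constant on `A` leaves `A`. -/
lemma ae_exists_exit {M c : ℝ} (hc : 0 < c) (hg : ∀ k, |g k| ≤ M)
    (hgen : ∀ k ∈ A, c ≤ walkGen p g k) (hgenB : ∃ B, ∀ k, |walkGen p g k| ≤ B) :
    ∀ᵐ ω ∂Q, ∃ t, ⌊Y t ω / h⌋ ∉ A := by
  have := hY.prob
  obtain ⟨K, hK, hstep⟩ := hY.step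
  obtain ⟨B, hB⟩ := hgenB
  have hM : 0 ≤ M := (abs_nonneg _).trans (hg 0)
  -- Each of the `N` steps raises the expectation of the stopped `g` by at least `δ c` times the
  -- probability of having stayed, minus the `δ²` error, while `|g| ≤ M` caps the total rise at `2
  -- M`.
  have hmain : ∀ (δ : ℝ≥0) (N : ℕ), δ ≤ 1 →
      N * (δ * c * Q.real (skeletonStay Y h A δ N) - K * M * (δ : ℝ) ^ 2) ≤ 2 * M := by
    intro δ N hδ
    have h1 := hY.integral_skeletonStop (A := A) (δ := δ) (q := 0) le_rfl hg N
    have h2 : |∫ ω, skeletonStop Y h A δ 0 g N ω ∂Q| ≤ M := by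
      have := norm_integral_le_of_norm_le_const (μ := Q) (f := skeletonStop Y h A δ 0 g N) (C := M)
        (Eventually.of_forall fun ω => abs_skeletonStop_le le_rfl hg N ω)
      simpa using this
    have h3 : ∑ j ∈ Finset.range N, (δ * c * Q.real (skeletonStay Y h A δ N)
          - K * M * (δ : ℝ) ^ 2) ≤ ∑ j ∈ Finset.range N,
        ∫ ω in skeletonStay Y h A δ (j + 1),
          (skeletonVal Y h δ 0 g (j + 1) ω - skeletonVal Y h δ 0 g j ω) ∂Q := by
      refine Finset.sum_le_sum fun j hj => ?_
      have hjN : j + 1 ≤ N := by simpa using hj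
      have h4 := hstep g M hg (j * δ) δ hδ _ (measurableSet_skeletonStay_comap (Y := Y) (h := h) (A := A) j)
      have hij : ((j : ℝ≥0) * δ + δ) = ((j + 1 : ℕ) : ℝ≥0) * δ := by push_cast; ring
      rw [hij] at h4
      have hi1 : Integrable (fun ω => g ⌊Y (((j + 1 : ℕ) : ℝ≥0) * δ) ω / h⌋
          - g ⌊Y ((j : ℝ≥0) * δ) ω / h⌋) Q := by
        refine Integrable.of_bound ((hY.measurable_comp g _).sub
          (hY.measurable_comp g _)).aestronglyMeasurable (M + M) (Eventually.of_forall fun ω => ?_)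
        exact (norm_sub_le _ _).trans (add_le_add (hg _) (hg _))
      have hi2 : Integrable (fun ω => (δ : ℝ) * walkGen p g ⌊Y ((j : ℝ≥0) * δ) ω / h⌋) Q := by
        refine (Integrable.of_bound (hY.measurable_comp (walkGen p g) _).aestronglyMeasurable B
          (Eventually.of_forall fun ω => ?_)).const_mul _
        exact hB _
      rw [integral_sub hi1.integrableOn hi2.integrableOn] at h4
      have h5 : (δ * c * Q.real (skeletonStay Y h A δ N) : ℝ) ≤
          ∫ ω in skeletonStay Y h A δ (j + 1), (δ : ℝ) * walkGen p g ⌊Y ((j : ℝ≥0) * δ) ω / h⌋ ∂Q := by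
        calc (δ * c * Q.real (skeletonStay Y h A δ N) : ℝ)
            ≤ δ * c * Q.real (skeletonStay Y h A δ (j + 1)) := by
              gcongr
              · finiteness
              · exact skeletonStay_anti hjN
          _ = ∫ ω in skeletonStay Y h A δ (j + 1), (δ * c : ℝ) ∂Q := by
              rw [setIntegral_const, smul_eq_mul, mul_comm]
          _ ≤ _ := by
              refine setIntegral_mono_on (integrable_const _).integrableOn hi2.integrableOn
                (hY.measurableSet_skeletonStay j) fun ω hω => ?_
              gcongr
              exact hgen _ (hω j (Nat.lt_succ_self j))
      have h6 : ∀ ω, skeletonVal Y h δ 0 g (j + 1) ω - skeletonVal Y h δ 0 g j ω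
          = g ⌊Y (((j + 1 : ℕ) : ℝ≥0) * δ) ω / h⌋ - g ⌊Y ((j : ℝ≥0) * δ) ω / h⌋ := by
        intro ω; simp [skeletonVal]
      simp_rw [h6]
      linarith [neg_abs_le (∫ ω in skeletonStay Y h A δ (j + 1),
        (g ⌊Y (((j + 1 : ℕ) : ℝ≥0) * δ) ω / h⌋ - g ⌊Y ((j : ℝ≥0) * δ) ω / h⌋) ∂Q
        - ∫ ω in skeletonStay Y h A δ (j + 1), (δ : ℝ) * walkGen p g ⌊Y ((j : ℝ≥0) * δ) ω / h⌋ ∂Q)]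
    rw [Finset.sum_const, Finset.card_range, nsmul_eq_mul] at h3
    have h7 := (abs_le.1 (hg 0)).1
    have h8 := (abs_le.1 h2).2
    linarith
  set F : Set Ω := {ω | ∀ t, ⌊Y t ω / h⌋ ∈ A} with hF
  -- With `(j+1)^3` steps of length `(j+1)^(-2)` the gain is of order `j + 1` times the probability
  -- of staying, and the accumulated error is of order `1 / (j + 1)`.
  have hbound : ∀ j : ℕ, Q.real F ≤ ((2 * M + K * M) / c) * (1 / ((j : ℝ) + 1)) := by
    intro j
    have hδ : (1 / ((j : ℝ≥0) + 1) ^ 2) ≤ 1 := by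
      rw [div_le_one (by positivity)]
      exact one_le_pow₀ (by simp)
    have h1 := hmain _ ((j + 1) ^ 3) hδ
    have h2 : Q.real F ≤ Q.real (skeletonStay Y h A (1 / ((j : ℝ≥0) + 1) ^ 2) ((j + 1) ^ 3)) :=
      measureReal_mono (fun ω hω k _ => hω _)
    set x := Q.real (skeletonStay Y h A (1 / ((j : ℝ≥0) + 1) ^ 2) ((j + 1) ^ 3))
    refine h2.trans ?_
    have hj : (0 : ℝ) < (j : ℝ) + 1 := by positivity
    have h3 : (((j + 1) ^ 3 : ℕ) : ℝ) * (((1 / ((j : ℝ≥0) + 1) ^ 2 : ℝ≥0) : ℝ) * c * x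
        - K * M * ((1 / ((j : ℝ≥0) + 1) ^ 2 : ℝ≥0) : ℝ) ^ 2)
        = ((j : ℝ) + 1) * c * x - K * M / ((j : ℝ) + 1) := by
      push_cast
      field_simp
    rw [h3] at h1
    have h4 : K * M / ((j : ℝ) + 1) ≤ K * M := div_le_self (by positivity) (by linarith)
    rw [div_mul_div_comm, mul_one, le_div_iff₀ (by positivity)]
    nlinarith
  have hlim : Tendsto (fun j : ℕ => ((2 * M + K * M) / c) * (1 / ((j : ℝ) + 1))) atTop (𝓝 0) := by
    simpa using (tendsto_one_div_add_atTop_nhds_zero_nat (𝕜 := ℝ)).const_mul ((2 * M + K * M) / c)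
  have h0 : Q.real F = 0 :=
    le_antisymm (ge_of_tendsto hlim (Eventually.of_forall hbound)) measureReal_nonneg
  have h1 : Q F = 0 := by
    rwa [measureReal_eq_zero_iff] at h0
  have h2 : ∀ᵐ ω ∂Q, ω ∉ F := measure_eq_zero_iff_ae_notMem.1 h1
  filter_upwards [h2] with ω hω
  simpa [hF] using hω

/-- Where the generator is `q g`, the first-order growth `1 + q δ` cancels the discount `exp (-q δ)`
up to `(q δ)²`; this adds `q ^ 2` to the constant of the one-step estimate. The constant is uniform
in `g`, `A`, the mesh and the step. -/
lemma abs_setIntegral_skeletonVal_sub_le (hq : 0 ≤ q) :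
    ∃ K : ℝ, ∀ (g : ℤ → ℝ) (M : ℝ), (∀ k, |g k| ≤ M) → ∀ (A : Set ℤ),
      (∀ k ∈ A, walkGen p g k = q * g k) → ∀ (δ : ℝ≥0), δ ≤ 1 → ∀ j : ℕ,
      |∫ ω in skeletonStay Y h A δ (j + 1),
        (skeletonVal Y h δ q g (j + 1) ω - skeletonVal Y h δ q g j ω) ∂Q| ≤ K * M * (δ : ℝ) ^ 2 := by
  have := hY.prob
  obtain ⟨K, hK, hstep⟩ := hY.step
  refine ⟨K + q ^ 2, fun g M hg A hgen δ hδ j => ?_⟩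
  have hM : 0 ≤ M := (abs_nonneg _).trans (hg 0)
  set E := skeletonStay Y h A δ (j + 1) with hE
  have hEm : MeasurableSet E := hY.measurableSet_skeletonStay j
  have h4 := hstep g M hg (j * δ) δ hδ E (measurableSet_skeletonStay_comap (Y := Y) (h := h) (A := A) j)
  have hij : ((j : ℝ≥0) * δ + δ) = ((j + 1 : ℕ) : ℝ≥0) * δ := by push_cast; ring
  rw [hij] at h4
  set a : Ω → ℝ := fun ω => g ⌊Y (((j + 1 : ℕ) : ℝ≥0) * δ) ω / h⌋
  set b : Ω → ℝ := fun ω => g ⌊Y ((j : ℝ≥0) * δ) ω / h⌋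
  have hia : Integrable a Q := Integrable.of_bound
    (hY.measurable_comp g _).aestronglyMeasurable M (Eventually.of_forall fun ω => hg _)
  have hib : Integrable b Q := Integrable.of_bound
    (hY.measurable_comp g _).aestronglyMeasurable M (Eventually.of_forall fun ω => hg _)
  have h5 : ∫ ω in E, (a ω - b ω - δ * walkGen p g ⌊Y ((j : ℝ≥0) * δ) ω / h⌋) ∂Q
      = ∫ ω in E, (a ω - b ω - δ * (q * b ω)) ∂Q :=
    setIntegral_congr_fun hEm fun ω hω => by
      simp only [hgen _ (hω j (Nat.lt_succ_self j)), b]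
  change |∫ ω in E, (a ω - b ω - δ * walkGen p g ⌊Y ((j : ℝ≥0) * δ) ω / h⌋) ∂Q| ≤ _ at h4
  rw [h5] at h4
  set e0 := Real.exp (-(q * (j * δ))) with he0
  set e1 := Real.exp (-(q * δ)) with he1
  have hval : ∀ ω, skeletonVal Y h δ q g (j + 1) ω - skeletonVal Y h δ q g j ω
      = e0 * (e1 * (a ω - b ω - δ * (q * b ω)) + (e1 * (1 + q * δ) - 1) * b ω) := by
    intro ω
    have : Real.exp (-(q * ((j + 1 : ℕ) * δ))) = e0 * e1 := by
      rw [he0, he1, ← Real.exp_add]; congr 1; push_cast; ring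
    simp only [skeletonVal, this]
    change e0 * e1 * a ω - e0 * b ω = _
    ring
  simp_rw [hval]
  rw [integral_const_mul, integral_add, integral_const_mul, integral_const_mul]
  rotate_left
  · exact (((hia.sub hib).sub ((hib.const_mul q).const_mul δ)).const_mul e1).integrableOn
  · exact (hib.const_mul _).integrableOn
  have hx : (0 : ℝ) ≤ q * δ := by positivity
  have hb1 : |∫ ω in E, b ω ∂Q| ≤ M := by
    have h6 := norm_setIntegral_le_of_norm_le_const (μ := Q) (s := E) (f := b) (C := M)
      (measure_lt_top _ _) (fun ω _ => hg _)
    refine h6.trans (mul_le_of_le_one_right hM measureReal_le_one)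
  have he0' : |e0| ≤ 1 := by
    rw [abs_of_pos (Real.exp_pos _), Real.exp_le_one_iff, neg_nonpos]; positivity
  have he1' : |e1| ≤ 1 := by
    rw [abs_of_pos (Real.exp_pos _), Real.exp_le_one_iff, neg_nonpos]; positivity
  have he2 : |e1 * (1 + q * δ) - 1| ≤ (q * δ) ^ 2 := by
    have h7 := Real.add_one_le_exp (q * δ)
    have h8 := Real.add_one_le_exp (-(q * δ))
    have h9 : e1 * Real.exp (q * δ) = 1 := by rw [he1, ← Real.exp_add]; simp
    have h10 : 0 < e1 := Real.exp_pos _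
    rw [← he1] at h8
    rw [abs_le]
    constructor <;> nlinarith
  calc |e0 * (e1 * ∫ ω in E, (a ω - b ω - δ * (q * b ω)) ∂Q
        + (e1 * (1 + q * δ) - 1) * ∫ ω in E, b ω ∂Q)|
      ≤ 1 * (1 * (K * M * (δ : ℝ) ^ 2) + (q * δ) ^ 2 * M) := by
        rw [abs_mul]
        refine mul_le_mul he0' ((abs_add_le _ _).trans (add_le_add ?_ ?_)) (abs_nonneg _) zero_le_one
        · rw [abs_mul]; exact mul_le_mul he1' h4 (abs_nonneg _) zero_le_one
        · rw [abs_mul]; exact mul_le_mul he2 hb1 (abs_nonneg _) (by positivity)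
    _ = (K + q ^ 2) * M * (δ : ℝ) ^ 2 := by ring

/-- Optional stopping at the exit from `A` for a bounded function which is `q`-harmonic on `A`. -/
theorem integral_exit (hex : ∀ᵐ ω ∂Q, ∃ t, ⌊Y t ω / h⌋ ∉ A) (hq : 0 ≤ q) {M : ℝ}
    (hg : ∀ k, |g k| ≤ M) (hgen : ∀ k ∈ A, walkGen p g k = q * g k) {V : Ω → ℝ}
    (hV : ∀ᵐ ω ∂Q, ∀ t : ℝ≥0, ⌊Y t ω / h⌋ ∉ A → (∀ s < t, ⌊Y s ω / h⌋ ∈ A) →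
      V ω = Real.exp (-(q * t)) * g ⌊Y t ω / h⌋) :
    Integrable V Q ∧ ∫ ω, V ω ∂Q = g 0 := by
  have := hY.prob
  have hM : 0 ≤ M := (abs_nonneg _).trans (hg 0)
  set S : ℕ → Ω → ℝ := fun j =>
    skeletonStop Y h A (1 / ((j : ℝ≥0) + 1) ^ 2) q g ((j + 1) ^ 3) with hS
  have hlim : ∀ᵐ ω ∂Q, Tendsto (fun j => S j ω) atTop (𝓝 (V ω)) := by
    filter_upwards [hV, hex, hY.ae_lattice] with ω hω hexω hl
    obtain ⟨t, ht, hlt⟩ := exists_first_exit hY.pos (hY.right_cont ω) hl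
      (B := {y | ⌊y / h⌋ ∉ A}) hexω
    have hlt' : ∀ s < t, ⌊Y s ω / h⌋ ∈ A := fun s hs => not_not.1 (hlt s hs)
    rw [hω t ht hlt']
    exact hY.tendsto_skeletonStop hl ht hlt'
  have hmeas : ∀ j, AEStronglyMeasurable (S j) Q := fun j =>
    (hY.measurable_skeletonStop _).aestronglyMeasurable
  have hb : ∀ j, ∀ᵐ ω ∂Q, ‖S j ω‖ ≤ M := fun j =>
    Eventually.of_forall fun ω => abs_skeletonStop_le hq hg _ ω
  -- Measurability of `V` comes from its being an a.e. limit of measurable skeleton variables, so no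
  -- measurability of hitting times has to be established.
  have hVm : AEStronglyMeasurable V Q := aestronglyMeasurable_of_tendsto_ae atTop hmeas hlim
  have hVb : ∀ᵐ ω ∂Q, ‖V ω‖ ≤ M := by
    filter_upwards [hlim] with ω hω
    exact le_of_tendsto hω.norm (Eventually.of_forall fun j => abs_skeletonStop_le hq hg _ ω)
  refine ⟨Integrable.of_bound hVm M hVb, ?_⟩
  have h1 := tendsto_integral_of_dominated_convergence (fun _ => M) hmeas (integrable_const M) hb
    hlim
  refine tendsto_nhds_unique h1 ?_
  obtain ⟨K, hK⟩ := hY.abs_setIntegral_skeletonVal_sub_le hq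
  -- The drift accumulated over `(j+1)^3` steps is at most `(j+1)^3 * K M (j+1)^(-4)`, which
  -- vanishes although the time horizon tends to infinity.
  have h2 : ∀ j : ℕ, |∫ ω, S j ω ∂Q - g 0| ≤ K * M * (1 / ((j : ℝ) + 1)) := by
    intro j
    have hδ : (1 / ((j : ℝ≥0) + 1) ^ 2) ≤ 1 := by
      rw [div_le_one (by positivity)]
      exact one_le_pow₀ (by simp)
    simp only [hS]
    rw [hY.integral_skeletonStop hq hg, add_sub_cancel_left]
    refine (Finset.abs_sum_le_sum_abs _ _).trans ((Finset.sum_le_sum fun i _ =>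
      hK g M hg A hgen _ hδ i).trans ?_)
    rw [Finset.sum_const, Finset.card_range, nsmul_eq_mul]
    have hj : (0 : ℝ) < (j : ℝ) + 1 := by positivity
    push_cast
    refine le_of_eq ?_
    field_simp
  rw [tendsto_iff_norm_sub_tendsto_zero]
  refine squeeze_zero (fun _ => norm_nonneg _) h2 ?_
  simpa using (tendsto_one_div_add_atTop_nhds_zero_nat (𝕜 := ℝ)).const_mul (K * M)

end IsWalkProcess

end LevyChain
namespace LevyChain

/-! ### Compound Poisson laws -/

/-- The convolution powers of a measure on `ℝ`. -/
noncomputable def convPow (ν : Measure ℝ) : ℕ → Measure ℝ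
  | 0 => Measure.dirac 0
  | n + 1 => convPow ν n ∗ ν

/-- The compound Poisson law with Lévy measure `ν` at time `t`. -/
noncomputable def compoundPoisson (ν : Measure ℝ) (t : ℝ≥0) : Measure ℝ :=
  Measure.sum fun n => ENNReal.ofReal (Real.exp (-(t * ν.real Set.univ)) * t ^ n / n.factorial) •
    convPow ν n

instance isFiniteMeasure_convPow (ν : Measure ℝ) [IsFiniteMeasure ν] (n : ℕ) :
    IsFiniteMeasure (convPow ν n) := by
  induction n with
  | zero => rw [convPow]; infer_instance
  | succ n ih => rw [convPow]; infer_instance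

section CompoundPoisson

variable (ν : Measure ℝ)

lemma hasSum_integral_compoundPoisson {E : Type*} [NormedAddCommGroup E] [NormedSpace ℝ E]
    (t : ℝ≥0) {f : ℝ → E} (hf : Integrable f (compoundPoisson ν t)) :
    HasSum (fun n : ℕ => (Real.exp (-(t * ν.real Set.univ)) * (t : ℝ) ^ n / n.factorial) •
      ∫ x, f x ∂(convPow ν n)) (∫ x, f x ∂(compoundPoisson ν t)) := by
  refine (hasSum_integral_measure hf).congr_fun ?_ |> fun h => h
  intro n
  rw [integral_smul_measure, ENNReal.toReal_ofReal (by positivity)]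

variable [IsFiniteMeasure ν]

lemma charFun_convPow (n : ℕ) (p : ℝ) : charFun (convPow ν n) p = charFun ν p ^ n := by
  induction n with
  | zero => simp [convPow, charFun_dirac]
  | succ n ih => rw [convPow, charFun_conv, ih, pow_succ]

lemma convPow_univ (n : ℕ) : (convPow ν n).real Set.univ = ν.real Set.univ ^ n := by
  have h1 := charFun_convPow ν n 0
  rw [charFun_zero, charFun_zero] at h1
  exact_mod_cast h1

lemma convPow_one : convPow ν 1 = ν := by
  rw [convPow, convPow, Measure.dirac_zero_conv]

lemma hasSum_poisson_weights (t : ℝ≥0) (a : ℝ) :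
    HasSum (fun n : ℕ => Real.exp (-(t * a)) * (t : ℝ) ^ n / n.factorial * a ^ n) 1 := by
  have h1 := (NormedSpace.expSeries_div_hasSum_exp ((t : ℝ) * a)).mul_left (Real.exp (-(t * a)))
  rw [← Real.exp_eq_exp_ℝ, ← Real.exp_add, neg_add_cancel, Real.exp_zero] at h1
  refine h1.congr_fun ?_ |> fun h => h
  intro n
  rw [mul_pow]; ring

instance isProbabilityMeasure_compoundPoisson (t : ℝ≥0) :
    IsProbabilityMeasure (compoundPoisson ν t) := by
  constructor
  have h1 : ∀ n : ℕ, (ENNReal.ofReal (Real.exp (-(t * ν.real Set.univ)) * t ^ n / n.factorial) •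
      convPow ν n) Set.univ = ENNReal.ofReal (Real.exp (-(t * ν.real Set.univ)) * (t : ℝ) ^ n /
        n.factorial * ν.real Set.univ ^ n) := by
    intro n
    rw [Measure.smul_apply, smul_eq_mul, ENNReal.ofReal_mul (by positivity), ← convPow_univ,
      ofReal_measureReal]
  rw [compoundPoisson, Measure.sum_apply _ MeasurableSet.univ]
  simp_rw [h1]
  have h2 := hasSum_poisson_weights t (ν.real Set.univ)
  rw [← ENNReal.ofReal_tsum_of_nonneg (fun n => by positivity) h2.summable, h2.tsum_eq,
    ENNReal.ofReal_one]

lemma charFun_compoundPoisson (t : ℝ≥0) (p : ℝ) :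
    charFun (compoundPoisson ν t) p = Complex.exp (t * (charFun ν p - ν.real Set.univ)) := by
  have hi : Integrable (fun x : ℝ => Complex.exp (p * x * Complex.I)) (compoundPoisson ν t) := by
    refine Integrable.of_bound (by fun_prop) 1 (Eventually.of_forall fun x => ?_)
    rw [← Complex.ofReal_mul, Complex.norm_exp_ofReal_mul_I]
  have h1 := hasSum_integral_compoundPoisson ν t hi
  rw [← charFun_apply_real] at h1
  have h2 := (NormedSpace.expSeries_div_hasSum_exp ((t : ℂ) * charFun ν p)).mul_left
    (Complex.exp (-(t * ν.real Set.univ)))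
  rw [← Complex.exp_eq_exp_ℂ, ← Complex.exp_add] at h2
  rw [show (t : ℂ) * (charFun ν p - ν.real Set.univ)
    = -(t * ν.real Set.univ) + t * charFun ν p by ring]
  refine h1.unique (h2.congr_fun ?_ |> fun h => h)
  intro n
  rw [← charFun_apply_real, charFun_convPow, Complex.real_smul, mul_pow]
  push_cast
  ring

/-- First order expansion of a compound Poisson law in time. -/
lemma abs_integral_compoundPoisson_sub_le (t : ℝ≥0) {G : ℝ → ℝ} (hG : Measurable G) {M : ℝ}
    (hM : ∀ x, |G x| ≤ M) :
    |∫ x, G x ∂(compoundPoisson ν t) - ((1 - t * ν.real Set.univ) * G 0 + t * ∫ x, G x ∂ν)|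
      ≤ 3 * M * (t * ν.real Set.univ) ^ 2 := by
  set a := ν.real Set.univ with ha
  have ha0 : 0 ≤ a := measureReal_nonneg
  have hM0 : 0 ≤ M := (abs_nonneg _).trans (hM 0)
  set x : ℝ := t * a with hx
  have hx0 : 0 ≤ x := by positivity
  have h1 := hasSum_integral_compoundPoisson ν t
    (Integrable.of_bound hG.aestronglyMeasurable M (Eventually.of_forall hM))
  have h2 := hasSum_poisson_weights t a
  have hb : ∀ n, |∫ y, G y ∂(convPow ν n)| ≤ M * a ^ n := fun n => by
    have := norm_integral_le_of_norm_le_const (μ := convPow ν n) (f := G) (C := M)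
      (Eventually.of_forall hM)
    rwa [convPow_univ] at this
  have h3 := (hasSum_nat_add_iff' 2).2 h1
  have h4 := ((hasSum_nat_add_iff' 2).2 h2).mul_left M
  -- The terms with two or more jumps weigh at most `M (1 - exp (-x) (1 + x)) ≤ M x²` for `x = t a`.
  -- The no-jump and one-jump terms, linearized in `t`, cost another `M x²` each, whence the factor
  -- 3.
  have h6 : |∫ x, G x ∂(compoundPoisson ν t) - ∑ i ∈ Finset.range 2,
      (Real.exp (-(t * a)) * (t : ℝ) ^ i / i.factorial) • ∫ x, G x ∂(convPow ν i)|
      ≤ M * (1 - ∑ i ∈ Finset.range 2, Real.exp (-(t * a)) * (t : ℝ) ^ i / i.factorial * a ^ i) := by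
    rw [← h3.tsum_eq, ← Real.norm_eq_abs]
    refine tsum_of_norm_bounded h4 fun n => ?_
    rw [norm_smul, Real.norm_of_nonneg (by positivity)]
    calc _ ≤ Real.exp (-(t * a)) * (t : ℝ) ^ (n + 2) / (n + 2).factorial * (M * a ^ (n + 2)) := by
          gcongr
          exact hb _
      _ = _ := by ring
  simp only [Finset.sum_range_succ, Finset.sum_range_zero, pow_zero, pow_one, Nat.factorial,
    convPow_one, smul_eq_mul, mul_one, Nat.cast_one, div_one, zero_add] at h6
  rw [convPow, integral_dirac] at h6
  have hν : |∫ x, G x ∂ν| ≤ M * a := by simpa [convPow_one] using hb 1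
  set e := Real.exp (-(t * a)) with he
  have he0 : 0 < e := Real.exp_pos _
  have h7 : 1 - x ≤ e := by
    have := Real.add_one_le_exp (-(t * a)); rw [← he, ← hx] at this; linarith
  have h8 : e * (1 + x) ≤ 1 := by
    have h9 := Real.add_one_le_exp x
    have h10 : e * Real.exp x = 1 := by rw [he, ← Real.exp_add]; simp [hx]
    nlinarith
  have h9 : e ≤ 1 - x + x ^ 2 := by
    have : e * (1 + x) ≤ (1 - x + x ^ 2) * (1 + x) := h8.trans (by nlinarith [pow_nonneg hx0 3])
    exact le_of_mul_le_mul_right this (by linarith)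
  set I := ∫ x, G x ∂ν
  set J := ∫ x, G x ∂(compoundPoisson ν t)
  have hdec : J - ((1 - x) * G 0 + t * I)
      = (J - (e * G 0 + e * t * I)) + ((e - (1 - x)) * G 0 + (e - 1) * (t * I)) := by ring
  rw [hdec]
  have hA : |(e - (1 - x)) * G 0| ≤ x ^ 2 * M := by
    rw [abs_mul]
    refine mul_le_mul ?_ (hM 0) (abs_nonneg _) (by positivity)
    rw [abs_le]; constructor <;> nlinarith
  have hB : |(e - 1) * (t * I)| ≤ x * (x * M) := by
    rw [abs_mul]
    refine mul_le_mul ?_ ?_ (abs_nonneg _) hx0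
    · have : e ≤ 1 := by nlinarith
      rw [abs_le]; constructor <;> nlinarith
    · rw [abs_mul, abs_of_nonneg t.coe_nonneg]
      calc (t : ℝ) * |I| ≤ t * (M * a) := by gcongr
        _ = x * M := by rw [hx]; ring
  have hC : M * (1 - (e + e * t * a)) ≤ M * x ^ 2 := by
    refine mul_le_mul_of_nonneg_left ?_ hM0
    have : e * t * a = e * x := by rw [hx]; ring
    rw [this]
    nlinarith
  refine (abs_add_le _ _).trans ((add_le_add (h6.trans hC) ((abs_add_le _ _).trans
    (add_le_add hA hB))).trans (le_of_eq ?_))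
  ring

end CompoundPoisson

/-- The density `exp (c x)` is multiplicative in `x`, so tilting commutes with convolution. -/
lemma convPow_levyTilt (ν : Measure ℝ) [IsFiniteMeasure ν] (c : ℝ)
    [IsFiniteMeasure (levyTilt ν c)] (n : ℕ) :
    convPow (levyTilt ν c) n =
      (convPow ν n).withDensity fun x => ENNReal.ofReal (Real.exp (c * x)) := by
  have hm : Measurable fun x : ℝ => ENNReal.ofReal (Real.exp (c * x)) := by fun_prop
  induction n with
  | zero =>
    refine Measure.ext_of_lintegral _ fun f hf => ?_
    rw [convPow, convPow, lintegral_withDensity_eq_lintegral_mul _ hm hf]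
    simp
  | succ n ih =>
    refine Measure.ext_of_lintegral _ fun f hf => ?_
    rw [convPow, Measure.lintegral_conv hf, ih,
      lintegral_withDensity_eq_lintegral_mul _ hm (by fun_prop),
      lintegral_withDensity_eq_lintegral_mul _ hm hf, convPow, Measure.lintegral_conv (by fun_prop)]
    refine lintegral_congr fun x => ?_
    rw [Pi.mul_apply, levyTilt, lintegral_withDensity_eq_lintegral_mul _ hm (by fun_prop),
      ← lintegral_const_mul _ (by fun_prop)]
    refine lintegral_congr fun y => ?_
    simp only [Pi.mul_apply]
    rw [mul_add, Real.exp_add, ENNReal.ofReal_mul (Real.exp_pos _).le, mul_assoc]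

lemma psi_eq (ν : Measure ℝ) [IsFiniteMeasure ν] {c : ℝ}
    (hc : Integrable (fun x => Real.exp (c * x)) ν) :
    (levyTilt ν c).real Set.univ = psi ν c + ν.real Set.univ := by
  rw [psi, integral_sub hc (integrable_const 1), levyTilt, measureReal_def,
    withDensity_apply _ MeasurableSet.univ, Measure.restrict_univ,
    ← integral_eq_lintegral_of_nonneg_ae (Eventually.of_forall fun x => (Real.exp_pos _).le) hc.1]
  simp

/-- After tilting each convolution power, the change of total mass from `ν` to `ν + ψ(c)` in the
Poisson weights accounts for the factor `exp (-ψ(c) t)`. -/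
lemma compoundPoisson_levyTilt (ν : Measure ℝ) [IsFiniteMeasure ν] {c : ℝ}
    (hc : Integrable (fun x => Real.exp (c * x)) ν) [IsFiniteMeasure (levyTilt ν c)] (t : ℝ≥0) :
    compoundPoisson (levyTilt ν c) t = (compoundPoisson ν t).withDensity
      fun x => ENNReal.ofReal (Real.exp (c * x - psi ν c * t)) := by
  rw [compoundPoisson, compoundPoisson, withDensity_sum]
  congr 1
  funext n
  have hm : Measurable fun x : ℝ => ENNReal.ofReal (Real.exp (c * x)) := by fun_prop
  have h1 : (fun x : ℝ => ENNReal.ofReal (Real.exp (c * x - psi ν c * t)))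
      = ENNReal.ofReal (Real.exp (-(psi ν c * t))) •
        fun x : ℝ => ENNReal.ofReal (Real.exp (c * x)) := by
    funext x
    rw [Pi.smul_apply, smul_eq_mul, ← ENNReal.ofReal_mul (Real.exp_pos _).le, ← Real.exp_add]
    congr 2; ring
  rw [convPow_levyTilt, psi_eq ν hc, withDensity_smul_measure, h1, withDensity_smul _ hm, smul_smul,
    ← ENNReal.ofReal_mul (by positivity)]
  congr 2
  have h2 : Real.exp (-(t * (psi ν c + ν.real Set.univ)))
      = Real.exp (-(t * ν.real Set.univ)) * Real.exp (-(psi ν c * t)) := by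
    rw [← Real.exp_add]; congr 1; ring
  rw [h2]; ring

lemma measurableSet_lattice (h : ℝ) : MeasurableSet (lattice h) := by
  have : lattice h = Set.range fun k : ℤ => h * k := by
    ext x; simp [lattice, eq_comm]
  rw [this]
  exact (Set.countable_range _).measurableSet

lemma isClosed_lattice {h : ℝ} (hh : 0 < h) : IsClosed (lattice h) := by
  have : lattice h = (Homeomorph.mulLeft₀ h hh.ne') '' Set.range ((↑) : ℤ → ℝ) := by
    ext x; simp [lattice, eq_comm]
  rw [this]
  exact (Homeomorph.isClosedMap _) _ Int.isClosedEmbedding_coe_real.isClosed_range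

lemma add_mem_lattice {h x y : ℝ} (hx : x ∈ lattice h) (hy : y ∈ lattice h) :
    x + y ∈ lattice h := by
  obtain ⟨a, rfl⟩ := hx
  obtain ⟨b, rfl⟩ := hy
  exact ⟨a + b, by push_cast; ring⟩

lemma zero_mem_lattice (h : ℝ) : (0 : ℝ) ∈ lattice h := ⟨0, by simp⟩

lemma ae_mem_lattice_convPow {ν : Measure ℝ} [IsFiniteMeasure ν] {h : ℝ}
    (hν : ∀ᵐ x ∂ν, x ∈ lattice h) (n : ℕ) : ∀ᵐ x ∂(convPow ν n), x ∈ lattice h := by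
  induction n with
  | zero =>
    exact (ae_dirac_iff (p := (· ∈ lattice h)) (measurableSet_lattice h)).2 (zero_mem_lattice h)
  | succ n ih =>
    refine (ae_map_iff (p := (· ∈ lattice h)) (f := fun z : ℝ × ℝ => z.1 + z.2) (by fun_prop)
      (measurableSet_lattice h)).2 ?_
    have h1 : ∀ᵐ z ∂((convPow ν n).prod ν), z.1 ∈ lattice h := Measure.quasiMeasurePreserving_fst.ae ih
    have h2 : ∀ᵐ z ∂((convPow ν n).prod ν), z.2 ∈ lattice h := Measure.quasiMeasurePreserving_snd.ae hν
    filter_upwards [h1, h2] with z hz1 hz2 using add_mem_lattice hz1 hz2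

lemma ae_mem_lattice_compoundPoisson {ν : Measure ℝ} [IsFiniteMeasure ν] {h : ℝ}
    (hν : ∀ᵐ x ∂ν, x ∈ lattice h) (t : ℝ≥0) : ∀ᵐ x ∂(compoundPoisson ν t), x ∈ lattice h := by
  rw [compoundPoisson, Measure.ae_sum_iff]
  exact fun n => Measure.ae_smul_measure (ae_mem_lattice_convPow hν n) _

/-- A right-continuous path which is lattice-valued on a dense set is lattice-valued. -/
lemma mem_lattice_of_dense {f : ℝ≥0 → ℝ} {h : ℝ} (hh : 0 < h)
    (hc : ∀ t, ContinuousWithinAt f (Set.Ici t) t) {D : Set ℝ≥0} (hD : Dense D)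
    (hl : ∀ s ∈ D, f s ∈ lattice h) (t : ℝ≥0) : f t ∈ lattice h := by
  rw [← (isClosed_lattice hh).closure_eq]
  have h1 : t ∈ closure (Set.Ioi t ∩ D) := by
    have h2 : t ∈ closure (Set.Ioi t) := by
      rw [closure_Ioi]; exact Set.self_mem_Ici
    exact closure_minimal (hD.open_subset_closure_inter isOpen_Ioi) isClosed_closure h2
  exact ((hc t).mono fun s hs => Set.Ioi_subset_Ici_self hs.1).mem_closure h1 fun s hs => hl s hs.2

end LevyChain
namespace LevyChain

/-! ### Exponential change of measure -/

/-- The density `exp (c X_t - ψ(c) t)`. -/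
noncomputable def tiltDensity {Ω : Type*} (X : ℝ≥0 → Ω → ℝ) (lam : Measure ℝ) (c : ℝ) (t : ℝ≥0)
    (ω : Ω) : ℝ≥0∞ :=
  ENNReal.ofReal (Real.exp (c * X t ω - psi lam c * t))

lemma tiltDensity_add {Ω : Type*} (X : ℝ≥0 → Ω → ℝ) (lam : Measure ℝ) (c : ℝ) (t δ : ℝ≥0) (ω : Ω) :
    tiltDensity X lam c (t + δ) ω = tiltDensity X lam c t ω *
      ENNReal.ofReal (Real.exp (c * (X (t + δ) ω - X t ω) - psi lam c * δ)) := by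
  rw [tiltDensity, tiltDensity, ← ENNReal.ofReal_mul (Real.exp_pos _).le, ← Real.exp_add]
  congr 2
  push_cast
  ring

/-- Under a density that factorizes over a `σ`-algebra and an independent variable, these remain
independent. -/
lemma map_prod_withDensity_mul {Ω α β : Type*} {m mΩ : MeasurableSpace Ω} [MeasurableSpace α]
    [MeasurableSpace β] {P : Measure Ω} (hm : m ≤ mΩ)
    {Z : Ω → α} (hZ : Measurable[m] Z) {U : Ω → β} (hU : Measurable U)
    (hind : Indep (MeasurableSpace.comap U inferInstance) m P) {D : Ω → ℝ≥0∞}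
    (hD : Measurable[m] D) {D' : β → ℝ≥0∞} (hD' : Measurable D')
    [IsFiniteMeasure (P.withDensity D)] [IsFiniteMeasure ((P.map U).withDensity D')] :
    (P.withDensity fun ω => D ω * D' (U ω)).map (fun ω => (Z ω, U ω))
      = ((P.withDensity D).map Z).prod ((P.map U).withDensity D') := by
  have hZ' : Measurable Z := hZ.mono hm le_rfl
  have hDm : Measurable D := hD.mono hm le_rfl
  symm
  refine Measure.prod_eq fun S T hS hT => ?_
  rw [Measure.map_apply (hZ'.prodMk hU) (hS.prod hT), withDensity_apply _
    ((hZ'.prodMk hU) (hS.prod hT)), Measure.map_apply hZ' hS, withDensity_apply _ (hZ' hS),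
    withDensity_apply _ hT, setLIntegral_map hT hD' hU,
    ← lintegral_indicator ((hZ'.prodMk hU) (hS.prod hT)), ← lintegral_indicator (hZ' hS),
    ← lintegral_indicator (hU hT)]
  have hf : Measurable[m] ((Z ⁻¹' S).indicator D) := hD.indicator (hZ hS)
  have hg : Measurable[MeasurableSpace.comap U inferInstance]
      ((U ⁻¹' T).indicator fun ω => D' (U ω)) :=
    (hD'.comp (comap_measurable U)).indicator ⟨T, hT, rfl⟩
  rw [← lintegral_mul_eq_lintegral_mul_lintegral_of_independent_measurableSpace hm hU.comap_le
    hind.symm hf hg]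
  refine lintegral_congr fun ω => ?_
  by_cases h1 : ω ∈ Z ⁻¹' S <;> by_cases h2 : ω ∈ U ⁻¹' T <;>
    simp_all [Set.indicator]

namespace IsUpwardsSkipFreeLevyChain

variable {Ω : Type*} [mΩ : MeasurableSpace Ω] {P : Measure Ω}
  {ℱ : Filtration ℝ≥0 mΩ} {X : ℝ≥0 → Ω → ℝ} {lam : Measure ℝ} {h : ℝ}
  (hX : IsUpwardsSkipFreeLevyChain P ℱ X lam h)
include hX

lemma measurable (t : ℝ≥0) : Measurable (X t) := (hX.adapted t).mono (ℱ.le t) le_rfl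

lemma measurable_tiltDensity (c : ℝ) (t : ℝ≥0) : Measurable[ℱ t] (tiltDensity X lam c t) :=
  ENNReal.measurable_ofReal.comp
    (Real.measurable_exp.comp (((hX.adapted t).const_mul c).sub_const _))

lemma withDensity_compoundPoisson {c : ℝ} (hc : 0 ≤ c) (δ : ℝ≥0) : (compoundPoisson lam δ).withDensity
      (fun x => ENNReal.ofReal (Real.exp (c * x - psi lam c * δ)))
    = compoundPoisson (levyTilt lam c) δ := by
  have := hX.finite
  have := (hX.isSkipFreeMeasure.levyTilt hc).finite
  rw [compoundPoisson_levyTilt lam (hX.isSkipFreeMeasure.integrable_exp hc)]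

variable [IsProbabilityMeasure P]

lemma map_eq_compoundPoisson (t : ℝ≥0) : P.map (X t) = compoundPoisson lam t := by
  have := hX.finite
  have : IsProbabilityMeasure (P.map (X t)) :=
    Measure.isProbabilityMeasure_map (hX.measurable t).aemeasurable
  refine Measure.ext_of_charFun ?_
  funext p
  rw [charFun_compoundPoisson, charFun_apply_real, charFun_apply_real,
    integral_map (hX.measurable t).aemeasurable (by fun_prop)]
  have h1 := hX.charExponent t p
  have h2 : ∀ x : ℝ, Complex.exp (p * x * Complex.I) = Complex.exp (Complex.I * p * x) :=
    fun x => by congr 1; ring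
  simp_rw [h2]
  rw [h1, integral_sub _ (integrable_const _)]
  · simp
  · refine Integrable.of_bound (by fun_prop) 1 (Eventually.of_forall fun x => ?_)
    rw [← h2, ← Complex.ofReal_mul, Complex.norm_exp_ofReal_mul_I]

lemma map_sub_eq_compoundPoisson (t δ : ℝ≥0) :
    P.map (fun ω => X (t + δ) ω - X t ω) = compoundPoisson lam δ := by
  rw [(hX.stationary t (t + δ) (by simp)).map_eq, add_tsub_cancel_left, hX.map_eq_compoundPoisson]

/-- At a fixed time this is a property of the compound Poisson law. A countable dense set of times
and right-continuity give one null set for all times, since the lattice is closed. -/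
lemma ae_mem_lattice : ∀ᵐ ω ∂P, ∀ t, X t ω ∈ lattice h := by
  have := hX.finite
  obtain ⟨D, hDc, hD⟩ := TopologicalSpace.exists_countable_dense ℝ≥0
  have hl : ∀ᵐ x ∂lam, x ∈ lattice h := by
    filter_upwards [hX.isSkipFreeMeasure.ae_mem] with x hx
    obtain ⟨i, rfl⟩ := hx
    exact ⟨1 - i, by push_cast; ring⟩
  have h1 : ∀ t, ∀ᵐ ω ∂P, X t ω ∈ lattice h := fun t => by
    have h2 := ae_mem_lattice_compoundPoisson hl t
    rw [← hX.map_eq_compoundPoisson] at h2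
    exact ae_of_ae_map (hX.measurable t).aemeasurable h2
  have h2 : ∀ᵐ ω ∂P, ∀ t ∈ D, X t ω ∈ lattice h := (ae_ball_iff hDc).2 fun t _ => h1 t
  filter_upwards [h2] with ω hω
  exact mem_lattice_of_dense hX.step_pos (fun t => (hX.cadlag ω t).1) hD hω

variable {c : ℝ} (hc : 0 ≤ c)
include hc

lemma isProbabilityMeasure_tilt (t : ℝ≥0) :
    IsProbabilityMeasure (P.withDensity (tiltDensity X lam c t)) := by
  have := (hX.isSkipFreeMeasure.levyTilt hc).finite
  constructor
  have h1 : (compoundPoisson (levyTilt lam c) t) Set.univ = 1 := measure_univ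
  rw [← hX.withDensity_compoundPoisson hc, withDensity_apply _ MeasurableSet.univ,
    Measure.restrict_univ, ← hX.map_eq_compoundPoisson, lintegral_map (by fun_prop)
    (hX.measurable t)] at h1
  rwa [withDensity_apply _ MeasurableSet.univ, Measure.restrict_univ]

/-- Under the tilted measure the increment after `t` is independent of the past and has the
compound Poisson law of the tilted Lévy measure. -/
lemma map_prod_tilt {α : Type*} [MeasurableSpace α] (t δ : ℝ≥0) {Z : Ω → α}
    (hZ : Measurable[ℱ t] Z) :
    (P.withDensity (tiltDensity X lam c (t + δ))).map (fun ω => (Z ω, X (t + δ) ω - X t ω))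
      = ((P.withDensity (tiltDensity X lam c t)).map Z).prod
        (compoundPoisson (levyTilt lam c) δ) := by
  have := (hX.isSkipFreeMeasure.levyTilt hc).finite
  have := hX.isProbabilityMeasure_tilt hc t
  have hU : Measurable fun ω => X (t + δ) ω - X t ω := (hX.measurable _).sub (hX.measurable _)
  have h1 := hX.withDensity_compoundPoisson hc δ
  rw [← hX.map_sub_eq_compoundPoisson t] at h1
  have hfin : IsFiniteMeasure ((P.map fun ω => X (t + δ) ω - X t ω).withDensity
      fun x => ENNReal.ofReal (Real.exp (c * x - psi lam c * δ))) := by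
    rw [h1]; infer_instance
  have h2 := map_prod_withDensity_mul (ℱ.le t) hZ hU (hX.indep t (t + δ) (by simp))
    (hX.measurable_tiltDensity c t)
    (D' := fun x => ENNReal.ofReal (Real.exp (c * x - psi lam c * δ))) (by fun_prop)
  rw [h1] at h2
  rw [← h2]
  congr 2
  funext ω
  exact tiltDensity_add X lam c t δ ω

/-- The martingale property of the tilting density. -/
lemma withDensity_tilt_apply_of_le {s t : ℝ≥0} (hst : s ≤ t) {S : Set Ω}
    (hS : MeasurableSet[ℱ s] S) :
    P.withDensity (tiltDensity X lam c t) S = P.withDensity (tiltDensity X lam c s) S := by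
  have := (hX.isSkipFreeMeasure.levyTilt hc).finite
  -- The past event is treated as a `Prop`-valued variable `Z`; evaluating the product law on
  -- `{True} × ℝ` integrates out the increment, whose law has mass 1.
  have hZs : Measurable[ℱ s] fun ω => ω ∈ S := (@measurableSet_setOfPred _ (ℱ s) _).1 hS
  have hZ : Measurable fun ω => ω ∈ S := hZs.mono (ℱ.le s) le_rfl
  have h1 := hX.map_prod_tilt hc s (t - s) hZs
  rw [add_tsub_cancel_of_le hst] at h1
  have h2 := congrArg (fun μ => μ (({True} : Set Prop) ×ˢ (Set.univ : Set ℝ))) h1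
  have hm : Measurable fun ω => (ω ∈ S, X t ω - X s ω) :=
    hZ.prodMk ((hX.measurable _).sub (hX.measurable _))
  rw [Measure.prod_prod, measure_univ, mul_one, Measure.map_apply hZ (measurableSet_singleton _),
    Measure.map_apply hm ((measurableSet_singleton _).prod MeasurableSet.univ)] at h2
  convert h2 using 2 <;> ext ω <;> simp

end IsUpwardsSkipFreeLevyChain

end LevyChain
-- The one-step estimate for the chain under the change of measure
namespace LevyChain

lemma measurable_restrict_Iic {Ω : Type*} {m : MeasurableSpace Ω} {Y : ℝ≥0 → Ω → ℝ} {t : ℝ≥0}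
    (hY : ∀ s ≤ t, Measurable (Y s)) : Measurable fun ω (s : Set.Iic t) => Y s ω :=
  measurable_pi_iff.2 fun s => hY s s.2

lemma abs_walkGen_le {p : ℕ → ℝ} (hp : ∀ i, 0 ≤ p i) (hs : Summable p) {g : ℤ → ℝ} {M : ℝ}
    (hg : ∀ k, |g k| ≤ M) (k : ℤ) : |walkGen p g k| ≤ 2 * M * ∑' i, p i := by
  rw [walkGen, ← Real.norm_eq_abs]
  refine tsum_of_norm_bounded (hs.hasSum.mul_left (2 * M)) fun i => ?_
  rw [norm_mul, Real.norm_of_nonneg (hp i), mul_comm]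
  refine mul_le_mul_of_nonneg_right ?_ (hp i)
  exact (norm_sub_le _ _).trans ((add_le_add (hg _) (hg _)).trans (by linarith))

namespace IsSkipFreeMeasure

variable {ν : Measure ℝ} {h : ℝ} (hν : IsSkipFreeMeasure ν h)
include hν

lemma integral_index_eq_walkGen {g : ℤ → ℝ} {M : ℝ} (hg : ∀ k, |g k| ≤ M) (k : ℤ) :
    ∫ x, (g (k + ⌊x / h⌋) - g k) ∂ν = walkGen (jumpRate ν h) g k := by
  have := hν.finite
  have hm : Measurable fun x : ℝ => g (k + ⌊x / h⌋) - g k :=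
    ((measurable_of_countable fun j => g (k + j)).comp
      (Int.measurable_floor.comp (measurable_id.div_const h))).sub_const _
  have hi : Integrable (fun x : ℝ => g (k + ⌊x / h⌋) - g k) ν :=
    Integrable.of_bound hm.aestronglyMeasurable (M + M) (Eventually.of_forall fun x =>
      (norm_sub_le _ _).trans (add_le_add (hg _) (hg _)))
  rw [← (hν.hasSum_integral hi).tsum_eq, walkGen]
  refine tsum_congr fun i => ?_
  have : ⌊h * (1 - (i : ℝ)) / h⌋ = 1 - (i : ℤ) := by
    rw [mul_div_cancel_left₀ _ hν.step_pos.ne', Int.floor_eq_iff]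
    push_cast
    constructor <;> linarith
  rw [this, add_sub_assoc]

lemma tsum_jumpRate : ∑' i, jumpRate ν h i = ν.real Set.univ := by
  have := hν.finite
  have h1 := hν.hasSum_integral (integrable_const (1 : ℝ))
  simp only [mul_one] at h1
  rw [h1.tsum_eq]
  simp

/-- The second-order compound Poisson estimate is applied to `g(k + ⌊x/h⌋) - g(k) - δ L`, `L` the
generator at `k`. Its first-order part cancels identically, and its bound `2 M (1 + a)` explains the
constant `6 (1 + a) a²`. -/
lemma abs_integral_index_le {g : ℤ → ℝ} {M : ℝ} (hg : ∀ k, |g k| ≤ M) (k : ℤ) {δ : ℝ≥0}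
    (hδ : δ ≤ 1) :
    |∫ x, (g (k + ⌊x / h⌋) - g k - δ * walkGen (jumpRate ν h) g k) ∂(compoundPoisson ν δ)|
      ≤ 6 * (1 + ν.real Set.univ) * ν.real Set.univ ^ 2 * M * (δ : ℝ) ^ 2 := by
  have := hν.finite
  set a := ν.real Set.univ with ha
  have ha0 : 0 ≤ a := measureReal_nonneg
  have hM0 : 0 ≤ M := (abs_nonneg _).trans (hg 0)
  set L := walkGen (jumpRate ν h) g k with hL
  have hLb : |L| ≤ 2 * M * a := by
    rw [ha, ← hν.tsum_jumpRate]
    exact abs_walkGen_le (jumpRate_nonneg ν h) hν.summable_jumpRate hg k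
  have hδ' : (δ : ℝ) ≤ 1 := by exact_mod_cast hδ
  have hm0 : Measurable fun x : ℝ => g (k + ⌊x / h⌋) - g k :=
    ((measurable_of_countable fun j => g (k + j)).comp
      (Int.measurable_floor.comp (measurable_id.div_const h))).sub_const _
  have hb : ∀ x : ℝ, |g (k + ⌊x / h⌋) - g k - δ * L| ≤ 2 * M * (1 + a) := fun x => by
    have h1 : |(δ : ℝ) * L| ≤ 1 * (2 * M * a) := by
      rw [abs_mul, abs_of_nonneg δ.coe_nonneg]
      exact mul_le_mul hδ' hLb (abs_nonneg _) zero_le_one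
    have h2 : |g (k + ⌊x / h⌋) - g k| ≤ M + M := (abs_sub _ _).trans (add_le_add (hg _) (hg _))
    refine (abs_sub _ _).trans ((add_le_add h2 h1).trans (le_of_eq (by ring)))
  have h1 := abs_integral_compoundPoisson_sub_le ν δ
    (G := fun x => g (k + ⌊x / h⌋) - g k - δ * L) (hm0.sub_const _) hb
  have hi : Integrable (fun x : ℝ => g (k + ⌊x / h⌋) - g k) ν :=
    Integrable.of_bound hm0.aestronglyMeasurable (M + M) (Eventually.of_forall fun x =>
      (norm_sub_le _ _).trans (add_le_add (hg _) (hg _)))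
  have h2 : ∫ x, (g (k + ⌊x / h⌋) - g k - δ * L) ∂ν = L - a * (δ * L) := by
    rw [integral_sub hi (integrable_const _), hν.integral_index_eq_walkGen hg]
    simp [ha, hL]
  rw [h2] at h1
  simp only [zero_div, Int.floor_zero, add_zero, sub_self, zero_sub] at h1
  rw [show (1 - (δ : ℝ) * a) * -(δ * L) + δ * (L - a * (δ * L)) = 0 by ring, sub_zero] at h1
  exact h1.trans (le_of_eq (by ring))

end IsSkipFreeMeasure

namespace IsUpwardsSkipFreeLevyChain

variable {Ω : Type*} [mΩ : MeasurableSpace Ω] {P : Measure Ω} [IsProbabilityMeasure P]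
  {ℱ : Filtration ℝ≥0 mΩ} {X : ℝ≥0 → Ω → ℝ} {lam : Measure ℝ} {h : ℝ}
  (hX : IsUpwardsSkipFreeLevyChain P ℱ X lam h)
include hX

/-- A right-continuous process whose law is that of the chain under the exponential change of
measure is governed by the tilted jump rates. -/
theorem isWalkProcess_of_tilt {c : ℝ} (hc : 0 ≤ c) {Ω' : Type*} [MeasurableSpace Ω']
    {Q : Measure Ω'} {Y : ℝ≥0 → Ω' → ℝ} (hYm : ∀ t, Measurable (Y t))
    (hYc : ∀ ω t, ContinuousWithinAt (fun s => Y s ω) (Set.Ici t) t)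
    (hQ : ∀ (t : ℝ≥0) (B : Set (Set.Iic t → ℝ)), MeasurableSet B →
      Q {ω | (fun s : Set.Iic t => Y s ω) ∈ B} =
        ∫⁻ ω in {ω | (fun s : Set.Iic t => X s ω) ∈ B}, tiltDensity X lam c t ω ∂P) :
    IsWalkProcess Q Y h (jumpRate (levyTilt lam c) h) := by
  have hν := hX.isSkipFreeMeasure.levyTilt hc
  have := hν.finite
  have hYp : ∀ t : ℝ≥0, Measurable fun ω (s : Set.Iic t) => Y s ω := fun t =>
    measurable_pi_iff.2 fun s => hYm s
  have hXp : ∀ t : ℝ≥0, Measurable fun ω (s : Set.Iic t) => X s ω := fun t =>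
    measurable_pi_iff.2 fun s => hX.measurable s
  have hXp' : ∀ t : ℝ≥0, Measurable[ℱ t] fun ω (s : Set.Iic t) => X s ω := fun t =>
    measurable_restrict_Iic fun s hs => (hX.adapted s).mono (ℱ.mono hs) le_rfl
  have hmap : ∀ t : ℝ≥0, Q.map (fun ω (s : Set.Iic t) => Y s ω)
      = (P.withDensity (tiltDensity X lam c t)).map fun ω (s : Set.Iic t) => X s ω := by
    intro t
    refine Measure.ext fun B hB => ?_
    rw [Measure.map_apply (hYp t) hB, Measure.map_apply (hXp t) hB,
      withDensity_apply _ (hXp t hB)]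
    exact hQ t B hB
  have hmapt : ∀ t, Q.map (Y t) = (P.withDensity (tiltDensity X lam c t)).map (X t) := by
    intro t
    have h1 := congrArg (Measure.map fun y : Set.Iic t → ℝ => y ⟨t, Set.self_mem_Iic⟩) (hmap t)
    rwa [Measure.map_map (measurable_pi_apply _) (hYp t),
      Measure.map_map (measurable_pi_apply _) (hXp t)] at h1
  have hae : ∀ t (S : Set ℝ), MeasurableSet S → (∀ᵐ ω ∂P, X t ω ∈ S) → ∀ᵐ ω ∂Q, Y t ω ∈ S := by
    intro t S hS h1
    have h2 : ∀ᵐ x ∂((P.withDensity (tiltDensity X lam c t)).map (X t)), x ∈ S :=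
      (ae_map_iff (p := (· ∈ S)) (hX.measurable t).aemeasurable hS).2
        ((withDensity_absolutelyContinuous _ _).ae_le h1)
    rw [← hmapt] at h2
    exact ae_of_ae_map (hYm t).aemeasurable h2
  have hprob : IsProbabilityMeasure Q := by
    have := hX.isProbabilityMeasure_tilt hc 0
    have h1 : IsProbabilityMeasure (Q.map (Y 0)) := by
      rw [hmapt]
      exact Measure.isProbabilityMeasure_map (hX.measurable 0).aemeasurable
    constructor
    have h2 : (Q.map (Y 0)) Set.univ = 1 := measure_univ
    rwa [Measure.map_apply (hYm 0) MeasurableSet.univ, Set.preimage_univ] at h2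
  refine ⟨hprob, hX.step_pos, hYm, hYc, ?_, hae 0 {0} (measurableSet_singleton _) hX.start,
    6 * (1 + (levyTilt lam c).real Set.univ) * (levyTilt lam c).real Set.univ ^ 2, by positivity, ?_⟩
  · obtain ⟨D, hDc, hD⟩ := TopologicalSpace.exists_countable_dense ℝ≥0
    have h2 : ∀ᵐ ω ∂Q, ∀ t ∈ D, Y t ω ∈ lattice h := (ae_ball_iff hDc).2 fun t _ =>
      hae t _ (measurableSet_lattice h) (hX.ae_mem_lattice.mono fun ω hω => hω t)
    filter_upwards [h2] with ω hω
    exact mem_lattice_of_dense hX.step_pos (hYc ω) hD hω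
  · rintro g M hg t δ hδ E ⟨B, hB, rfl⟩
    set p := jumpRate (levyTilt lam c) h with hp
    set ρ := Q.map (fun ω (s : Set.Iic t) => Y s ω) with hR
    have hRprob : IsProbabilityMeasure ρ := Measure.isProbabilityMeasure_map (hYp t).aemeasurable
    have hYpair : Measurable fun ω => ((fun s : Set.Iic t => Y s ω), Y (t + δ) ω - Y t ω) :=
      (hYp t).prodMk ((hYm _).sub (hYm _))
    -- The pair (past, increment) is a function of the path up to `t + δ`, so its law transfers from
    -- the tilted `X` to `Y`, and there it factorizes.
    have hprod : Q.map (fun ω => ((fun s : Set.Iic t => Y s ω), Y (t + δ) ω - Y t ω))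
        = ρ.prod (compoundPoisson (levyTilt lam c) δ) := by
      rw [hR, hmap t, ← hX.map_prod_tilt hc t δ (hXp' t)]
      set r : (Set.Iic (t + δ) → ℝ) → (Set.Iic t → ℝ) × ℝ := fun y =>
        (fun s => y ⟨s, Set.mem_Iic.2 (s.2.trans (by simp))⟩, y ⟨t + δ, Set.self_mem_Iic⟩ - y ⟨t, Set.mem_Iic.2 (by simp)⟩) with hr
      have hrm : Measurable r := by
        refine Measurable.prodMk (measurable_pi_lambda _ fun s => measurable_pi_apply _) ?_
        exact (measurable_pi_apply _).sub (measurable_pi_apply _)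
      have h1 := congrArg (Measure.map r) (hmap (t + δ))
      rwa [Measure.map_map hrm (hYp _), Measure.map_map hrm (hXp _)] at h1
    set F : (Set.Iic t → ℝ) × ℝ → ℝ := fun z =>
      g ⌊(z.1 ⟨t, Set.self_mem_Iic⟩ + z.2) / h⌋ - g ⌊z.1 ⟨t, Set.self_mem_Iic⟩ / h⌋
        - δ * walkGen p g ⌊z.1 ⟨t, Set.self_mem_Iic⟩ / h⌋ with hF
    have hFm : Measurable F := by
      have e1 : Measurable fun z : (Set.Iic t → ℝ) × ℝ => z.1 ⟨t, Set.self_mem_Iic⟩ :=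
        (measurable_pi_apply _).comp measurable_fst
      have e2 : Measurable fun z : (Set.Iic t → ℝ) × ℝ => ⌊z.1 ⟨t, Set.self_mem_Iic⟩ / h⌋ :=
        Int.measurable_floor.comp (e1.div_const h)
      have e3 : Measurable fun z : (Set.Iic t → ℝ) × ℝ => ⌊(z.1 ⟨t, Set.self_mem_Iic⟩ + z.2) / h⌋ :=
        Int.measurable_floor.comp ((e1.add measurable_snd).div_const h)
      exact (((measurable_of_countable g).comp e3).sub ((measurable_of_countable g).comp e2)).sub
        (((measurable_of_countable (walkGen p g)).comp e2).const_mul _)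
    have hFi : Integrable F (ρ.prod (compoundPoisson (levyTilt lam c) δ)) := by
      refine Integrable.of_bound hFm.aestronglyMeasurable
        (M + M + δ * (2 * M * ∑' i, p i)) (Eventually.of_forall fun z => ?_)
      refine (norm_sub_le _ _).trans (add_le_add ((norm_sub_le _ _).trans
        (add_le_add (hg _) (hg _))) ?_)
      rw [norm_mul, Real.norm_of_nonneg δ.coe_nonneg]
      exact mul_le_mul_of_nonneg_left
        (abs_walkGen_le (jumpRate_nonneg _ h) hν.summable_jumpRate hg _) δ.coe_nonneg
    have hint : ∫ ω in (fun ω (s : Set.Iic t) => Y s ω) ⁻¹' B, (g ⌊Y (t + δ) ω / h⌋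
          - g ⌊Y t ω / h⌋ - δ * walkGen p g ⌊Y t ω / h⌋) ∂Q
        = ∫ y in B, (∫ x, F (y, x) ∂(compoundPoisson (levyTilt lam c) δ)) ∂ρ := by
      have h1 := setIntegral_prod F (s := B) (t := Set.univ) hFi.integrableOn
      rw [Measure.restrict_univ] at h1
      rw [← h1, ← hprod, setIntegral_map (hB.prod MeasurableSet.univ)
        hFm.aestronglyMeasurable hYpair.aemeasurable]
      have h2 : (fun ω => ((fun s : Set.Iic t => Y s ω), Y (t + δ) ω - Y t ω)) ⁻¹' (B ×ˢ Set.univ)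
          = (fun ω (s : Set.Iic t) => Y s ω) ⁻¹' B := by
        ext ω; simp
      rw [h2]
      refine integral_congr_ae (Eventually.of_forall fun ω => ?_)
      simp only [hF, add_sub_cancel]
    rw [hint, ← Real.norm_eq_abs]
    -- On the lattice `y t = h k`, so `⌊(y t + x) / h⌋` splits as `k + ⌊x / h⌋` and the estimate at
    -- a fixed index `k` applies.
    have hlat : ∀ᵐ y ∂ρ, y ⟨t, Set.self_mem_Iic⟩ ∈ lattice h := by
      refine (ae_map_iff (p := fun y : Set.Iic t → ℝ => y ⟨t, Set.self_mem_Iic⟩ ∈ lattice h)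
        (hYp t).aemeasurable ((measurable_pi_apply _) (measurableSet_lattice h))).2 ?_
      exact hae t _ (measurableSet_lattice h) (hX.ae_mem_lattice.mono fun ω hω => hω t)
    have hM0 : 0 ≤ M := (abs_nonneg _).trans (hg 0)
    refine (norm_setIntegral_le_of_norm_le_const_ae (C := 6 * (1 + (levyTilt lam c).real Set.univ)
      * (levyTilt lam c).real Set.univ ^ 2 * M * (δ : ℝ) ^ 2) (measure_lt_top _ _) ?_).trans
      (mul_le_of_le_one_right (by positivity) measureReal_le_one)
    · filter_upwards [ae_restrict_of_ae hlat] with y hy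
      obtain ⟨k, hk⟩ := hy
      have h1 := hν.abs_integral_index_le hg k hδ
      refine le_trans (le_of_eq ?_) h1
      rw [Real.norm_eq_abs]
      congr 1
      refine integral_congr_ae (Eventually.of_forall fun x => ?_)
      have hh := hX.step_pos.ne'
      have e1 : ⌊h * (k : ℝ) / h⌋ = k := by rw [mul_div_cancel_left₀ _ hh, Int.floor_intCast]
      have e2 : ⌊(h * (k : ℝ) + x) / h⌋ = k + ⌊x / h⌋ := by
        rw [add_div, mul_div_cancel_left₀ _ hh, Int.floor_intCast_add]
      simp only [hF, hk, e1, e2, hp]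

end IsUpwardsSkipFreeLevyChain

end LevyChain
namespace LevyChain

/-! ### Independence and stationarity of the process after a fixed time -/

namespace IsUpwardsSkipFreeLevyChain

variable {Ω : Type*} [mΩ : MeasurableSpace Ω] {P : Measure Ω}
  {ℱ : Filtration ℝ≥0 mΩ} {X : ℝ≥0 → Ω → ℝ} {lam : Measure ℝ} {h : ℝ}
  (hX : IsUpwardsSkipFreeLevyChain P ℱ X lam h)
include hX

lemma measurable_postPath (τ : ℝ≥0) : Measurable fun ω (r : ℝ≥0) => X (τ + r) ω - X τ ω :=
  measurable_pi_iff.2 fun _ => (hX.measurable _).sub (hX.measurable _)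

variable [IsProbabilityMeasure P]

lemma lintegral_increment {α : Type*} [MeasurableSpace α] (t δ : ℝ≥0) {Z : Ω → α}
    (hZ : Measurable[ℱ t] Z) {Φ : α × ℝ → ℝ≥0∞} (hΦ : Measurable Φ) :
    ∫⁻ ω, Φ (Z ω, X (t + δ) ω - X t ω) ∂P
      = ∫⁻ ω, ∫⁻ d, Φ (Z ω, d) ∂(compoundPoisson lam δ) ∂P := by
  have := hX.finite
  have hZ' : Measurable Z := hZ.mono (ℱ.le t) le_rfl
  have hU : Measurable fun ω => X (t + δ) ω - X t ω := (hX.measurable _).sub (hX.measurable _)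
  have hind : IndepFun Z (fun ω => X (t + δ) ω - X t ω) P := by
    rw [IndepFun_iff_Indep]
    exact indep_of_indep_of_le_left (hX.indep t (t + δ) (by simp)).symm hZ.comap_le
  have h1 := (indepFun_iff_map_prod_eq_prod_map_map hZ'.aemeasurable hU.aemeasurable).1 hind
  rw [hX.map_sub_eq_compoundPoisson] at h1
  rw [← lintegral_map hΦ (hZ'.prodMk hU), h1, lintegral_prod _ hΦ.aemeasurable,
    lintegral_map hΦ.lintegral_prod_right' hZ']

/-- The same constant `K` serves for all `τ` and all past events `A`: this yields independence of
the post-`τ` path from the past together with its stationarity. The largest time is removed by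
integrating out the last increment. -/
lemma exists_setLIntegral_prod_eq (I : Finset ℝ≥0) : ∀ f : ℝ≥0 → ℝ → ℝ≥0∞,
    (∀ j, Measurable (f j)) → ∃ K, ∀ (τ : ℝ≥0) (A : Set Ω), MeasurableSet[ℱ τ] A →
      ∫⁻ ω in A, ∏ j ∈ I, f j (X (τ + j) ω - X τ ω) ∂P = P A * K := by
  have := hX.finite
  induction I using Finset.induction_on_max with
  | empty => exact fun f hf => ⟨1, fun τ A hA => by simp⟩
  | insert a s hmax ih =>
    intro f hf
    have has : a ∉ s := fun has => lt_irrefl _ (hmax a has)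
    have key : ∀ b ≤ a, (∀ j ∈ s, j ≤ b) → ∀ (τ : ℝ≥0) (A : Set Ω), MeasurableSet[ℱ τ] A →
        ∫⁻ ω in A, ∏ j ∈ insert a s, f j (X (τ + j) ω - X τ ω) ∂P
        = ∫⁻ ω in A, (∏ j ∈ s, f j (X (τ + j) ω - X τ ω)) *
          ∫⁻ d, f a ((X (τ + b) ω - X τ ω) + d) ∂(compoundPoisson lam (a - b)) ∂P := by
      intro b hba hb τ A hA
      have hm : ∀ r ≤ τ + b, Measurable[ℱ (τ + b)] (X r) := fun r hr =>
        (hX.adapted r).mono (ℱ.mono hr) le_rfl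
      have hUm : ∀ j ≤ b, Measurable[ℱ (τ + b)] fun ω => X (τ + j) ω - X τ ω := fun j hj =>
        (hm _ (by gcongr)).sub (hm _ (by simp))
      have hA' : MeasurableSet[ℱ (τ + b)] A := ℱ.mono (by simp) _ hA
      have hG : Measurable[ℱ (τ + b)] (A.indicator fun ω => ∏ j ∈ s, f j (X (τ + j) ω - X τ ω)) :=
        Measurable.indicator (Finset.measurable_fun_prod s fun j hj =>
          (hf j).comp (hUm j (hb j hj))) hA'
      have h1 := hX.lintegral_increment (τ + b) (a - b)
        (Z := fun ω => (A.indicator (fun ω => ∏ j ∈ s, f j (X (τ + j) ω - X τ ω)) ω,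
          X (τ + b) ω - X τ ω)) (hG.prodMk (hUm b le_rfl))
        (Φ := fun z => z.1.1 * f a (z.1.2 + z.2))
        ((measurable_fst.comp measurable_fst).mul ((hf a).comp
          ((measurable_snd.comp measurable_fst).add measurable_snd)))
      rw [← lintegral_indicator (ℱ.le _ _ hA), ← lintegral_indicator (ℱ.le _ _ hA)]
      have h2 : τ + b + (a - b) = τ + a := by rw [add_assoc, add_tsub_cancel_of_le hba]
      rw [h2] at h1
      calc _ = _ := lintegral_congr fun ω => ?_
        _ = _ := h1
        _ = _ := lintegral_congr fun ω => ?_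
      · by_cases hω : ω ∈ A
        · simp only [Set.indicator_of_mem hω, Finset.prod_insert has]
          rw [mul_comm]
          congr 2
          ring
        · simp [Set.indicator_of_notMem hω]
      · simp only
        have hfa : Measurable fun d => f a (X (τ + b) ω - X τ ω + d) :=
          (hf a).comp (measurable_const.add measurable_id)
        rw [lintegral_const_mul _ hfa]
        by_cases hω : ω ∈ A
        · simp only [Set.indicator_of_mem hω]
        · simp [Set.indicator_of_notMem hω]
    rcases s.eq_empty_or_nonempty with rfl | hne
    · refine ⟨∫⁻ d, f a d ∂(compoundPoisson lam a), fun τ A hA => ?_⟩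
      rw [key 0 (by simp) (by simp) τ A hA]
      simp [mul_comm]
    · set b := s.max' hne with hb
      have hbs : b ∈ s := s.max'_mem hne
      -- The integrated factor depends on the path only through its value at the preceding time `b`,
      -- so it is absorbed into the test function at `b`.
      obtain ⟨K, hK⟩ := ih (Function.update f b fun x => f b x *
        ∫⁻ d, f a (x + d) ∂(compoundPoisson lam (a - b))) (fun j => by
          by_cases hj : j = b
          · subst hj
            rw [Function.update_self]
            refine (hf _).mul ?_
            exact Measurable.lintegral_prod_right' (f := fun z : ℝ × ℝ => f a (z.1 + z.2))
              ((hf a).comp (measurable_fst.add measurable_snd))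
          · rw [Function.update_of_ne hj]; exact hf j)
      refine ⟨K, fun τ A hA => ?_⟩
      rw [key b (hmax b hbs).le (fun j hj => s.le_max' j hj) τ A hA, ← hK τ A hA]
      refine lintegral_congr fun ω => ?_
      rw [← Finset.mul_prod_erase s _ hbs, ← Finset.mul_prod_erase s _ hbs, Function.update_self]
      rw [mul_right_comm]
      congr 1
      refine Finset.prod_congr rfl fun j hj => ?_
      rw [Function.update_of_ne (Finset.ne_of_mem_erase hj)]

lemma measure_inter_postPath (τ : ℝ≥0) {A : Set Ω} (hA : MeasurableSet[ℱ τ] A)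
    {S : Set (ℝ≥0 → ℝ)} (hS : MeasurableSet S) :
    P (A ∩ {ω | (fun r : ℝ≥0 => X (τ + r) ω - X τ ω) ∈ S})
      = P A * P {ω | (fun r : ℝ≥0 => X (0 + r) ω - X 0 ω) ∈ S} := by
  have hA' : MeasurableSet A := ℱ.le _ _ hA
  have hrect : ∀ (I : Finset ℝ≥0) (T : ℝ≥0 → Set ℝ), (∀ j, MeasurableSet (T j)) → ∃ K,
      ∀ (τ : ℝ≥0) (A : Set Ω), MeasurableSet[ℱ τ] A →
      P (A ∩ {ω | (fun r : ℝ≥0 => X (τ + r) ω - X τ ω) ∈ (I : Set ℝ≥0).pi T}) = P A * K := by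
    intro I T hT
    obtain ⟨K, hK⟩ := hX.exists_setLIntegral_prod_eq I (fun j => (T j).indicator 1)
      fun j => measurable_one.indicator (hT j)
    refine ⟨K, fun τ A hA => ?_⟩
    have hm : MeasurableSet
        {ω | (fun r : ℝ≥0 => X (τ + r) ω - X τ ω) ∈ (I : Set ℝ≥0).pi T} :=
      (hX.measurable_postPath τ) (MeasurableSet.pi I.countable_toSet fun j _ => hT j)
    rw [← hK τ A hA, Set.inter_comm, ← Measure.restrict_apply hm, ← lintegral_indicator_one hm]
    refine lintegral_congr fun ω => ?_
    classical
    simp only [Set.indicator_apply, Finset.prod_ite_zero, Pi.one_apply, Finset.prod_const_one]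
    congr 1
  have heq : (P.restrict A).map (fun ω (r : ℝ≥0) => X (τ + r) ω - X τ ω)
      = P A • P.map (fun ω (r : ℝ≥0) => X (0 + r) ω - X 0 ω) := by
    have : IsProbabilityMeasure (P.map fun ω (r : ℝ≥0) => X (0 + r) ω - X 0 ω) :=
      Measure.isProbabilityMeasure_map (hX.measurable_postPath 0).aemeasurable
    have : IsFiniteMeasure (P A • P.map fun ω (r : ℝ≥0) => X (0 + r) ω - X 0 ω) :=
      Measure.smul_finite _ (measure_ne_top _ _)
    -- Products of indicators settle the cylinder sets, a generating π-system; both measures are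
    -- finite with total mass `P A`.
    refine ext_of_generate_finite _ generateFrom_squareCylinders.symm
      (isPiSystem_squareCylinders (fun _ => MeasurableSpace.isPiSystem_measurableSet)
        (fun _ => Set.mem_ofPred.2 MeasurableSet.univ)) ?_ ?_
    · rintro _ ⟨I, T, hT, rfl⟩
      have hT' : ∀ j, MeasurableSet (T j) := fun j => hT j (Set.mem_univ j)
      have hm : MeasurableSet ((I : Set ℝ≥0).pi T) :=
        MeasurableSet.pi I.countable_toSet fun j _ => hT' j
      obtain ⟨K, hK⟩ := hrect I T hT'
      have h1 := hK τ A hA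
      have h2 := hK 0 Set.univ MeasurableSet.univ
      rw [Set.univ_inter, measure_univ, one_mul] at h2
      rw [Measure.map_apply (hX.measurable_postPath τ) hm, Measure.restrict_apply
        ((hX.measurable_postPath τ) hm), Measure.smul_apply,
        Measure.map_apply (hX.measurable_postPath 0) hm, smul_eq_mul, Set.inter_comm]
      rw [← h2] at h1
      exact h1
    · rw [Measure.map_apply (hX.measurable_postPath τ) MeasurableSet.univ, Measure.smul_apply,
        measure_univ]
      simp
  have h1 := congrArg (fun μ => μ S) heq
  rw [Measure.map_apply (hX.measurable_postPath τ) hS, Measure.restrict_apply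
    ((hX.measurable_postPath τ) hS), Measure.smul_apply,
    Measure.map_apply (hX.measurable_postPath 0) hS, smul_eq_mul, Set.inter_comm] at h1
  exact h1

lemma map_postPath (τ : ℝ≥0) : P.map (fun ω (r : ℝ≥0) => X (τ + r) ω - X τ ω)
    = P.map (fun ω (r : ℝ≥0) => X (0 + r) ω - X 0 ω) := by
  refine Measure.ext fun S hS => ?_
  rw [Measure.map_apply (hX.measurable_postPath τ) hS,
    Measure.map_apply (hX.measurable_postPath 0) hS]
  have h1 := hX.measure_inter_postPath τ MeasurableSet.univ hS
  rw [Set.univ_inter, measure_univ, one_mul] at h1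
  exact h1

lemma indep_postPath (τ : ℝ≥0) :
    Indep (MeasurableSpace.comap (fun ω (r : ℝ≥0) => X (τ + r) ω - X τ ω) inferInstance) (ℱ τ) P := by
  refine Indep.symm ((Indep_iff _ _ _).2 ?_)
  rintro A _ hA ⟨S, hS, rfl⟩
  have h1 := hX.measure_inter_postPath τ hA hS
  have h2 := hX.measure_inter_postPath τ MeasurableSet.univ hS
  rw [Set.univ_inter, measure_univ, one_mul] at h2
  rw [← h2] at h1
  exact h1

end IsUpwardsSkipFreeLevyChain

end LevyChain
namespace LevyChain

/-! ### Existence of the exponential change of measure on the path space -/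

lemma IsCadlag.add {f g : ℝ≥0 → ℝ} (hf : IsCadlag f) (hg : IsCadlag g) :
    IsCadlag fun t => f t + g t := by
  intro t
  obtain ⟨hf1, l, hl⟩ := hf t
  obtain ⟨hg1, m, hm⟩ := hg t
  exact ⟨hf1.add hg1, l + m, hl.add hm⟩

lemma isCadlag_const (a : ℝ) : IsCadlag fun _ => a :=
  fun _ => ⟨continuousWithinAt_const, a, tendsto_const_nhds⟩

lemma isCadlag_sum {ι : Type*} (s : Finset ι) {f : ι → ℝ≥0 → ℝ} (hf : ∀ i ∈ s, IsCadlag (f i)) :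
    IsCadlag fun t => ∑ i ∈ s, f i t := by
  classical
  induction s using Finset.induction_on with
  | empty => simpa using isCadlag_const 0
  | insert a s ha ih =>
    simp_rw [Finset.sum_insert ha]
    exact (hf a (by simp)).add (ih fun i hi => hf i (by simp [hi]))

/-- If `φ` is constant just before `t`, the left limit is `f (φ t)` itself; otherwise `φ` approaches
`φ t` strictly from below and the left limit of `f` is used. -/
lemma IsCadlag.comp_monotone {f : ℝ≥0 → ℝ} (hf : IsCadlag f) {φ : ℝ≥0 → ℝ≥0} (hφ : Continuous φ)
    (hm : Monotone φ) : IsCadlag fun t => f (φ t) := by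
  intro t
  refine ⟨(hf (φ t)).1.comp hφ.continuousWithinAt fun s hs => hm hs, ?_⟩
  by_cases h : ∃ s < t, φ s = φ t
  · obtain ⟨s, hst, hs⟩ := h
    refine ⟨f (φ t), tendsto_const_nhds.congr' ?_⟩
    filter_upwards [Ioo_mem_nhdsLT hst] with r hr
    rw [le_antisymm (hm hr.2.le) (hs ▸ hm hr.1.le)]
  · push Not at h
    obtain ⟨l, hl⟩ := (hf (φ t)).2
    refine ⟨l, hl.comp (tendsto_nhdsWithin_iff.2 ⟨hφ.continuousWithinAt.tendsto, ?_⟩)⟩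
    filter_upwards [self_mem_nhdsWithin] with r hr
    exact (hm (le_of_lt hr)).lt_of_ne (h r hr)

lemma isCadlag_of_eventuallyEq {f : ℝ≥0 → ℝ}
    (hf : ∀ t, ∃ g, IsCadlag g ∧ f =ᶠ[𝓝 t] g) : IsCadlag f := by
  intro t
  obtain ⟨g, hg, hfg⟩ := hf t
  obtain ⟨h1, l, hl⟩ := hg t
  exact ⟨h1.congr_of_eventuallyEq (hfg.filter_mono nhdsWithin_le_nhds) hfg.eq_of_nhds, l,
    hl.congr' (hfg.filter_mono nhdsWithin_le_nhds).symm⟩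

/-- The path that runs through the first `n` of the given unit-time blocks. -/
noncomputable def concatBlocks {Ω : Type*} (X : ℝ≥0 → Ω → ℝ) (n : ℕ) (w : ℕ → Ω) (t : ℝ≥0) : ℝ :=
  ∑ k ∈ Finset.range n, X (min (t - k) 1) (w k)

section Concat

variable {Ω : Type*} {X : ℝ≥0 → Ω → ℝ}

/-- Truncated subtraction makes `t - k = 0` for blocks that have not begun, and these contribute the
starting value 0. -/
lemma concatBlocks_eq (h0 : ∀ ω, X 0 ω = 0) {m n : ℕ} (hmn : m ≤ n) {t : ℝ≥0} (ht : t ≤ m)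
    (w : ℕ → Ω) : concatBlocks X n w t = concatBlocks X m w t := by
  refine (Finset.sum_subset (Finset.range_mono hmn) fun k _ hk => ?_).symm
  have hk' : m ≤ k := by simpa using hk
  have : t - (k : ℝ≥0) = 0 := tsub_eq_zero_of_le (ht.trans (by exact_mod_cast hk'))
  rw [this, zero_min, h0]

lemma isCadlag_concatBlocks (hX : ∀ ω, IsCadlag fun t => X t ω) (n : ℕ) (w : ℕ → Ω) :
    IsCadlag (concatBlocks X n w) :=
  isCadlag_sum _ fun k _ => (hX (w k)).comp_monotone
    (φ := fun t => min (t - (k : ℝ≥0)) 1) (by fun_prop)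
    fun _ _ hst => min_le_min (tsub_le_tsub_right hst _) le_rfl

lemma isCadlag_concatBlocks_ceil (hX : ∀ ω, IsCadlag fun t => X t ω) (h0 : ∀ ω, X 0 ω = 0)
    (w : ℕ → Ω) : IsCadlag fun t => concatBlocks X ⌈t⌉₊ w t := by
  refine isCadlag_of_eventuallyEq fun t => ⟨_, isCadlag_concatBlocks hX (⌈t⌉₊ + 1) w, ?_⟩
  have ht : t < ((⌈t⌉₊ + 1 : ℕ) : ℝ≥0) := by
    push_cast
    exact (Nat.le_ceil t).trans_lt (lt_add_of_pos_right _ zero_lt_one)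
  filter_upwards [Iio_mem_nhds ht] with s hs
  exact (concatBlocks_eq h0 (Nat.ceil_le.2 (le_of_lt hs)) (Nat.le_ceil s) w).symm

lemma concatBlocks_mem_lattice {h : ℝ} (hl : ∀ t ω, X t ω ∈ lattice h) (n : ℕ) (w : ℕ → Ω)
    (t : ℝ≥0) : concatBlocks X n w t ∈ lattice h :=
  Finset.sum_induction _ (· ∈ lattice h) (fun _ _ => add_mem_lattice) (zero_mem_lattice h)
    fun _ _ => hl _ _

end Concat

/-- Gluing a path and a subsequent unit-time block. -/
noncomputable def glue (n : ℕ) (z : (ℝ≥0 → ℝ) × (ℝ≥0 → ℝ)) (s : ℝ≥0) : ℝ :=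
  z.1 s + z.2 (min (s - n) 1)

lemma measurable_glue (n : ℕ) : Measurable (glue n) :=
  measurable_pi_iff.2 fun s => ((measurable_pi_apply s).comp measurable_fst).add
    ((measurable_pi_apply _).comp measurable_snd)

namespace IsUpwardsSkipFreeLevyChain

variable {Ω : Type*} [mΩ : MeasurableSpace Ω] {P : Measure Ω} [IsProbabilityMeasure P]
  {ℱ : Filtration ℝ≥0 mΩ} {X : ℝ≥0 → Ω → ℝ} {lam : Measure ℝ} {h : ℝ}
  (hX : IsUpwardsSkipFreeLevyChain P ℱ X lam h) {c : ℝ} (hc : 0 ≤ c)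
include hX hc

/-- Under the tilted measure, the path up to time `n + 1` is glued from the path up to time `n`
and an independent block distributed like the path up to time `1`. -/
lemma map_stopped_tilt_succ (n : ℕ) :
    (P.withDensity (tiltDensity X lam c ((n + 1 : ℕ) : ℝ≥0))).map
        (fun ω (s : ℝ≥0) => X (min s ((n + 1 : ℕ) : ℝ≥0)) ω - X 0 ω)
      = (((P.withDensity (tiltDensity X lam c (n : ℝ≥0))).map
          (fun ω (s : ℝ≥0) => X (min s (n : ℝ≥0)) ω - X 0 ω)).prod
        ((P.withDensity (tiltDensity X lam c 1)).map
          (fun ω (r : ℝ≥0) => X (0 + r) ω - X 0 ω))).map (glue n) := by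
  have := hX.isProbabilityMeasure_tilt hc 1
  have := hX.isProbabilityMeasure_tilt hc n
  set D' : (ℝ≥0 → ℝ) → ℝ≥0∞ := fun b => ENNReal.ofReal (Real.exp (c * b 1 - psi lam c * (1 : ℝ≥0)))
    with hD'
  have heval : Measurable fun b : ℝ≥0 → ℝ => b 1 := measurable_pi_apply 1
  have hD'm : Measurable D' := ENNReal.measurable_ofReal.comp
    (Real.measurable_exp.comp ((heval.const_mul c).sub_const _))
  -- The increment of the log-density over `[n, n+1]` is a function of the post-`n` path alone,
  -- which has the law of the path from time 0; it uses `X 0 = 0` a.s.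
  have hblock : (P.map fun ω (r : ℝ≥0) => X ((n : ℝ≥0) + r) ω - X n ω).withDensity D'
      = (P.withDensity (tiltDensity X lam c 1)).map (fun ω (r : ℝ≥0) => X (0 + r) ω - X 0 ω) := by
    rw [hX.map_postPath]
    refine Measure.ext fun S hS => ?_
    have hm := hX.measurable_postPath 0
    rw [withDensity_apply _ hS, setLIntegral_map hS hD'm hm, Measure.map_apply hm hS,
      withDensity_apply _ (hm hS)]
    refine lintegral_congr_ae (ae_restrict_of_ae ?_)
    filter_upwards [hX.start] with ω hω
    simp only [hD', tiltDensity, zero_add, hω, sub_zero]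
  have hfin : IsFiniteMeasure
      ((P.map fun ω (r : ℝ≥0) => X ((n : ℝ≥0) + r) ω - X n ω).withDensity D') := by
    rw [hblock]; infer_instance
  have hV : Measurable[ℱ n] fun ω (s : ℝ≥0) => X (min s (n : ℝ≥0)) ω - X 0 ω :=
    (@measurable_pi_iff _ _ _ (ℱ n) _ _).2 fun s =>
      ((hX.adapted _).mono (ℱ.mono (min_le_right _ _)) le_rfl).sub
      ((hX.adapted _).mono (ℱ.mono zero_le) le_rfl)
  have h1 := map_prod_withDensity_mul (ℱ.le n) hV (hX.measurable_postPath n) (hX.indep_postPath n)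
    (hX.measurable_tiltDensity c n) hD'm
  rw [hblock] at h1
  rw [← h1, Measure.map_map (measurable_glue n)
    ((hV.mono (ℱ.le _) le_rfl).prodMk (hX.measurable_postPath n))]
  have hdens : (fun ω => tiltDensity X lam c (n : ℝ≥0) ω *
      D' fun r : ℝ≥0 => X ((n : ℝ≥0) + r) ω - X n ω)
      = tiltDensity X lam c ((n + 1 : ℕ) : ℝ≥0) := by
    funext ω
    rw [Nat.cast_add, Nat.cast_one, tiltDensity_add]
  rw [hdens]
  congr 1
  funext ω s
  simp only [Function.comp_apply, glue]
  rcases le_total s n with hs | hs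
  · have h2 : s - (n : ℝ≥0) = 0 := tsub_eq_zero_of_le hs
    have h3 : s ≤ ((n + 1 : ℕ) : ℝ≥0) := hs.trans (by push_cast; simp)
    rw [h2, zero_min, add_zero, min_eq_left hs, min_eq_left h3]
    ring
  · have h2 : min s ((n + 1 : ℕ) : ℝ≥0) = (n : ℝ≥0) + min (s - n) 1 := by
      rw [← min_add_add_left, add_tsub_cancel_of_le hs]
      push_cast
      rfl
    rw [h2, min_eq_right hs]
    ring

/-- The exponential change of measure exists on the path space. -/
theorem exists_isExpTilt : ∃ Q : Measure (PathSpace h), IsExpTilt P X lam h c Q := by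
  have := hX.isProbabilityMeasure_tilt hc 1
  -- The path is replaced by 0 off a measurable set of full measure, so that every block starts at 0
  -- and is lattice-valued, as membership in the path space requires.
  obtain ⟨G, hG, hGm, hG'⟩ := (hX.start.and hX.ae_mem_lattice).exists_measurable_mem
  set X' : ℝ≥0 → Ω → ℝ := fun t => G.indicator (X t) with hX'
  have hX'm : ∀ t, Measurable (X' t) := fun t => (hX.measurable t).indicator hGm
  have hX'0 : ∀ ω, X' 0 ω = 0 := fun ω => by
    by_cases hω : ω ∈ G
    · simp [hX', hω, (hG' ω hω).1]
    · simp [hX', hω]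
  have hX'l : ∀ t ω, X' t ω ∈ lattice h := fun t ω => by
    by_cases hω : ω ∈ G
    · simpa [hX', hω] using (hG' ω hω).2 t
    · simpa [hX', hω] using zero_mem_lattice h
  have hX'c : ∀ ω, IsCadlag fun t => X' t ω := fun ω => by
    by_cases hω : ω ∈ G
    · simpa [hX', hω] using hX.cadlag ω
    · simpa [hX', hω] using isCadlag_const 0
  set μ := P.withDensity (tiltDensity X lam c 1) with hμ
  set W := Measure.infinitePi (fun _ : ℕ => μ) with hW
  have hSm : ∀ n, Measurable (concatBlocks X' n) := fun n => measurable_pi_iff.2 fun t =>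
    Finset.measurable_fun_sum _ fun k _ => (hX'm _).comp (measurable_pi_apply k)
  have hblock : μ.map (fun ω (r : ℝ≥0) => X' r ω)
      = μ.map (fun ω (r : ℝ≥0) => X (0 + r) ω - X 0 ω) := by
    refine Measure.map_congr ((withDensity_absolutelyContinuous _ _).ae_le ?_)
    filter_upwards [hG] with ω hω
    funext r
    simp [hX', hω, (hG' ω hω).1]
  have hpath : Measurable fun ω (r : ℝ≥0) => X' r ω := measurable_pi_iff.2 hX'm
  -- By induction, `n` independent blocks under the product measure reproduce the tilted law of the
  -- path stopped at `n`.
  have claim : ∀ n : ℕ, W.map (concatBlocks X' n)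
      = (P.withDensity (tiltDensity X lam c (n : ℝ≥0))).map
          (fun ω (s : ℝ≥0) => X (min s (n : ℝ≥0)) ω - X 0 ω) := by
    intro n
    induction n with
    | zero =>
      have := hX.isProbabilityMeasure_tilt hc 0
      have h1 : concatBlocks X' 0 = fun _ _ => (0 : ℝ) := by
        funext w t; simp [concatBlocks]
      rw [h1, Nat.cast_zero]
      simp
    | succ n ih =>
      rw [hX.map_stopped_tilt_succ hc n, ← ih, ← hblock]
      have hind : IndepFun (concatBlocks X' n) (fun (w : ℕ → Ω) (r : ℝ≥0) => X' r (w n)) W := by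
        have h1 : iIndepFun (fun (i : ℕ) (w : ℕ → Ω) => w i) W :=
          iIndepFun_infinitePi (P := fun _ : ℕ => μ) (X := fun _ ω => ω) fun _ => measurable_id
        have h2 := h1.indepFun_finset (Finset.range n) {n} (by simp) fun i => measurable_pi_apply i
        have h3 : Measurable fun (y : Finset.range n → Ω) (t : ℝ≥0) =>
            ∑ k : Finset.range n, X' (min (t - ((k : ℕ) : ℝ≥0)) 1) (y k) :=
          measurable_pi_iff.2 fun t => Finset.measurable_fun_sum _ fun k _ =>
            (hX'm _).comp (measurable_pi_apply k)
        have h4 : Measurable fun (y : ({n} : Finset ℕ) → Ω) (r : ℝ≥0) =>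
            X' r (y ⟨n, by simp⟩) :=
          measurable_pi_iff.2 fun t => (hX'm _).comp (measurable_pi_apply _)
        have h5 := h2.comp h3 h4
        refine (h5.congr (Eventually.of_forall fun w => ?_) (Eventually.of_forall fun w => rfl))
        funext t
        simp only [Function.comp_apply, concatBlocks]
        exact Finset.sum_coe_sort (Finset.range n) (fun k => X' (min (t - (k : ℝ≥0)) 1) (w k))
      have hm2 : Measurable fun (w : ℕ → Ω) (r : ℝ≥0) => X' r (w n) :=
        hpath.comp (measurable_pi_apply n)
      have h1 := (indepFun_iff_map_prod_eq_prod_map_map (hSm n).aemeasurable hm2.aemeasurable).1 hind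
      have h2 : W.map (fun (w : ℕ → Ω) (r : ℝ≥0) => X' r (w n))
          = μ.map (fun ω (r : ℝ≥0) => X' r ω) := by
        rw [← (measurePreserving_eval_infinitePi (fun _ : ℕ => μ) n).map_eq,
          Measure.map_map hpath (measurable_pi_apply n)]
        rfl
      rw [h2] at h1
      rw [← h1, Measure.map_map (measurable_glue n) ((hSm n).prodMk hm2)]
      congr 1
      funext w t
      simp only [concatBlocks, Finset.sum_range_succ, Function.comp_apply, glue]
  set Y : (ℕ → Ω) → PathSpace h := fun w => ⟨fun t => concatBlocks X' ⌈t⌉₊ w t,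
    isCadlag_concatBlocks_ceil hX'c hX'0 w, fun t => concatBlocks_mem_lattice hX'l _ w t⟩ with hY
  have hYm : Measurable Y := Measurable.subtype_mk
    (measurable_pi_iff.2 fun t => (measurable_pi_apply t).comp (hSm _))
  refine ⟨W.map Y, fun t B hB => ?_⟩
  have hr : Measurable fun (f : PathSpace h) (s : Set.Iic t) => f.1 s :=
    measurable_pi_iff.2 fun s => (measurable_pi_apply _).comp measurable_subtype_coe
  have hr' : Measurable fun (y : ℝ≥0 → ℝ) (s : Set.Iic t) => y s :=
    measurable_pi_iff.2 fun s => measurable_pi_apply _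
  have hXp : Measurable[ℱ t] fun ω (s : Set.Iic t) => X s ω :=
    measurable_restrict_Iic fun s hs => (hX.adapted s).mono (ℱ.mono hs) le_rfl
  have htn : t ≤ (⌈t⌉₊ : ℝ≥0) := Nat.le_ceil t
  have hVm : Measurable fun ω (s : ℝ≥0) => X (min s (⌈t⌉₊ : ℝ≥0)) ω - X 0 ω :=
    measurable_pi_iff.2 fun s => (hX.measurable _).sub (hX.measurable _)
  change W.map Y ((fun (f : PathSpace h) (s : Set.Iic t) => f.1 s) ⁻¹' B) = _
  have h1 : Y ⁻¹' ((fun (f : PathSpace h) (s : Set.Iic t) => f.1 s) ⁻¹' B)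
      = concatBlocks X' ⌈t⌉₊ ⁻¹' ((fun (y : ℝ≥0 → ℝ) (s : Set.Iic t) => y s) ⁻¹' B) := by
    ext w
    have : (fun s : Set.Iic t => (Y w).1 s) = fun s : Set.Iic t => concatBlocks X' ⌈t⌉₊ w s := by
      funext s
      exact (concatBlocks_eq hX'0 (Nat.ceil_mono s.2) (Nat.le_ceil _) w).symm
    simp only [Set.mem_preimage, this]
  rw [Measure.map_apply hYm (hr hB), h1, ← Measure.map_apply (hSm _) (hr' hB), claim,
    Measure.map_apply hVm (hr' hB)]
  have h2 : (P.withDensity (tiltDensity X lam c (⌈t⌉₊ : ℝ≥0)))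
      ((fun ω (s : ℝ≥0) => X (min s (⌈t⌉₊ : ℝ≥0)) ω - X 0 ω) ⁻¹'
        ((fun (y : ℝ≥0 → ℝ) (s : Set.Iic t) => y s) ⁻¹' B))
      = (P.withDensity (tiltDensity X lam c (⌈t⌉₊ : ℝ≥0)))
        ((fun ω (s : Set.Iic t) => X s ω) ⁻¹' B) := by
    refine measure_congr ((withDensity_absolutelyContinuous _ _).ae_le ?_)
    filter_upwards [hX.start] with ω hω
    apply propext
    change (fun s : Set.Iic t => X (min (s : ℝ≥0) (⌈t⌉₊ : ℝ≥0)) ω - X 0 ω) ∈ B ↔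
      (fun s : Set.Iic t => X s ω) ∈ B
    have : (fun s : Set.Iic t => X (min (s : ℝ≥0) (⌈t⌉₊ : ℝ≥0)) ω - X 0 ω)
        = fun s : Set.Iic t => X s ω := by
      funext s
      rw [hω, sub_zero, min_eq_left (le_trans s.2 htn)]
    rw [this]
  -- The construction identifies the law with the density at `⌈t⌉`; the martingale property lowers
  -- it to the density at `t`.
  rw [h2, hX.withDensity_tilt_apply_of_le hc htn (hXp hB),
    withDensity_apply _ ((hXp.mono (ℱ.le t) le_rfl) hB)]
  rfl

end IsUpwardsSkipFreeLevyChain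

end LevyChain
namespace LevyChain

/-! ### The depth distribution and the scale function -/

lemma exists_abs_le_of_eventually_const {g : ℤ → ℝ} {a b : ℤ} (hab : a ≤ b)
    (ha : ∀ k ≤ a, g k = g a) (hb : ∀ k, b ≤ k → g k = g b) : ∃ M, ∀ k, |g k| ≤ M := by
  refine ⟨∑ j ∈ Finset.Icc a b, |g j|, fun k => ?_⟩
  have key : ∀ j ∈ Finset.Icc a b, |g j| ≤ ∑ j ∈ Finset.Icc a b, |g j| := fun j hj =>
    Finset.single_le_sum (f := fun j => |g j|) (fun _ _ => abs_nonneg _) hj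
  rcases le_total k a with h1 | h1
  · rw [ha k h1]; exact key a (by simp [hab])
  · rcases le_total b k with h2 | h2
    · rw [hb k h2]; exact key b (by simp [hab])
    · exact key k (by simp [h1, h2])

/-- The generator at `k` only depends on the values up to `k + 1`. -/
lemma walkGen_congr {p : ℕ → ℝ} {f g : ℤ → ℝ} {k : ℤ} (hfg : ∀ j ≤ k + 1, f j = g j) :
    walkGen p f k = walkGen p g k := by
  refine tsum_congr fun i => ?_
  rw [hfg (k + 1 - i) (by omega), hfg k (by omega)]

lemma walkGen_shift (p : ℕ → ℝ) (g : ℤ → ℝ) (a k : ℤ) :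
    walkGen p (fun j => g (j + a)) k = walkGen p g (k + a) := by
  refine tsum_congr fun i => ?_
  simp only [show k + 1 - (i : ℤ) + a = k + a + 1 - i by ring]

/-- The inequality is strict because the path stays at its value at `t` for a positive time. -/
lemma lt_entranceAbove {f : ℝ≥0 → ℝ} {h x : ℝ} (hh : 0 < h)
    (hc : ∀ t, ContinuousWithinAt f (Set.Ici t) t) (hl : ∀ s, f s ∈ lattice h) {t : ℝ≥0}
    (ht : ∀ s ≤ t, f s < x) : (t : ℝ≥0∞) < entranceAbove x f := by
  obtain ⟨ε, hε, hconst⟩ := exists_eq_of_right_cont hh (hc t) hl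
  have h1 : ((t + ε : ℝ≥0) : ℝ≥0∞) ≤ entranceAbove x f := by
    refine le_iInf₂ fun s hs => ENNReal.coe_le_coe.2 ?_
    by_contra hlt
    push Not at hlt
    rcases le_total s t with hst | hst
    · exact absurd (ht s hst) (not_lt.2 hs)
    · rw [hconst s hst hlt] at hs
      exact absurd (ht t le_rfl) (not_lt.2 hs)
  exact (ENNReal.coe_lt_coe.2 (lt_add_of_pos_right t hε)).trans_le h1

lemma entranceAbove_le {f : ℝ≥0 → ℝ} {x : ℝ} {t : ℝ≥0} (ht : x ≤ f t) :
    entranceAbove x f ≤ t :=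
  iInf₂_le t ht

namespace IsSkipFreeMeasure

variable {ν : Measure ℝ} {h : ℝ} (hν : IsSkipFreeMeasure ν h)
include hν

/-- The process leaves every bounded set. -/
lemma ae_exists_exit_Ico {Ω : Type*} [MeasurableSpace Ω] {Q : Measure Ω} {Y : ℝ≥0 → Ω → ℝ}
    (hY : IsWalkProcess Q Y h (jumpRate ν h)) (lo hi : ℤ) :
    ∀ᵐ ω ∂Q, ∃ t, ⌊Y t ω / h⌋ ∉ Set.Ico lo hi := by
  have hψ := hν.psi_pos (β := PhiZero ν + 1) (by linarith)
  have hβ : 0 ≤ PhiZero ν + 1 := by linarith [hν.PhiZero_mem.1]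
  set u := Real.exp ((PhiZero ν + 1) * h) with hu
  have hu0 : 0 < u := Real.exp_pos _
  have hu1 : 1 ≤ u := Real.one_le_exp (mul_nonneg hβ hν.step_pos.le)
  have hgb : ∀ k : ℤ, |u ^ (min k hi)| ≤ u ^ hi := fun k => by
    rw [abs_of_pos (zpow_pos hu0 _)]
    exact zpow_le_zpow_right₀ hu1 (min_le_right _ _)
  -- For `u = exp (β h)` with `ψ(β) > 0`, the generator of `u ^ k` is `ψ(β) u ^ k`, bounded below on
  -- the interval. Truncation at `hi` makes the function bounded and is invisible to the generator
  -- below `hi`, as upward jumps have size 1.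
  refine hY.ae_exists_exit (g := fun k => u ^ (min k hi)) (M := u ^ hi)
    (c := u ^ lo * psi ν (PhiZero ν + 1)) (mul_pos (zpow_pos hu0 _) hψ) hgb ?_
    ⟨_, abs_walkGen_le (jumpRate_nonneg ν h) hν.summable_jumpRate hgb⟩
  rintro k ⟨hk1, hk2⟩
  rw [walkGen_congr (g := fun j => u ^ j) fun j hj => by rw [min_eq_left (by omega)]]
  have h1 : walkGen (jumpRate ν h) (fun j => u ^ j) k = u ^ k * psi ν (PhiZero ν + 1) := by
    rw [walkGen, ← ((hν.hasSum_psi hβ).mul_left (u ^ k)).tsum_eq]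
    refine tsum_congr fun i => ?_
    rw [add_sub_assoc, zpow_add₀ hu0.ne']
    ring
  rw [h1]
  exact mul_le_mul_of_nonneg_right (zpow_le_zpow_right₀ hu1 hk1) hψ.le

/-- Optional stopping of the harmonic `w`, shifted by `n`, at the exit from `[-n, 1)`: it equals `w
n` at the start, `w (n + 1)` at an exit through the top, and 0 at an exit below. Exit through the
top is the event that the depth is at most `n h`. -/
lemma walkScale_mul_depth {Q : Measure (PathSpace h)}
    (hY : IsWalkProcess Q (fun t (f : PathSpace h) => f.1 t) h (jumpRate ν h)) (n : ℕ) :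
    walkScale (jumpRate ν h) (∑' i, jumpRate ν h i) (n + 1) *
        (Q {f | depth h f.1 ≤ (((n : ℝ) * h : ℝ) : EReal)}).toReal
      = walkScale (jumpRate ν h) (∑' i, jumpRate ν h i) n := by
  have := hY.prob
  have hh := hν.step_pos
  set p := jumpRate ν h with hp
  have h0 : 0 < p 0 := hν.jumpRate_zero_pos
  set v := walkScaleInt p (∑' i, p i) with hv
  set w := walkScale p (∑' i, p i) with hw
  set g : ℤ → ℝ := fun k => v (min k 1 + n) with hg
  obtain ⟨M, hM⟩ : ∃ M, ∀ k, |g k| ≤ M := by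
    refine exists_abs_le_of_eventually_const (a := -(n : ℤ) - 1) (b := 1) (by omega) ?_ ?_
    · intro k hk
      simp only [hg, hv]
      rw [walkScaleInt_of_neg _ _ (by omega), walkScaleInt_of_neg _ _ (by omega)]
    · intro k hk
      simp only [hg]
      rw [min_eq_right hk, min_self]
  have hgen : ∀ k ∈ Set.Ico (-(n : ℤ)) 1, walkGen p g k = 0 * g k := by
    rintro k ⟨hk1, hk2⟩
    rw [walkGen_congr (g := fun j => v (j + n)) fun j hj => by
      simp only [hg]; rw [min_eq_left (by omega)], walkGen_shift, zero_mul]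
    obtain ⟨m, hm⟩ := Int.eq_ofNat_of_zero_le (show 0 ≤ k + n by omega)
    rw [hm, walkGen]
    have h1 := (hasSum_walkGen_walkScaleInt h0.ne' hν.summable_jumpRate (∑' i, p i) m).tsum_eq
    simpa using h1
  set E : Set (PathSpace h) := {f | depth h f.1 ≤ (((n : ℝ) * h : ℝ) : EReal)} with hE
  have hV : ∀ᵐ f ∂Q, ∀ t : ℝ≥0, ⌊f.1 t / h⌋ ∉ Set.Ico (-(n : ℤ)) 1 →
      (∀ s < t, ⌊f.1 s / h⌋ ∈ Set.Ico (-(n : ℤ)) 1) →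
      E.indicator (fun _ => w (n + 1)) f = Real.exp (-(0 * t)) * g ⌊f.1 t / h⌋ := by
    refine Eventually.of_forall fun f t ht hlt => ?_
    have hc : ∀ t, ContinuousWithinAt f.1 (Set.Ici t) t := fun t => (f.2.1 t).1
    have hfl : ∀ s, f.1 s = h * ⌊f.1 s / h⌋ := fun s => by
      obtain ⟨k, hk⟩ := f.2.2 s
      rw [hk, mul_div_cancel_left₀ _ hh.ne', Int.floor_intCast]
    rw [zero_mul, neg_zero, Real.exp_zero, one_mul]
    simp only [Set.mem_Ico, not_and_or, not_le, not_lt] at ht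
    rcases ht with ht | ht
    · have hnE : f ∉ E := by
        intro hf
        have h1 : (t : ℝ≥0∞) < entranceAbove h f.1 := by
          refine lt_entranceAbove hh hc f.2.2 fun s hs => ?_
          have h2 : ⌊f.1 s / h⌋ < 1 := by
            rcases hs.lt_or_eq with hs | rfl
            · exact (hlt s hs).2
            · omega
          have h3 : f.1 s / h < 1 := by exact_mod_cast Int.floor_lt.1 h2
          rwa [div_lt_one hh] at h3
        have h2 : ((-(f.1 t) : ℝ) : EReal) ≤ depth h f.1 :=
          le_iSup₂ (f := fun (t : ℝ≥0) (_ : (t : ℝ≥0∞) < entranceAbove h f.1) =>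
            ((-(f.1 t) : ℝ) : EReal)) t h1
        have h3 : -(f.1 t) ≤ n * h := EReal.coe_le_coe_iff.1 (h2.trans hf)
        have h4 : f.1 t / h < -(n : ℤ) := by exact_mod_cast Int.floor_lt.1 ht
        rw [div_lt_iff₀ hh] at h4
        push_cast at h4
        linarith
      rw [Set.indicator_of_notMem hnE]
      simp only [hg, hv]
      rw [walkScaleInt_of_neg _ _ (by omega)]
    · have hfE : f ∈ E := by
        have h1 : h ≤ f.1 t := by
          have h2 : (1 : ℝ) ≤ f.1 t / h := by exact_mod_cast Int.le_floor.1 ht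
          rwa [one_le_div hh] at h2
        refine iSup₂_le fun s hs => EReal.coe_le_coe_iff.2 ?_
        have h2 : s < t := ENNReal.coe_lt_coe.1 (hs.trans_le (entranceAbove_le h1))
        have h3 : ((-(n : ℤ) : ℤ) : ℝ) ≤ f.1 s / h := Int.le_floor.1 (hlt s h2).1
        rw [le_div_iff₀ hh] at h3
        push_cast at h3
        linarith
      rw [Set.indicator_of_mem hfE]
      simp only [hg, hv]
      rw [min_eq_right ht, show (1 : ℤ) + n = ((n + 1 : ℕ) : ℤ) by push_cast; ring,
        walkScaleInt_natCast]
  obtain ⟨hint, hval⟩ := hY.integral_exit (hν.ae_exists_exit_Ico hY _ _) le_rfl hM hgen hV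
  have hw1 : 1 ≤ w (n + 1) := one_le_walkScale (jumpRate_nonneg ν h) h0 hν.summable_jumpRate _
  have : NeZero (w (n + 1)) := ⟨by linarith⟩
  -- Measurability of the depth event is read off from its indicator multiplied by the nonzero `w (n
  -- + 1)`, which optional stopping shows to be integrable.
  have hEm : NullMeasurableSet E Q :=
    (aemeasurable_indicator_const_iff (w (n + 1))).1
      hint.aestronglyMeasurable.aemeasurable
  rw [integral_indicator₀ hEm, setIntegral_const, smul_eq_mul] at hval
  have hg0 : g 0 = w n := by
    simp only [hg, hv]
    rw [min_eq_left (by norm_num), zero_add, walkScaleInt_natCast]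
  rw [← hg0, ← hval, mul_comm]
  rfl

lemma scaleRaw_eq {Q : Measure (PathSpace h)}
    (hY : IsWalkProcess Q (fun t (f : PathSpace h) => f.1 t) h (jumpRate ν h)) (x : ℝ) :
    scaleRaw h Q x = walkScale (jumpRate ν h) (∑' i, jumpRate ν h i) ⌊x / h⌋₊ := by
  have h0 := hν.jumpRate_zero_pos
  have hw1 := one_le_walkScale (jumpRate_nonneg ν h) h0 hν.summable_jumpRate
  have key : ∀ n : ℕ, ∏ r ∈ Finset.Icc 1 n,
      (Q {f | depth h f.1 ≤ ((((r : ℝ) - 1) * h : ℝ) : EReal)}).toReal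
      = 1 / walkScale (jumpRate ν h) (∑' i, jumpRate ν h i) n := by
    intro n
    induction n with
    | zero => simp [walkScale_zero h0.ne']
    | succ n ih =>
      rw [Finset.prod_Icc_succ_top (by omega), ih]
      have h2 := hν.walkScale_mul_depth hY n
      have h3 := hw1 n
      have h4 := hw1 (n + 1)
      have h5 : (((n + 1 : ℕ) : ℝ) - 1) = n := by push_cast; ring
      rw [h5, div_mul_eq_mul_div, one_mul, div_eq_div_iff (by linarith) (by linarith), one_mul,
        mul_comm]
      exact h2
  rw [scaleRaw, key, one_div_one_div]

end IsSkipFreeMeasure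

end LevyChain
namespace LevyChain

/-! ### The two-sided exit problem -/

/-- Substituting `u z` for `z` in the denominator of the tilted generating function gives `u` times
the untilted denominator. This is the factor `exp (Φ(q) ⌊x/h⌋ h)` in `W^{(q)}`. -/
lemma walkScale_zpow_mul {p : ℕ → ℝ} (h0 : p 0 ≠ 0) (s : ℝ) {u : ℝ} (hu : u ≠ 0) (n : ℕ) :
    u ^ n * walkScale (fun i => p i * u ^ (1 - i : ℤ)) s n = walkScale p s n := by
  set A : PowerSeries ℝ := PowerSeries.mk p - PowerSeries.C s * PowerSeries.X with hA
  set A' : PowerSeries ℝ := PowerSeries.mk (fun i : ℕ => p i * u ^ (1 - i : ℤ)) -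
    PowerSeries.C s * PowerSeries.X with hA'
  have hc : PowerSeries.constantCoeff A ≠ 0 := by simp [hA, h0]
  have hc' : PowerSeries.constantCoeff A' ≠ 0 := by simp [hA', h0, hu]
  have h1 : PowerSeries.rescale u A' = PowerSeries.C u * A := by
    ext n
    have hn : u ^ n * u ^ (1 - (n : ℤ)) = u := by
      rw [← zpow_natCast, ← zpow_add₀ hu, add_sub_cancel, zpow_one]
    simp only [hA, hA', PowerSeries.coeff_rescale, map_sub, PowerSeries.coeff_mk,
      PowerSeries.coeff_C_mul, PowerSeries.coeff_X]
    split_ifs with h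
    · subst h
      linear_combination p 1 * hn
    · linear_combination p n * hn
  have h2 := congrArg (PowerSeries.rescale u) (PowerSeries.mul_inv_cancel A' hc')
  rw [map_mul, h1, map_one] at h2
  have h3 : PowerSeries.C u * PowerSeries.rescale u A'⁻¹ = A⁻¹ := by
    rw [PowerSeries.eq_inv_iff_mul_eq_one hc]
    linear_combination h2
  rw [walkScale, walkScale, ← hA, ← hA', ← h3, PowerSeries.coeff_C_mul, PowerSeries.coeff_C_mul,
    PowerSeries.coeff_C_mul, PowerSeries.coeff_rescale]
  simp
  ring

/-- The discrete counterpart of `Z^{(q)}`. -/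
noncomputable def walkScaleSum (p : ℕ → ℝ) (q : ℝ) (k : ℤ) : ℝ :=
  1 + q / p 0 * ∑ j ∈ Finset.range k.toNat, walkScale p (q + ∑' i, p i) j

lemma walkScaleSum_of_nonpos (p : ℕ → ℝ) (q : ℝ) {k : ℤ} (hk : k ≤ 0) : walkScaleSum p q k = 1 := by
  simp [walkScaleSum, Int.toNat_of_nonpos hk]

lemma walkScaleSum_add_one (p : ℕ → ℝ) (q : ℝ) (k : ℤ) :
    walkScaleSum p q (k + 1) =
      walkScaleSum p q k + q / p 0 * walkScaleInt p (q + ∑' i, p i) k := by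
  rcases lt_or_ge k 0 with hk | hk
  · rw [walkScaleSum_of_nonpos _ _ hk, walkScaleSum_of_nonpos _ _ hk.le,
      walkScaleInt_of_neg _ _ hk, mul_zero, add_zero]
  · obtain ⟨n, rfl⟩ := Int.eq_ofNat_of_zero_le hk
    rw [walkScaleInt_natCast, walkScaleSum, walkScaleSum, show ((n : ℤ) + 1).toNat = n + 1 by omega,
      Int.toNat_natCast, Finset.sum_range_succ]
    ring

/-- Induction on the starting point: the shift by one adds `(q / p 0) w`, whose generator is `q`
times itself. At 0 only the upward jump changes the value, by `q / p 0` at rate `p 0`. -/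
lemma hasSum_walkGen_walkScaleSum {p : ℕ → ℝ} (h0 : p 0 ≠ 0) (hs : Summable p) (q : ℝ) (n : ℕ) :
    HasSum (fun i : ℕ => p i * (walkScaleSum p q ((n : ℤ) + 1 - i) - walkScaleSum p q n))
      (q * walkScaleSum p q n) := by
  induction n with
  | zero =>
    have h1 : walkScaleSum p q 1 = 1 + q / p 0 := by
      have h2 := walkScaleInt_natCast p (q + ∑' i, p i) 0
      rw [walkScale_zero h0, Nat.cast_zero] at h2
      rw [← zero_add (1 : ℤ), walkScaleSum_add_one, walkScaleSum_of_nonpos _ _ le_rfl, h2, mul_one]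
    convert hasSum_single (f := fun i : ℕ => p i * (walkScaleSum p q (((0 : ℕ) : ℤ) + 1 - i) -
      walkScaleSum p q ((0 : ℕ) : ℤ))) 0 ?_ using 1
    · simp [h1, walkScaleSum_of_nonpos p q le_rfl]
      field_simp
    · intro i hi
      rw [walkScaleSum_of_nonpos _ _ (by omega), walkScaleSum_of_nonpos _ _ (by simp), sub_self,
        mul_zero]
  | succ n ih =>
    have h1 := ih.add ((hasSum_walkGen_walkScaleInt h0 hs (q + ∑' i, p i) n).mul_left (q / p 0))
    convert h1 using 1
    · ext i
      rw [show ((n + 1 : ℕ) : ℤ) + 1 - i = (n + 1 - i) + 1 by push_cast; ring, Nat.cast_add_one,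
        walkScaleSum_add_one, walkScaleSum_add_one]
      ring
    · rw [Nat.cast_add_one, walkScaleSum_add_one, walkScaleInt_natCast]
      ring

lemma intervalIntegral_floor_div {f : ℝ → ℝ} {a : ℕ → ℝ} {h : ℝ} (hh : 0 < h)
    (hf : ∀ x, 0 ≤ x → f x = a ⌊x / h⌋₊) (n : ℕ) :
    ∫ z in (0 : ℝ)..(n * h), f z = h * ∑ j ∈ Finset.range n, a j := by
  have hcongr : ∀ j : ℕ, Set.EqOn (fun _ => a j) f (Set.Ioo ((j : ℝ) * h) ((j + 1 : ℕ) * h)) := by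
    intro j z hz
    have hz0 : 0 ≤ z := le_trans (by positivity) hz.1.le
    have h1 : ⌊z / h⌋₊ = j := by
      rw [Nat.floor_eq_iff (by positivity), le_div_iff₀ hh, div_lt_iff₀ hh]
      exact ⟨hz.1.le, by simpa using hz.2⟩
    simp only [hf z hz0, h1]
  have hle : ∀ j : ℕ, (j : ℝ) * h ≤ (j + 1 : ℕ) * h := fun j => by push_cast; nlinarith
  have key := intervalIntegral.sum_integral_adjacent_intervals (μ := volume) (f := f)
    (a := fun j : ℕ => (j : ℝ) * h) (n := n) fun j _ => by
      refine (intervalIntegrable_iff_integrableOn_Ioo_of_le (hle j)).2 ?_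
      exact (integrableOn_const (by simp)).congr_fun (hcongr j) measurableSet_Ioo
  simp only [Nat.cast_zero, zero_mul] at key
  rw [← key, Finset.mul_sum]
  refine Finset.sum_congr rfl fun j _ => ?_
  rw [intervalIntegral.integral_of_le (hle j), integral_Ioc_eq_integral_Ioo,
    ← setIntegral_congr_fun measurableSet_Ioo (hcongr j), setIntegral_const, measureReal_def,
    Real.volume_Ioo, ENNReal.toReal_ofReal (sub_nonneg.2 (hle j)), smul_eq_mul]
  push_cast
  ring

lemma walkGen_walkScaleSum_sub {p : ℕ → ℝ} (h0 : p 0 ≠ 0) (hs : Summable p) (q r : ℝ) (n : ℕ) :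
    walkGen p (fun k => walkScaleSum p q k - r * walkScaleInt p (q + ∑' i, p i) k) n =
      q * (walkScaleSum p q n - r * walkScaleInt p (q + ∑' i, p i) n) := by
  have h1 := (hasSum_walkGen_walkScaleSum h0 hs q n).sub
    ((hasSum_walkGen_walkScaleInt h0 hs (q + ∑' i, p i) n).mul_left r)
  rw [walkScaleInt_natCast, walkGen, show q * (walkScaleSum p q n -
    r * walkScale p (q + ∑' i, p i) n) = q * walkScaleSum p q n -
      r * ((q + ∑' i, p i - ∑' i, p i) * walkScale p (q + ∑' i, p i) n) by ring, ← h1.tsum_eq]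
  refine tsum_congr fun i => ?_
  rw [walkScaleInt_natCast]
  ring

/-- For lattice values, lying strictly below `-x` means having index below `-⌊x/h⌋`, although `x`
need not be on the lattice. Hence the two ways of leaving the index interval decide which entrance
time comes first. -/
lemma entranceBelow_lt_entranceAbove_of_exit {f : ℝ≥0 → ℝ} {h : ℝ} (hh : 0 < h)
    (hc : ∀ t, ContinuousWithinAt f (Set.Ici t) t) (hl : ∀ s, f s ∈ lattice h) {x : ℝ} (hx : 0 ≤ x)
    {m : ℤ} (hm : 0 ≤ m) {t : ℝ≥0} (hlt : ∀ s < t, ⌊f s / h⌋ ∈ Set.Ico (-(⌊x / h⌋)) m) :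
    (⌊f t / h⌋ < -⌊x / h⌋ → entranceBelow x f = t ∧ (t : ℝ≥0∞) < entranceAbove (h * m) f) ∧
      (m ≤ ⌊f t / h⌋ → ¬ entranceBelow x f < entranceAbove (h * m) f) := by
  have hbelow : (t : ℝ≥0∞) ≤ entranceBelow x f := by
    refine le_iInf₂ fun s hs => ENNReal.coe_le_coe.2 (not_lt.1 fun hst => ?_)
    have h1 : ((-⌊x / h⌋ : ℤ) : ℝ) ≤ f s / h := Int.le_floor.1 (hlt s hst).1
    have h2 : (⌊x / h⌋ : ℝ) ≤ x / h := Int.floor_le _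
    push_cast at h1
    have h3 : -(x / h) ≤ f s / h := by linarith
    rw [← neg_div, div_le_div_iff_of_pos_right hh] at h3
    linarith
  refine ⟨fun ht => ⟨le_antisymm (iInf₂_le t ?_) hbelow, ?_⟩, fun ht => ?_⟩
  · obtain ⟨k, hk⟩ := hl t
    rw [hk, mul_div_cancel_left₀ _ hh.ne', Int.floor_intCast] at ht
    have h1 : x / h < ((-k : ℤ) : ℝ) := Int.floor_lt.1 (by omega)
    rw [div_lt_iff₀ hh] at h1
    push_cast at h1
    rw [hk]
    linarith
  · refine lt_entranceAbove hh hc hl fun s hs => ?_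
    have h0 : 0 ≤ ⌊x / h⌋ := Int.floor_nonneg.2 (by positivity)
    have h2 : ⌊f s / h⌋ < m := by
      rcases hs.lt_or_eq with hs | rfl
      · exact (hlt s hs).2
      · omega
    have h3 := Int.floor_lt.1 h2
    rw [div_lt_iff₀ hh] at h3
    linarith
  · have h1 := Int.le_floor.1 ht
    rw [le_div_iff₀ hh] at h1
    exact not_lt.2 ((entranceAbove_le (by linarith)).trans hbelow)

namespace IsUpwardsSkipFreeLevyChain

variable {Ω : Type*} [mΩ : MeasurableSpace Ω] {P : Measure Ω} [IsProbabilityMeasure P]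
  {ℱ : Filtration ℝ≥0 mΩ} {X : ℝ≥0 → Ω → ℝ} {lam : Measure ℝ} {h : ℝ}
  (hX : IsUpwardsSkipFreeLevyChain P ℱ X lam h)
include hX

lemma isWalkProcess : IsWalkProcess P X h (jumpRate lam h) := by
  have h1 : jumpRate (levyTilt lam 0) h = jumpRate lam h := by
    ext i
    rw [hX.isSkipFreeMeasure.jumpRate_levyTilt, zero_mul, Real.exp_zero, mul_one]
  rw [← h1]
  refine hX.isWalkProcess_of_tilt le_rfl hX.measurable (fun ω t => (hX.cadlag ω t).1)
    fun t B hB => ?_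
  simp [tiltDensity, psi]

/-- Existence makes the chosen measure satisfy the tilting identity, which alone determines the
one-step estimate. -/
lemma isWalkProcess_expTilt {c : ℝ} (hc : 0 ≤ c) :
    IsWalkProcess (expTilt P X lam h c) (fun t (f : PathSpace h) => f.1 t) h
      (jumpRate (levyTilt lam c) h) :=
  hX.isWalkProcess_of_tilt hc (fun t => (measurable_pi_apply t).comp measurable_subtype_coe)
    (fun f t => (f.2.1 t).1) (Classical.epsilon_spec (hX.exists_isExpTilt hc))

omit [IsProbabilityMeasure P] in
lemma walkScale_jumpRate_eq {q : ℝ} (hq : 0 ≤ q) (n : ℕ) :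
    Real.exp (Phi lam q * h) ^ n * walkScale (jumpRate (levyTilt lam (Phi lam q)) h)
      (∑' i, jumpRate (levyTilt lam (Phi lam q)) h i) n
      = walkScale (jumpRate lam h) (q + ∑' i, jumpRate lam h i) n := by
  have hν := hX.isSkipFreeMeasure
  rw [hν.tsum_jumpRate_levyTilt (hν.Phi_nonneg hq), hν.psi_Phi hq,
    ← walkScale_zpow_mul hν.jumpRate_zero_pos.ne' _ (Real.exp_pos (Phi lam q * h)).ne']
  congr 2
  ext i
  rw [hν.jumpRate_levyTilt, exp_zpow_one_sub, mul_assoc]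

omit [IsProbabilityMeasure P] in
lemma walkScale_jumpRate_pos {q : ℝ} (hq : 0 ≤ q) (n : ℕ) :
    0 < walkScale (jumpRate lam h) (q + ∑' i, jumpRate lam h i) n := by
  have hν := hX.isSkipFreeMeasure
  have hνc := hν.levyTilt (hν.Phi_nonneg hq)
  rw [← hX.walkScale_jumpRate_eq hq]
  exact mul_pos (pow_pos (Real.exp_pos _) _) (zero_lt_one.trans_le
    (one_le_walkScale (jumpRate_nonneg _ h) hνc.jumpRate_zero_pos hνc.summable_jumpRate n))

/-- The `1 +` in `⌊1 + x/h⌋` supplies an extra `exp (Φ(q) h)`; it cancels the one in the tilted rate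
`p 0 * exp (Φ(q) h)` of the normalizing constant. -/
lemma scaleWq_eq {q x : ℝ} (hq : 0 ≤ q) (hx : 0 ≤ x) :
    scaleWq P X lam h q x = walkScale (jumpRate lam h) (q + ∑' i, jumpRate lam h i) ⌊x / h⌋₊ /
      (h * jumpRate lam h 0) := by
  have hν := hX.isSkipFreeMeasure
  have hh := hν.step_pos
  have h0 := hν.jumpRate_zero_pos
  have hc := hν.Phi_nonneg hq
  have hνc := hν.levyTilt hc
  have hW := hX.isWalkProcess_expTilt hc
  have hfl : ((⌊1 + x / h⌋ : ℤ) : ℝ) = ⌊x / h⌋₊ + 1 := by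
    rw [add_comm, Int.floor_add_one, Int.cast_add, Int.cast_one,
      natCast_floor_eq_intCast_floor (by positivity)]
  rw [scaleWq, scaleW, if_pos hx, hνc.scaleConst_eq fun x _ => hνc.scaleRaw_eq hW x,
    hνc.scaleRaw_eq hW, ← hX.walkScale_jumpRate_eq hq, hν.jumpRate_levyTilt, hfl, ← Real.exp_nat_mul,
    show Phi lam q * ((⌊x / h⌋₊ : ℝ) + 1) * h =
      ⌊x / h⌋₊ * (Phi lam q * h) + Phi lam q * h by ring, Real.exp_add]
  simp only [Nat.cast_zero, sub_zero, mul_one]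
  have h1 := Real.exp_pos (Phi lam q * h)
  field_simp

lemma scaleZq_eq {q x : ℝ} (hq : 0 ≤ q) (hx : 0 ≤ x) :
    scaleZq P X lam h q x = walkScaleSum (jumpRate lam h) q ⌊x / h⌋₊ := by
  have hh := hX.step_pos
  have h0 := hX.isSkipFreeMeasure.jumpRate_zero_pos
  rw [scaleZq, if_pos hx, walkScaleSum, Int.toNat_natCast,
    ← natCast_floor_eq_intCast_floor (show 0 ≤ x / h by positivity),
    intervalIntegral_floor_div (a := fun n => walkScale (jumpRate lam h)
      (q + ∑' i, jumpRate lam h i) n / (h * jumpRate lam h 0)) hh fun x hx => hX.scaleWq_eq hq hx, ← Finset.sum_div]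
  field_simp

end IsUpwardsSkipFreeLevyChain

end LevyChain
-- The proposition
theorem mainTheorem12 {Ω : Type*} [mΩ : MeasurableSpace Ω] (P : Measure Ω)
    [IsProbabilityMeasure P] (ℱ : Filtration ℝ≥0 mΩ) (X : ℝ≥0 → Ω → ℝ) (lam : Measure ℝ) (h : ℝ)
    (hX : LevyChain.IsUpwardsSkipFreeLevyChain P ℱ X lam h)
    (q x y : ℝ) (hq : 0 ≤ q) (hx : 0 ≤ x) (hy : 0 ≤ y) (hyh : y ∈ LevyChain.lattice h) :
    Integrable
        ({ω | LevyChain.entranceBelow x (fun t => X t ω)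
            < LevyChain.entranceAbove y (fun t => X t ω)}.indicator
          (fun ω => Real.exp (-(q * (LevyChain.entranceBelow x (fun t => X t ω)).toReal)))) P ∧
      ∫ ω, {ω | LevyChain.entranceBelow x (fun t => X t ω)
            < LevyChain.entranceAbove y (fun t => X t ω)}.indicator
          (fun ω => Real.exp (-(q * (LevyChain.entranceBelow x (fun t => X t ω)).toReal))) ω ∂P
        = LevyChain.scaleZq P X lam h q x
          - LevyChain.scaleZq P X lam h q (x + y) *
            (LevyChain.scaleWq P X lam h q x / LevyChain.scaleWq P X lam h q (x + y)) := by
  have hν := hX.isSkipFreeMeasure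
  have hh := hX.step_pos
  have h0 := hν.jumpRate_zero_pos
  obtain ⟨m', rfl⟩ := hyh
  have hm' : 0 ≤ m' := by
    by_contra hlt
    push Not at hlt
    have : (m' : ℝ) < 0 := by exact_mod_cast hlt
    nlinarith
  obtain ⟨m, rfl⟩ := Int.eq_ofNat_of_zero_le hm'
  have hxy : ⌊(x + h * (m : ℤ)) / h⌋₊ = ⌊x / h⌋₊ + m := by
    rw [add_div, mul_div_cancel_left₀ _ hh.ne', Int.cast_natCast,
      Nat.floor_add_natCast (by positivity)]
  rw [hX.scaleZq_eq hq hx, hX.scaleZq_eq hq (add_nonneg hx hy), hX.scaleWq_eq hq hx,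
    hX.scaleWq_eq hq (add_nonneg hx hy), hxy]
  have hfl : ⌊x / h⌋ = (⌊x / h⌋₊ : ℤ) := (Int.natCast_floor_eq_floor (by positivity)).symm
  set n := ⌊x / h⌋₊ with hn
  set p := LevyChain.jumpRate lam h with hp
  have hw := hX.walkScale_jumpRate_pos hq
  set w := LevyChain.walkScale p (q + ∑' i, p i) with hwdef
  -- The coefficient of `w` that makes `F` vanish at the upper level, so that only exits below
  -- contribute.
  set r := LevyChain.walkScaleSum p q (n + m : ℕ) / w (n + m) with hr
  set F : ℤ → ℝ := fun k => LevyChain.walkScaleSum p q k -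
    r * LevyChain.walkScaleInt p (q + ∑' i, p i) k with hF
  have hFn : ∀ k : ℕ, F k = LevyChain.walkScaleSum p q k - r * w k := fun k => by
    simp only [hF, LevyChain.walkScaleInt_natCast, hwdef]
  have hFneg : ∀ k : ℤ, k < 0 → F k = 1 := fun k hk => by
    simp only [hF, LevyChain.walkScaleInt_of_neg _ _ hk, LevyChain.walkScaleSum_of_nonpos _ _ hk.le,
      mul_zero, sub_zero]
  have hFtop : F ((m : ℤ) + n) = 0 := by
    rw [show (m : ℤ) + n = (n + m : ℕ) by push_cast; ring, hFn, hr, div_mul_cancel₀ _ (hw _).ne',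
      sub_self]
  -- The walk starts at 0, hence the shift by `n`. Truncating at `m` gives boundedness without
  -- affecting the generator below `m`.
  set g : ℤ → ℝ := fun k => F (min k m + n) with hg
  obtain ⟨M, hM⟩ : ∃ M, ∀ k, |g k| ≤ M := by
    refine LevyChain.exists_abs_le_of_eventually_const (a := -(n : ℤ) - 1) (b := m) (by omega)
      (fun k hk => ?_) fun k hk => ?_
    · simp only [hg]
      rw [hFneg _ (by omega), hFneg _ (by omega)]
    · simp only [hg]
      rw [min_eq_right hk, min_self]
  have hgen : ∀ k ∈ Set.Ico (-(n : ℤ)) m, LevyChain.walkGen p g k = q * g k := by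
    rintro k ⟨hk1, hk2⟩
    rw [LevyChain.walkGen_congr (g := fun j => F (j + n)) fun j hj => by
      simp only [hg]; rw [min_eq_left (by omega)], LevyChain.walkGen_shift]
    obtain ⟨j, hj⟩ := Int.eq_ofNat_of_zero_le (show 0 ≤ k + n by omega)
    simp only [hg]
    rw [min_eq_left hk2.le, hj]
    exact LevyChain.walkGen_walkScaleSum_sub h0.ne' hν.summable_jumpRate q r j
  have hg0 : g 0 = LevyChain.walkScaleSum p q n - LevyChain.walkScaleSum p q (n + m : ℕ) *
      (w n / (h * p 0) / (w (n + m) / (h * p 0))) := by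
    have h1 := (hw (n + m)).ne'
    have h2 := h0.ne'
    simp only [hg]
    rw [min_eq_left (by omega), zero_add, hFn, hr]
    field_simp
  rw [← hg0]
  refine hX.isWalkProcess.integral_exit (hν.ae_exists_exit_Ico hX.isWalkProcess (-(n : ℤ)) m) hq hM
    hgen ?_
  filter_upwards [hX.ae_mem_lattice] with ω hω t ht hlt
  rw [← hfl] at ht hlt
  obtain ⟨hdown, hup⟩ := LevyChain.entranceBelow_lt_entranceAbove_of_exit hh (fun t => (hX.cadlag ω t).1) hω hx
    hm' hlt
  simp only [Set.mem_Ico, not_and_or, not_le, not_lt] at ht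
  rcases ht with ht | ht
  · obtain ⟨h1, h2⟩ := hdown ht
    -- On this event the entrance time below equals the finite exit time `t`, so `toReal` does not
    -- meet its default value at `∞`.
    rw [Set.indicator_of_mem (by rwa [Set.mem_ofPred_eq, h1]), h1, ENNReal.coe_toReal]
    simp only [hg]
    rw [hFneg _ (by omega), mul_one]
  · rw [Set.indicator_of_notMem (by rw [Set.mem_ofPred_eq]; exact hup ht)]
    simp only [hg]
    rw [min_eq_right ht, hFtop, mul_zero]
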